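/- Conventions. Variables are named by binary words. A clause is a finite set of literals, read as a disjunction; a CNF formula is a finite set of clauses, read as a conjunction; $\bot$ is the CNF formula consisting of the empty clause. $\mathrm{CNF}$ is the class of all CNF formulas, and $\mathrm{ID}$ is the class of the CNF formulas in which every clause contains at most one literal and that literal is positive (so every clause is a positive unit clause $\{x\}$ or the empty clause). For a set $S$ of CNF formulas, $\mathrm{Th}(S)$ is the set of CNF formulas entailed by $S$. A default theory $\langle W,D\rangle$ consists of a finite set $W$ of CNF formulas and a finite set $D$ of default rules $\frac{\alpha:\beta}{\gamma}$ with CNF formulas $\alpha,\beta,\gamma$; it is a $\Theta$-default theory if all these formulas lie in the class $\Theta$. For a set $E$ of CNF formulas, $\Gamma(E)$ is the smallest set with $W\subseteq\Gamma(E)$, $\Gamma(E)=\mathrm{Th}(\Gamma(E))$, and $\gamma\in\Gamma(E)$ for every $\frac{\alpha:\beta}{\gamma}\in D$ with $\alpha\in\Gamma(E)$ and $\neg\beta\notin E$ (where $\neg\beta\in E$ means that $E$ contains a CNF formula equivalent to $\neg\beta$). $E$ is a stable extension if $E=\Gamma(E)$, and it is consistent if $\bot\notin E$. For a literal $\ell$,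 the reduct $\varphi[\ell]$ of a CNF formula $\varphi$ arises by deleting all clauses that contain $\ell$ and deleting the literal complementary to $\ell$ from the remaining clauses. For a symbol $x_\varepsilon$ ($x$ a variable), $\varphi[x_\varepsilon]$ arises by deleting $x$ and $\neg x$ from all clauses. For a finite set $B$ of variables, a threefold assignment set over $B$ contains exactly one of $x,\neg x,x_\varepsilon$ for each $x\in B$ and nothing else, and $\varphi[Y]$ is the result of the consecutive reducts by the elements of such a set $Y$. The reduct of $\langle W,D\rangle$ by $Y$ has the knowledge base $\bigcup_{\omega\in W}\omega[Y]$ and, for every $\delta=\frac{\alpha:\beta}{\gamma}\in D$, the rule $\frac{\alpha[Y]:\beta[Y]}{\gamma[Y]\wedge y_\delta}$ with a fresh variable $y_\delta$. A set $B$ of variables of $\langle W,D\rangle$ is a strong $\Theta'$-backdoor of $\langle W,D\rangle$ if for every threefold assignment set $Y$ over $B$ the reduct of $\langle W,D\rangle$ by $Y$ is a $\Theta'$-default theory. $\mathrm{SBD}_{\mathrm{expl}}(\Theta\to\Theta')$ is the following parameterised problem. Input: a $\Theta$-default theory $\langle W,D\rangle$ and a strong $\Theta'$-backdoor $B$ of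 it, written explicitly as a word over a fixed finite alphabet. Parameter: $|B|$. Question: does $\langle W,D\rangle$ have a stable extension? (Words that do not encode such an instance with the given parameter value are no-instances.) A parameterised problem $L\subseteq\Sigma^*\times\mathbb N$ is in $\mathrm{FPT}$ if there are a finite alphabet $\Sigma'$, a computable function $f:\mathbb N\to\Sigma'^*$ and a problem $L'\subseteq\Sigma^*\times\Sigma'^*$ that is decidable in polynomial time by a Turing machine, such that $(x,k)\in L\iff(x,f(k))\in L'$ for all $x,k$. Corollary. $\mathrm{SBD}_{\mathrm{expl}}(\mathrm{CNF}\to\mathrm{ID})\in\mathrm{FPT}$. The same holds for the variant of the problem that asks for a consistent stable extension. -/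

import Mathlib

namespace DefaultLogic

/-! ### Clauses, CNF formulas, consequence -/

/-- A literal over the variables `V`. -/
inductive Literal (V : Type) where
  | pos (x : V)
  | neg (x : V)
  deriving DecidableEq

namespace Literal

variable {V U : Type}

/-- The variable of a literal. -/
def var : Literal V → V
  | pos x => x
  | neg x => x

/-- The complementary literal. -/
def compl : Literal V → Literal V
  | pos x => neg x
  | neg x => pos x

/-- Renaming of variables. -/
def map (f : V → U) : Literal V → Literal U
  | pos x => pos (f x)
  | neg x => neg (f x)

/-- The literal `l` is true under the truth assignment `v`. -/
def Holds (v : V → Bool) : Literal V → Prop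
  | pos x => v x = true
  | neg x => v x = false

end Literal

/-- A clause is a finite set of literals, read as their disjunction. -/
abbrev Clause (V : Type) := Finset (Literal V)

/-- A CNF formula is a finite set of clauses, read as their conjunction. -/
abbrev CNF (V : Type) := Finset (Clause V)

section

variable {V U : Type} [DecidableEq V] [DecidableEq U]

/-- The truth assignment `v` satisfies `φ`. -/
def CNF.Sat (v : V → Bool) (φ : CNF V) : Prop :=
  ∀ C ∈ φ, ∃ l ∈ C, Literal.Holds v l

/-- The formula `⊥`, consisting of the empty clause only. -/
def CNF.bot : CNF V := {∅}

/-- The variables of a formula. -/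
def CNF.vars (φ : CNF V) : Finset V :=
  φ.biUnion fun C => C.image Literal.var

/-- Renaming of variables. -/
def CNF.rename (f : V → U) (φ : CNF V) : CNF U :=
  φ.image fun C => C.image (Literal.map f)

/-- `S ⊨ ψ` for a (possibly infinite) set `S` of formulas. -/
def Entails (S : Set (CNF V)) (ψ : CNF V) : Prop :=
  ∀ v : V → Bool, (∀ φ ∈ S, CNF.Sat v φ) → CNF.Sat v ψ

/-- The deductive closure `Th(S)`, within the CNF formulas. -/
def Th (S : Set (CNF V)) : Set (CNF V) := {ψ | Entails S ψ}

/-- `ψ` is a CNF formula expressing `¬β`. -/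
def IsNegationOf (ψ β : CNF V) : Prop :=
  ∀ v : V → Bool, CNF.Sat v ψ ↔ ¬ CNF.Sat v β

/-- `¬β ∈ E`: since the negation of a CNF formula is a CNF formula only up to equivalence, this
says that some CNF formula expressing `¬β` belongs to `E`. -/
def NegMem (β : CNF V) (E : Set (CNF V)) : Prop :=
  ∃ ψ ∈ E, IsNegationOf ψ β

end

/-! ### Default theories and stable extensions -/

/-- The default rule `prereq : just / concl`. -/
structure Default (V : Type) where
  prereq : CNF V
  just : CNF V
  concl : CNF V
  deriving DecidableEq

/-- A (finite) default theory `⟨W, D⟩`. -/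
structure DefaultTheory (V : Type) where
  W : Finset (CNF V)
  D : Finset (Default V)

/-- The variables of a default rule. -/
def Default.vars {V : Type} [DecidableEq V] (δ : Default V) : Finset V :=
  δ.prereq.vars ∪ δ.just.vars ∪ δ.concl.vars

namespace DefaultTheory

/-- The variables of a default theory. -/
def vars {V : Type} [DecidableEq V] (T : DefaultTheory V) : Finset V :=
  T.W.biUnion CNF.vars ∪ T.D.biUnion Default.vars

variable {V : Type}

/-- The three conditions on `S` in the definition of `Γ(E)`. -/
structure GammaClosed (T : DefaultTheory V) (E S : Set (CNF V)) : Prop where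
  base : ∀ φ ∈ T.W, φ ∈ S
  closed : S = Th S
  rules : ∀ δ ∈ T.D, δ.prereq ∈ S → ¬ NegMem δ.just E → δ.concl ∈ S

/-- `Γ(E)`, the smallest set satisfying the three conditions. -/
def Gamma (T : DefaultTheory V) (E : Set (CNF V)) : Set (CNF V) :=
  ⋂₀ {S | T.GammaClosed E S}

/-- `Γ(E)` satisfies the three conditions, hence it is the smallest set that does. -/
theorem gamma_isLeast (T : DefaultTheory V) (E : Set (CNF V)) :
    IsLeast {S | T.GammaClosed E S} (T.Gamma E) := by
  refine ⟨⟨?_, ?_, ?_⟩, fun S hS => Set.sInter_subset_of_mem hS⟩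
  · intro φ hφ S hS
    exact hS.base φ hφ
  · apply Set.Subset.antisymm
    · intro ψ hψ v hv
      exact hv ψ hψ
    · intro ψ hψ S hS
      rw [hS.closed]
      intro v hv
      exact hψ v fun φ hφ => hv φ (hφ S hS)
  · intro δ hδ hp hj S hS
    exact hS.rules δ hδ (hp S hS) hj

/-- `E` is a stable extension of `T`. -/
def IsStableExtension (T : DefaultTheory V) (E : Set (CNF V)) : Prop :=
  E = T.Gamma E

/-- `T` has a stable extension. -/
def HasStableExtension (T : DefaultTheory V) : Prop :=
  ∃ E, T.IsStableExtension E

/-- `T` has a consistent stable extension, that is, one that does not contain `⊥`. -/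
def HasConsistentStableExtension (T : DefaultTheory V) : Prop :=
  ∃ E, T.IsStableExtension E ∧ CNF.bot ∉ E

end DefaultTheory

/-! ### Classes of formulas -/

/-- A class of CNF formulas (over any set of variables). -/
abbrev FormulaClass := ∀ V : Type, Set (CNF V)

/-- The class of all CNF formulas. -/
def classCNF : FormulaClass := fun _ => Set.univ

/-- The class ID: every clause contains at most one literal, and that literal is positive. So the
clauses are the positive unit clauses `{x}` and the empty clause; the latter arises when reducts
delete literals and has to be allowed for the class to be closed under subformulas. -/
def classID : FormulaClass := fun _ => {φ | ∀ C ∈ φ, C = ∅ ∨ ∃ x, C = {Literal.pos x}}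

/-- `T` is a `Θ`-default theory. -/
def DefaultTheory.InClass {V : Type} (Θ : FormulaClass) (T : DefaultTheory V) : Prop :=
  (∀ φ ∈ T.W, φ ∈ Θ V) ∧
    ∀ δ ∈ T.D, δ.prereq ∈ Θ V ∧ δ.just ∈ Θ V ∧ δ.concl ∈ Θ V

/-! ### Reducts and strong backdoors -/

/-- Extended literals: a literal, or `x_ε` for a variable `x`. -/
inductive ExtLiteral (V : Type) where
  | lit (l : Literal V)
  | eps (x : V)

/-- The variable of an extended literal. -/
def ExtLiteral.var {V : Type} : ExtLiteral V → V
  | lit l => l.var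
  | eps x => x

section

variable {V : Type} [DecidableEq V]

/-- The reduct of `φ` by one extended literal. -/
def CNF.reduct (φ : CNF V) : ExtLiteral V → CNF V
  | .lit l => (φ.filter fun C => l ∉ C).image fun C => C.erase l.compl
  | .eps x => φ.image fun C => (C.erase (Literal.pos x)).erase (Literal.neg x)

/-- Consecutive application of the reducts by the extended literals in `Y`. -/
def CNF.reducts (φ : CNF V) (Y : List (ExtLiteral V)) : CNF V :=
  Y.foldl CNF.reduct φ

/-- `Y` lists (in some order) a threefold assignment set over `B`: it contains exactly one of
`x`, `¬x`, `x_ε` for each `x ∈ B`, and nothing else. -/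
def IsThreefoldAssignment (B : Finset V) (Y : List (ExtLiteral V)) : Prop :=
  (Y.map ExtLiteral.var).Nodup ∧ (Y.map ExtLiteral.var).toFinset = B

/-- The reduct of a default theory. The fresh variable `y_δ` attached to the rule `δ` is
`Sum.inr δ`; the old variables `x` become `Sum.inl x`. -/
def DefaultTheory.reducts (T : DefaultTheory V) (Y : List (ExtLiteral V)) :
    DefaultTheory (V ⊕ Default V) where
  W := {CNF.rename Sum.inl (T.W.biUnion fun ω => CNF.reducts ω Y)}
  D := T.D.image fun δ =>
    { prereq := CNF.rename Sum.inl (CNF.reducts δ.prereq Y)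
      just := CNF.rename Sum.inl (CNF.reducts δ.just Y)
      concl := CNF.rename Sum.inl (CNF.reducts δ.concl Y) ∪ {{Literal.pos (Sum.inr δ)}} }

/-- `B` is a strong `Θ`-backdoor of `T`. -/
def DefaultTheory.IsStrongBackdoor (Θ : FormulaClass) (T : DefaultTheory V) (B : Finset V) :
    Prop :=
  B ⊆ T.vars ∧ ∀ Y, IsThreefoldAssignment B Y → (T.reducts Y).InClass Θ

end

/-! ### Inputs as words -/

/-- Variables are named by binary words. -/
abbrev Var := List Bool

/-- The finite input alphabet. -/
inductive Symb where
  | bit (b : Bool)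
  | pos
  | neg
  | endVar
  | endClause
  | endFormula
  | endPart
  deriving DecidableEq, Fintype

/-- Words for lists: the words of the entries one after the other, closed by the terminator `t`. -/
def encodeListWith {α : Type} (t : Symb) (c : α → List Symb) (l : List α) : List Symb :=
  l.flatMap c ++ [t]

/-- Word of a variable. -/
def encodeVar : Var → List Symb := encodeListWith .endVar fun b => [Symb.bit b]

/-- Word of a literal. -/
def encodeLiteral : Literal Var → List Symb
  | .pos x => Symb.pos :: encodeVar x
  | .neg x => Symb.neg :: encodeVar x

/-- Clauses and formulas as they are written in the input. -/
abbrev RawCNF := List (List (Literal Var))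

/-- Word of a formula. -/
def encodeCNF : RawCNF → List Symb :=
  encodeListWith .endFormula (encodeListWith .endClause encodeLiteral)

/-- Word of a default rule. -/
def encodeDefault (d : RawCNF × RawCNF × RawCNF) : List Symb :=
  encodeCNF d.1 ++ encodeCNF d.2.1 ++ encodeCNF d.2.2

/-- The formula that is written as `r`. -/
def RawCNF.toCNF (r : RawCNF) : CNF Var :=
  (r.map List.toFinset).toFinset

/-- An instance, as written in the input: a default theory together with a set of variables. -/
structure RawInstance where
  kb : List RawCNF
  rules : List (RawCNF × RawCNF × RawCNF)
  backdoor : List Var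

namespace RawInstance

/-- The input word. -/
def encode (I : RawInstance) : List Symb :=
  encodeListWith .endPart encodeCNF I.kb ++
    (encodeListWith .endPart encodeDefault I.rules ++
      encodeListWith .endPart encodeVar I.backdoor)

/-- The default theory of the instance. -/
def theory (I : RawInstance) : DefaultTheory Var where
  W := (I.kb.map RawCNF.toCNF).toFinset
  D := (I.rules.map fun d =>
    { prereq := RawCNF.toCNF d.1, just := RawCNF.toCNF d.2.1,
      concl := RawCNF.toCNF d.2.2 : Default Var }).toFinset

/-- The set of variables given with the instance. -/
def backdoorSet (I : RawInstance) : Finset Var := I.backdoor.toFinset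

end RawInstance

/-! The input words determine the instance. -/

theorem encodeListWith_inj {α : Type} {t : Symb} {c : α → List Symb}
    (hhead : ∀ a, ∃ s w, c a = s :: w ∧ s ≠ t)
    (hc : ∀ a b r s, c a ++ r = c b ++ s → a = b ∧ r = s) :
    ∀ (l m : List α) (r s : List Symb),
      encodeListWith t c l ++ r = encodeListWith t c m ++ s → l = m ∧ r = s := by
  intro l
  induction l with
  | nil =>
    intro m r s h
    cases m with
    | nil => simpa [encodeListWith] using h
    | cons b m =>
      obtain ⟨x, w, hx, hne⟩ := hhead b
      simp [encodeListWith, hx] at h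
      exact absurd h.1.symm hne
  | cons a l ih =>
    intro m r s h
    cases m with
    | nil =>
      obtain ⟨x, w, hx, hne⟩ := hhead a
      simp [encodeListWith, hx] at h
      exact absurd h.1 hne
    | cons b m =>
      have h' : c a ++ (encodeListWith t c l ++ r) = c b ++ (encodeListWith t c m ++ s) := by
        simpa [encodeListWith] using h
      obtain ⟨rfl, h2⟩ := hc _ _ _ _ h'
      obtain ⟨rfl, rfl⟩ := ih m r s h2
      exact ⟨rfl, rfl⟩

theorem encodeListWith_head {α : Type} {t u : Symb} {c : α → List Symb} (htu : t ≠ u)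
    (hhead : ∀ a, ∃ s w, c a = s :: w ∧ s ≠ u) (l : List α) :
    ∃ s w, encodeListWith t c l = s :: w ∧ s ≠ u := by
  cases l with
  | nil => exact ⟨t, [], by simp [encodeListWith], htu⟩
  | cons a l =>
    obtain ⟨x, w, hx, hne⟩ := hhead a
    exact ⟨x, w ++ encodeListWith t c l, by simp [encodeListWith, hx], hne⟩

theorem encodeVar_inj : ∀ (x y : Var) (r s : List Symb),
    encodeVar x ++ r = encodeVar y ++ s → x = y ∧ r = s :=
  encodeListWith_inj (fun _ => ⟨_, [], rfl, by simp⟩) (by simp)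

theorem encodeLiteral_inj (l m : Literal Var) (r s : List Symb)
    (h : encodeLiteral l ++ r = encodeLiteral m ++ s) : l = m ∧ r = s := by
  cases l <;> cases m <;> simp [encodeLiteral] at h
  all_goals
    obtain ⟨rfl, rfl⟩ := encodeVar_inj _ _ _ _ h
    exact ⟨rfl, rfl⟩

theorem encodeLiteral_head {u : Symb} (h1 : Symb.pos ≠ u) (h2 : Symb.neg ≠ u) (l : Literal Var) :
    ∃ s w, encodeLiteral l = s :: w ∧ s ≠ u := by
  cases l
  · exact ⟨_, _, rfl, h1⟩
  · exact ⟨_, _, rfl, h2⟩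

theorem encodeCNF_inj : ∀ (φ ψ : RawCNF) (r s : List Symb),
    encodeCNF φ ++ r = encodeCNF ψ ++ s → φ = ψ ∧ r = s :=
  encodeListWith_inj
    (encodeListWith_head (by simp) (encodeLiteral_head (by simp) (by simp)))
    (encodeListWith_inj (encodeLiteral_head (by simp) (by simp)) encodeLiteral_inj)

theorem encodeCNF_head : ∀ φ : RawCNF, ∃ s w, encodeCNF φ = s :: w ∧ s ≠ .endPart :=
  encodeListWith_head (by simp)
    (encodeListWith_head (by simp) (encodeLiteral_head (by simp) (by simp)))

theorem RawInstance.encode_injective : Function.Injective RawInstance.encode := by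
  rintro ⟨k₁, d₁, b₁⟩ ⟨k₂, d₂, b₂⟩ h
  obtain ⟨rfl, h⟩ := encodeListWith_inj encodeCNF_head encodeCNF_inj _ _ _ _ h
  have hd := encodeListWith_inj (t := .endPart) (c := encodeDefault)
    (fun d => by
      obtain ⟨s, w, hs, hne⟩ := encodeCNF_head d.1
      exact ⟨s, w ++ encodeCNF d.2.1 ++ encodeCNF d.2.2, by simp [encodeDefault, hs], hne⟩)
    (fun a b r s h => by
      obtain ⟨a1, a2, a3⟩ := a
      obtain ⟨b1, b2, b3⟩ := b
      simp only [encodeDefault, List.append_assoc] at h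
      obtain ⟨h1, h⟩ := encodeCNF_inj _ _ _ _ h
      obtain ⟨h2, h⟩ := encodeCNF_inj _ _ _ _ h
      obtain ⟨h3, h⟩ := encodeCNF_inj _ _ _ _ h
      exact ⟨by rw [h1, h2, h3], h⟩)
  obtain ⟨rfl, h⟩ := hd _ _ _ _ h
  have hb := encodeListWith_inj (t := .endPart) (c := encodeVar)
    (encodeListWith_head (by simp) (fun _ => ⟨_, [], rfl, by simp⟩)) encodeVar_inj
  obtain ⟨rfl, -⟩ := hb b₁ b₂ [] [] (by simpa using h)
  rfl

/-! ### Complexity classes -/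

/-- A parameterised problem over the alphabet `A`. -/
abbrev ParamProblem (A : Type) := Set (List A × ℕ)

open Classical in
/-- The problem `S` is in P, with instances written by the encoding `e`: some (multi-stack) Turing
machine decides `S` within a number of steps polynomial in the length of the input word. -/
def InP {α A : Type} [Fintype A] (e : Computability.Encoding α A) (S : Set α) : Prop :=
  Nonempty (Turing.TM2ComputableInPolyTime e.encode Computability.encodeBool
    fun a => decide (a ∈ S))

/-- FPT = para-P: there are a finite alphabet `Fin m`, a computable `f : ℕ → (Fin m)*` and a
problem `L' ⊆ A* × (Fin m)*` in P such that `(x, k) ∈ L ↔ (x, f k) ∈ L'`. -/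
def InFPT {A : Type} [Fintype A] (L : ParamProblem A) : Prop :=
  ∃ (m : ℕ) (f : ℕ → List (Fin m)) (L' : Set (List A × List (Fin m))),
    Computable f ∧
      InP (Computability.encodingProd (Computability.encodingList A)
        (Computability.encodingList (Fin m))) L' ∧
      ∀ x k, (x, k) ∈ L ↔ (x, f k) ∈ L'

/-! ### Strong backdoor evaluation -/

/-- Instances: a `Θ`-default theory with a strong `Θ'`-backdoor `B`; parameter: `|B|`; question:
does the theory have the property `Q`? -/
def backdoorEvaluation (Q : DefaultTheory Var → Prop) (Θ Θ' : FormulaClass) :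
    ParamProblem Symb :=
  {p | ∃ I : RawInstance, I.encode = p.1 ∧ I.theory.InClass Θ ∧
    I.theory.IsStrongBackdoor Θ' I.backdoorSet ∧ I.backdoorSet.card = p.2 ∧ Q I.theory}

/-- Strong backdoor evaluation for the existence of a stable extension. -/
def SBDexpl (Θ Θ' : FormulaClass) : ParamProblem Symb :=
  backdoorEvaluation DefaultTheory.HasStableExtension Θ Θ'

/-- Strong backdoor evaluation for the existence of a consistent stable extension. -/
def consistentSBDexpl (Θ Θ' : FormulaClass) : ParamProblem Symb :=
  backdoorEvaluation DefaultTheory.HasConsistentStableExtension Θ Θ'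

end DefaultLogic

/-! Let `B` be a strong backdoor into ID with `k` variables. Substituting `x_ε` for every `x ∈ B`
shows that each clause has at most one literal outside `B`, and that this literal is positive;
conversely, this syntactic condition makes every reduct an ID theory
(`isStrongBackdoor_classID_iff`). It can be checked without running through the threefold
assignments.

Fix the truth values `v` on `B`. A formula of this shape then becomes a conjunction of positive unit
clauses, possibly with the empty clause. It is satisfiable over `v` exactly if it holds when all
variables outside `B` are true (`greatest`), and in that case it has a least model over `v`
(`least`). All formulas of this shape are monotone in the variables outside `B`, so `r` entails `α`
exactly if, for each of the `2 ^ k` choices of `v`, either `r` fails in the greatest assignment or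
`α` holds in the least model (`entails_iff`).

A stable extension `E` is determined by the list `A` of those `v` for which `E` has a model. A
justification `β` passes exactly if it holds in the greatest assignment over some `v ∈ A`
(`negMem_iff_of_consistentPart`). Once `A` is guessed, the justifications are settled, the remaining
rules are monotone, and `Γ(E)` is the closure obtained by applying rules until nothing changes
(`gamma_eq`). The guess is right if the closure has `A` as its list of consistent assignments. Hence
stable extensions exist exactly if one of the `2 ^ 2 ^ k` candidates for `A` is accepted
(`hasStableExtension_iff`), and a consistent one exists exactly if a nonempty candidate is accepted
(`hasConsistentStableExtension_iff`).

For FPT, the parameter is replaced by a word with `k` marks and `2 ^ 2 ^ k` further symbols, so that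
the search over all candidates is polynomial in the padded input. Actual Turing machines come from
structured stack programs (`Exec.steps`). Above these stands a calculus of functions on tree-coded
data, closed under composition, case distinction and folds whose intermediate values stay
polynomially bounded (`PolyTime.foldl`). A polynomial time test yields a problem in P by
`PolyTime.inP`. -/

/-! ### Structured programs over finitely many stacks -/

namespace StackProgram

open Function (update)

/-- Structured programs acting on stacks `k : K` with alphabets `Γ k` and a register in `σ`. -/
inductive Prog {K : Type} (Γ : K → Type) (σ : Type) : Type
  | push (k : K) (f : σ → Γ k)
  | pop (k : K) (f : σ → Option (Γ k) → σ)
  | load (f : σ → σ)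
  | seq (p q : Prog Γ σ)
  | ite (c : σ → Bool) (p q : Prog Γ σ)
  | loop (c : σ → Bool) (p : Prog Γ σ)

namespace Prog

variable {K : Type} {Γ : K → Type} {σ : Type}

/-- The control points of a program. -/
def Label : Prog Γ σ → Type
  | push _ _ | pop _ _ | load _ => Unit
  | seq p q => Label p ⊕ Label q
  | ite _ p q => Option (Label p ⊕ Label q)
  | loop _ p => Option (Label p)

/-- A program has finitely many control points. -/
@[reducible]
def labelFintype : ∀ p : Prog Γ σ, Fintype p.Label
  | push _ _ | pop _ _ | load _ => inferInstanceAs (Fintype Unit)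
  | seq p q => @instFintypeSum _ _ (labelFintype p) (labelFintype q)
  | ite _ p q => @instFintypeOption _ (@instFintypeSum _ _ (labelFintype p) (labelFintype q))
  | loop _ p => @instFintypeOption _ (labelFintype p)

instance (p : Prog Γ σ) : Fintype p.Label := p.labelFintype

/-- The control point at which a program starts. -/
def entry : ∀ p : Prog Γ σ, p.Label
  | push _ _ | pop _ _ | load _ => ()
  | seq p _ => .inl (entry p)
  | ite _ _ _ => none
  | loop _ _ => none

/-- The Turing machine code of a program whose control points are embedded by `emb` into the
labels of the machine, and which continues at the label `exit`. -/
def code : ∀ (p : Prog Γ σ) {Λ : Type} (_ : p.Label → Λ) (_ : Λ),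
    p.Label → Turing.TM2.Stmt Γ Λ σ
  | push k f, _, _, exit => fun _ => .push k f (.goto fun _ => exit)
  | pop k f, _, _, exit => fun _ => .pop k f (.goto fun _ => exit)
  | load f, _, _, exit => fun _ => .load f (.goto fun _ => exit)
  | seq p q, _, emb, exit => fun l => match l with
    | .inl l => code p (fun l => emb (.inl l)) (emb (.inr (entry q))) l
    | .inr l => code q (fun l => emb (.inr l)) exit l
  | ite c p q, _, emb, exit => fun l => match l with
    | none => .goto fun v => bif c v then emb (some (.inl (entry p)))
        else emb (some (.inr (entry q)))
    | some (.inl l) => code p (fun l => emb (some (.inl l))) exit l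
    | some (.inr l) => code q (fun l => emb (some (.inr l))) exit l
  | loop c p, _, emb, exit => fun l => match l with
    | none => .goto fun v => bif c v then emb (some (entry p)) else exit
    | some l => code p (fun l => emb (some l)) (emb none) l

variable [DecidableEq K]

/-- `Exec p v S v' S' t`: started with register `v` and stacks `S`, the program `p` ends with
register `v'` and stacks `S'` after at most `t` steps. -/
inductive Exec : Prog Γ σ → σ → (∀ k, List (Γ k)) → σ → (∀ k, List (Γ k)) → ℕ → Prop
  | push {k f v S} : Exec (push k f) v S v (update S k (f v :: S k)) 1
  | pop {k f v S} : Exec (pop k f) v S (f v (S k).head?) (update S k (S k).tail) 1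
  | load {f v S} : Exec (load f) v S (f v) S 1
  | seq {p q v S v₁ S₁ v₂ S₂ t₁ t₂} :
      Exec p v S v₁ S₁ t₁ → Exec q v₁ S₁ v₂ S₂ t₂ → Exec (seq p q) v S v₂ S₂ (t₁ + t₂)
  | ite_true {c p q v S v₁ S₁ t} :
      c v = true → Exec p v S v₁ S₁ t → Exec (ite c p q) v S v₁ S₁ (t + 1)
  | ite_false {c p q v S v₁ S₁ t} :
      c v = false → Exec q v S v₁ S₁ t → Exec (ite c p q) v S v₁ S₁ (t + 1)
  | loop_false {c p v S} : c v = false → Exec (loop c p) v S v S 1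
  | loop_true {c p v S v₁ S₁ v₂ S₂ t₁ t₂} :
      c v = true → Exec p v S v₁ S₁ t₁ → Exec (loop c p) v₁ S₁ v₂ S₂ t₂ →
        Exec (loop c p) v S v₂ S₂ (t₁ + t₂ + 1)
  | mono {p v S v' S' t t'} : Exec p v S v' S' t → t ≤ t' → Exec p v S v' S' t'

/-- The machine `M` gets from `c` to `c'` in exactly `n` steps. -/
def Steps {Λ : Type} (M : Λ → Turing.TM2.Stmt Γ Λ σ) (n : ℕ) (c c' : Turing.TM2.Cfg Γ Λ σ) :
    Prop :=
  (flip bind (Turing.TM2.step M))^[n] (some c) = some c'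

theorem Steps.trans {Λ : Type} {M : Λ → Turing.TM2.Stmt Γ Λ σ} {n m : ℕ}
    {c₁ c₂ c₃ : Turing.TM2.Cfg Γ Λ σ} (h : Steps M n c₁ c₂) (h' : Steps M m c₂ c₃) :
    Steps M (n + m) c₁ c₃ := by
  unfold Steps at *
  rw [Nat.add_comm, Function.iterate_add_apply, h, h']

theorem Steps.single {Λ : Type} {M : Λ → Turing.TM2.Stmt Γ Λ σ} {l : Λ} {v : σ}
    {S : ∀ k, List (Γ k)} {c : Turing.TM2.Cfg Γ Λ σ}
    (h : Turing.TM2.stepAux (M l) v S = c) : Steps M 1 ⟨some l, v, S⟩ c := by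
  subst h; rfl

/-- The Turing machine code of a program simulates the program. -/
theorem Exec.steps {p : Prog Γ σ} {v v' : σ} {S S' : ∀ k, List (Γ k)} {t : ℕ}
    (h : Exec p v S v' S' t) :
    ∀ {Λ : Type} (M : Λ → Turing.TM2.Stmt Γ Λ σ) (emb : p.Label → Λ) (exit : Λ),
      (∀ l, M (emb l) = code p emb exit l) →
        ∃ n ≤ t, Steps M n ⟨some (emb p.entry), v, S⟩ ⟨some exit, v', S'⟩ := by
  induction h with
  | push => intro Λ M emb exit hM; exact ⟨1, le_rfl, Steps.single (by rw [hM]; rfl)⟩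
  | pop => intro Λ M emb exit hM; exact ⟨1, le_rfl, Steps.single (by rw [hM]; rfl)⟩
  | load => intro Λ M emb exit hM; exact ⟨1, le_rfl, Steps.single (by rw [hM]; rfl)⟩
  | @seq p q _ _ _ _ _ _ _ _ _ _ ih₁ ih₂ =>
    intro Λ M emb exit hM
    obtain ⟨n, hn, h⟩ := ih₁ M (fun l => emb (.inl l)) (emb (.inr (entry q)))
      fun l => hM (.inl l)
    obtain ⟨m, hm, h'⟩ := ih₂ M (fun l => emb (.inr l)) exit fun l => hM (.inr l)
    exact ⟨n + m, Nat.add_le_add hn hm, h.trans h'⟩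
  | @ite_true c p q v _ _ _ _ hc _ ih =>
    intro Λ M emb exit hM
    obtain ⟨n, hn, h⟩ := ih M (fun l => emb (some (.inl l))) exit fun l => hM (some (.inl l))
    refine ⟨1 + n, by omega, Steps.trans (Steps.single ?_) h⟩
    rw [hM]; simp [code, entry, hc]
  | @ite_false c p q v _ _ _ _ hc _ ih =>
    intro Λ M emb exit hM
    obtain ⟨n, hn, h⟩ := ih M (fun l => emb (some (.inr l))) exit fun l => hM (some (.inr l))
    refine ⟨1 + n, by omega, Steps.trans (Steps.single ?_) h⟩
    rw [hM]; simp [code, entry, hc]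
  | loop_false hc =>
    intro Λ M emb exit hM
    refine ⟨1, le_rfl, Steps.single ?_⟩
    rw [hM]; simp [code, entry, hc]
  | loop_true hc _ _ ih₁ ih₂ =>
    intro Λ M emb exit hM
    obtain ⟨n, hn, h⟩ := ih₁ M (fun l => emb (some l)) (emb none) fun l => hM (some l)
    obtain ⟨m, hm, h'⟩ := ih₂ M emb exit hM
    -- One step for the test; the body exits to the label `none` of the loop itself, so the second
    -- induction hypothesis applies to the same embedding.
    refine ⟨1 + n + m, by omega, ((Steps.single ?_).trans h).trans h'⟩
    rw [hM]; simp [code, entry, hc]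
  | mono _ ht ih =>
    intro Λ M emb exit hM
    obtain ⟨n, hn, h⟩ := ih M emb exit hM
    exact ⟨n, hn.trans ht, h⟩

end Prog

end StackProgram

/-! ### Binary trees as data, and programs acting on them -/

namespace StackProgram

open Function (update)

/-- Binary trees, the universal data type of the polynomial time functions below. -/
inductive Data
  | leaf
  | node (a b : Data)

namespace Data

/-- Trees in prefix notation. -/
def word : Data → List Bool
  | leaf => [false]
  | node a b => true :: (word a ++ word b)

/-- The length of the word of a tree. -/
def size (t : Data) : ℕ := t.word.length

@[simp] theorem size_leaf : leaf.size = 1 := rfl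

@[simp] theorem size_node (a b : Data) : (node a b).size = a.size + b.size + 1 := by
  simp [size, word]

theorem size_pos (t : Data) : 1 ≤ t.size := by
  cases t <;> simp

end Data

/-- Names of the stacks that hold data. -/
inductive DataStack
  | main
  | left
  | right
  deriving DecidableEq

instance : Fintype DataStack :=
  ⟨{.main, .left, .right}, fun k => by cases k <;> simp⟩

/-- Names of the stacks. -/
inductive Stack
  | input
  | reversed
  | output
  | aux
  | count
  | data (k : DataStack)
  deriving DecidableEq

instance : Fintype Stack :=
  ⟨{.input, .reversed, .output, .aux, .count} ∪ Finset.univ.image .data,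
    fun k => by cases k <;> simp⟩

/-- The alphabets of the stacks. -/
def Alphabet (A : Type) : Stack → Type
  | .input => A
  | .reversed => A
  | _ => Bool

/-- The register holds the last input symbol and the last bit read. -/
abbrev Register (A : Type) := Option A × Option Bool

/-- The programs used in this development. -/
abbrev Program (A : Type) := Prog (Alphabet A) (Register A)

variable {A : Type}

/-- The contents of the stacks that are not used when computing with data. -/
structure External (A : Type) where
  input : List A
  reversed : List A
  output : List Bool

/-- Stack contents, given by their components. -/
def contents (e : External A) (x c : List Bool) (d : DataStack → List Bool) :
    ∀ k, List (Alphabet A k)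
  | .input => e.input
  | .reversed => e.reversed
  | .output => e.output
  | .aux => x
  | .count => c
  | .data k => d k

/-- The stacks have different alphabets, so `Function.update` on them is dependent. This lemma and
its companions turn each update into the replacement of one component. -/
theorem update_aux (e : External A) (x c : List Bool) (d : DataStack → List Bool)
    (l : List Bool) : update (contents e x c d) .aux l = contents e l c d := by
  funext k; cases k <;> rfl

theorem update_count (e : External A) (x c : List Bool) (d : DataStack → List Bool)
    (l : List Bool) : update (contents e x c d) .count l = contents e x l d := by
  funext k; cases k <;> rfl

theorem update_data (e : External A) (x c : List Bool) (d : DataStack → List Bool)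
    (k : DataStack) (l : List Bool) :
    update (contents e x c d) (.data k) l = contents e x c (update d k l) := by
  funext j
  cases j with
  | data j =>
    by_cases h : j = k
    · subst h
      exact (Function.update_self (β := fun k => List (Alphabet A k)) _ _ _).trans
        (Function.update_self (β := fun _ => List Bool) j l d).symm
    · exact (Function.update_of_ne (β := fun k => List (Alphabet A k)) (by simpa using h) _ _).trans
        (Function.update_of_ne (β := fun _ => List Bool) h l d).symm
  | _ => rfl

theorem update_input (e : External A) (x c : List Bool) (d : DataStack → List Bool)
    (l : List A) : update (contents e x c d) .input l = contents { e with input := l } x c d := by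
  funext k; cases k <;> rfl

theorem update_reversed (e : External A) (x c : List Bool) (d : DataStack → List Bool)
    (l : List A) :
    update (contents e x c d) .reversed l = contents { e with reversed := l } x c d := by
  funext k; cases k <;> rfl

theorem update_output (e : External A) (x c : List Bool) (d : DataStack → List Bool)
    (l : List Bool) :
    update (contents e x c d) .output l = contents { e with output := l } x c d := by
  funext k; cases k <;> rfl

/-- The contents of the data stacks, given by their components. -/
def triple (m a b : List Bool) : DataStack → List Bool
  | .main => m
  | .left => a
  | .right => b

@[simp] theorem update_main (m a b l : List Bool) :
    update (triple m a b) .main l = triple l a b := by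
  funext k; cases k <;> rfl

@[simp] theorem update_left (m a b l : List Bool) :
    update (triple m a b) .left l = triple m l b := by
  funext k; cases k <;> rfl

@[simp] theorem update_right (m a b l : List Bool) :
    update (triple m a b) .right l = triple m a l := by
  funext k; cases k <;> rfl

@[simp] theorem triple_main (m a b : List Bool) : triple m a b .main = m := rfl
@[simp] theorem triple_left (m a b : List Bool) : triple m a b .left = a := rfl
@[simp] theorem triple_right (m a b : List Bool) : triple m a b .right = b := rfl

/-- Stack contents between two operations on data. -/
def conf (e : External A) (m a b : List Bool) : ∀ k, List (Alphabet A k) :=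
  contents e [] [] (triple m a b)

/-- Whatever the register holds, `p` leads from the stacks `S` to the stacks `S'` in time `t`. -/
def Runs (p : Program A) (S S' : ∀ k, List (Alphabet A k)) (t : ℕ) : Prop :=
  ∀ v, ∃ v', Prog.Exec p v S v' S' t

theorem Runs.seq {p q : Program A} {S₁ S₂ S₃ : ∀ k, List (Alphabet A k)} {t₁ t₂ : ℕ}
    (h₁ : Runs p S₁ S₂ t₁) (h₂ : Runs q S₂ S₃ t₂) : Runs (.seq p q) S₁ S₃ (t₁ + t₂) := by
  intro v
  obtain ⟨v₁, h₁⟩ := h₁ v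
  obtain ⟨v₂, h₂⟩ := h₂ v₁
  exact ⟨v₂, h₁.seq h₂⟩

theorem Runs.mono {p : Program A} {S₁ S₂ : ∀ k, List (Alphabet A k)} {t₁ t₂ : ℕ}
    (h : Runs p S₁ S₂ t₁) (ht : t₁ ≤ t₂) : Runs p S₁ S₂ t₂ := by
  intro v
  obtain ⟨v₁, h₁⟩ := h v
  exact ⟨v₁, h₁.mono ht⟩

/-! ### Moving, copying, deleting and exchanging trees on the stacks -/

namespace Prog

/-- The last attempt to read a bit was successful. -/
def hasBit (v : Register A) : Bool := v.2.isSome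

/-- The last bit read. -/
def lastBit (v : Register A) : Bool := v.2.getD false

/-- Push a bit. -/
def pushBit (k : DataStack) (b : Bool) : Program A := .push (.data k) fun _ => b

/-- Read a bit into the register. -/
def popBit (k : DataStack) : Program A := .pop (.data k) fun v b => (v.1, b)

/-- Read a bit of the stack `aux` into the register. -/
def popAux : Program A := .pop .aux fun v b => (v.1, b)

/-- Read a bit of the stack `count` into the register. -/
def popCount : Program A := .pop .count fun v b => (v.1, b)

/-- Read one bit of a tree; `count` holds the number of trees to be read afterwards. -/
def readBit (k : DataStack) : Program A :=
  .seq (popBit k) <| .seq (.push .aux lastBit) <|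
    .ite (fun v => v.2 == some true) (.push .count fun _ => true)
      popCount

/-- Move a tree to the stack `aux`, in reversed order. -/
def unload (k : DataStack) : Program A :=
  .seq (.load fun v => (v.1, some true)) (.loop hasBit (readBit k))

/-- Move the content of the stack `aux` to the stack `k`. -/
def drain (k : DataStack) : Program A :=
  .seq popAux (.loop hasBit (.seq (.push (.data k) lastBit) popAux))

/-- Move the content of the stack `aux` to the stacks `k` and `k'`. -/
def drainTwice (k k' : DataStack) : Program A :=
  .seq popAux (.loop hasBit
    (.seq (.push (.data k) lastBit)
      (.seq (.push (.data k') lastBit) popAux)))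

/-- Delete the content of the stack `aux`. -/
def clear : Program A := .seq popAux (.loop hasBit popAux)

/-- Move a tree from the stack `k` to the stack `k'`. -/
def move (k k' : DataStack) : Program A := .seq (unload k) (drain k')

/-- Duplicate the tree on the main stack. -/
def dup : Program A :=
  .seq (unload .main) (.seq (drainTwice .main .left) (move .left .main))

/-- Delete the tree on the main stack. -/
def drop : Program A := .seq (unload .main) clear

/-- Exchange the topmost trees of the main stack. -/
def swap : Program A :=
  .seq (move .main .left) (.seq (move .main .right) (.seq (move .left .main) (move .right .main)))

variable {e : External A} {x c : List Bool} {d : DataStack → List Bool} {v : Register A}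
  {k k' : DataStack} {m a b : List Bool}

theorem exec_pushBit {y : Bool} :
    Exec (pushBit k y) v (contents e x c d) v (contents e x c (update d k (y :: d k))) 1 := by
  rw [← update_data]; exact .push

theorem exec_push_data {f : Register A → Bool} :
    Exec (.push (.data k) f) v (contents e x c d) v (contents e x c (update d k (f v :: d k))) 1 := by
  rw [← update_data]; exact .push

theorem exec_popBit :
    Exec (popBit k) v (contents e x c d) (v.1, (d k).head?)
      (contents e x c (update d k (d k).tail)) 1 := by
  rw [← update_data]; exact .pop

theorem exec_popAux :
    Exec popAux v (contents e x c d) (v.1, x.head?) (contents e x.tail c d) 1 := by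
  rw [← update_aux e x c d x.tail]; exact .pop

theorem exec_push_aux {f : Register A → Bool} :
    Exec (.push .aux f) v (contents e x c d) v (contents e (f v :: x) c d) 1 := by
  rw [← update_aux e x c d (f v :: x)]; exact .push

theorem exec_push_count {f : Register A → Bool} :
    Exec (.push .count f) v (contents e x c d) v (contents e x (f v :: c) d) 1 := by
  rw [← update_count e x c d (f v :: c)]; exact .push

theorem exec_pop_count :
    Exec popCount v (contents e x c d) (v.1, c.head?)
      (contents e x c.tail d) 1 := by
  rw [← update_count e x c d c.tail]; exact .pop

theorem exec_readBit_true {r : List Bool} :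
    Exec (readBit k) v (contents e x c (update d k (true :: r))) (v.1, some true)
      (contents e (true :: x) (true :: c) (update d k r)) 4 := by
  have h := exec_popBit (e := e) (x := x) (c := c) (v := v) (k := k)
    (d := update d k (true :: r))
  simp only [Function.update_self, List.head?_cons, List.tail_cons, Function.update_idem] at h
  exact h.seq (exec_push_aux.seq (.ite_true rfl exec_push_count))

theorem exec_readBit_false {r : List Bool} :
    Exec (readBit k) v (contents e x c (update d k (false :: r))) (v.1, c.head?)
      (contents e (false :: x) c.tail (update d k r)) 4 := by
  have h := exec_popBit (e := e) (x := x) (c := c) (v := v) (k := k)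
    (d := update d k (false :: r))
  simp only [Function.update_self, List.head?_cons, List.tail_cons, Function.update_idem] at h
  exact h.seq (exec_push_aux.seq (.ite_false rfl exec_pop_count))

/-- In prefix notation a tree ends where the number of pending subtrees drops to zero. A bit `true`
adds one mark to `count`, and a bit `false` removes one and leaves it in the register, where an
empty `count` shows as `none`. The run after `t` is taken as a hypothesis, so that the two subtrees
of a node can be chained. Each bit costs four steps for the body and one for the test. -/
theorem exec_unload_loop (t : Data) : ∀ {x c r : List Bool} {v v' : Register A}
    {S : ∀ k, List (Alphabet A k)} {T : ℕ},
    Exec (.loop hasBit (readBit k)) (v.1, c.head?)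
        (contents e (t.word.reverse ++ x) c.tail (update d k r)) v' S T →
      hasBit v = true →
        Exec (.loop hasBit (readBit k)) v
          (contents e x c (update d k (t.word ++ r))) v' S (T + 5 * t.size) := by
  induction t with
  | leaf =>
    intro x c r v v' S T h hv
    have := Exec.loop_true hv exec_readBit_false h
    exact this.mono (by simp; omega)
  | node a b iha ihb =>
    intro x c r v v' S T h hv
    have hb := ihb (x := a.word.reverse ++ true :: x) (c := c) (v := (v.1, some true))
      (v' := v') (S := S) (T := T) (r := r) (by simpa [Data.word] using h) rfl
    have ha := iha (x := true :: x) (c := true :: c) (v := (v.1, some true)) (v' := v') (S := S)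
      (r := b.word ++ r) hb rfl
    have := Exec.loop_true hv exec_readBit_true ha
    simp only [Data.word, List.cons_append, List.append_assoc]
    exact this.mono (by simp; omega)

/-- With `count` empty, the loop stops exactly at the end of `t` and leaves `r` untouched. The two
additional steps are the initial load, which opens the loop, and the last test. -/
theorem exec_unload (t : Data) {r : List Bool} :
    Exec (unload k) v (contents e x [] (update d k (t.word ++ r))) (v.1, none)
      (contents e (t.word.reverse ++ x) [] (update d k r)) (5 * t.size + 2) :=
  (Exec.seq (.load) (exec_unload_loop (v := (v.1, some true)) t (.loop_false rfl) rfl)).mono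
    (by omega)

theorem exec_drain : Exec (drain k) v (contents e x c d) (v.1, none)
    (contents e [] c (update d k (x.reverse ++ d k))) (3 * x.length + 2) := by
  refine (exec_popAux.seq (t₂ := 3 * x.length + 1) ?_).mono (by omega)
  induction x generalizing d with
  | nil => simpa using Exec.loop_false rfl
  | cons y x ih =>
    have h := (exec_push_data (e := e) (x := x) (c := c) (d := d) (v := (v.1, some y)) (k := k)
      (f := lastBit)).seq exec_popAux
    have := Exec.loop_true (c := hasBit) rfl h ih
    simp only [Function.update_self, Function.update_idem, lastBit, Option.getD_some] at this
    simpa using this.mono (t' := 3 * (x.length + 1) + 1) (by omega)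

theorem exec_drainTwice (hk : k ≠ k') : Exec (drainTwice k k') v (contents e x c d) (v.1, none)
    (contents e [] c (update (update d k (x.reverse ++ d k)) k' (x.reverse ++ d k')))
      (4 * x.length + 2) := by
  refine (exec_popAux.seq (t₂ := 4 * x.length + 1) ?_).mono (by omega)
  induction x generalizing d with
  | nil => simpa using Exec.loop_false rfl
  | cons y x ih =>
    have h := (exec_push_data (e := e) (x := x) (c := c) (d := d) (v := (v.1, some y)) (k := k)
      (f := lastBit)).seq ((exec_push_data (k := k') (f := lastBit)).seq exec_popAux)
    have := Exec.loop_true (c := hasBit) rfl h ih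
    simp only [Function.update_self, Function.update_idem, lastBit, Option.getD_some,
      Function.update_of_ne hk, Function.update_of_ne hk.symm,
      Function.update_comm hk.symm] at this
    simpa using this.mono (t' := 4 * (x.length + 1) + 1) (by omega)

theorem exec_clear : Exec clear v (contents e x c d) (v.1, none)
    (contents e [] c d) (2 * x.length + 2) := by
  refine (exec_popAux.seq (t₂ := 2 * x.length + 1) ?_).mono (by omega)
  induction x with
  | nil => exact Exec.loop_false rfl
  | cons y x ih =>
    have := Exec.loop_true (c := hasBit) (v := (v.1, some y)) rfl exec_popAux ih
    exact this.mono (by simp; omega)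

theorem exec_move (t : Data) {r : List Bool} :
    Exec (move k k') v (contents e [] [] (update d k (t.word ++ r))) (v.1, none)
      (contents e [] [] (update (update d k r) k' (t.word ++ update d k r k')))
      (8 * t.size + 4) := by
  have := (exec_unload (e := e) (x := []) (d := d) (k := k) (v := v) t (r := r)).seq
    (exec_drain (k := k'))
  simp only [List.append_nil, List.reverse_reverse, List.length_reverse] at this
  exact this.mono (by simp only [Data.size]; omega)

variable (e m a b)

theorem runs_move_main_left (t : Data) :
    Runs (move .main .left) (conf e (t.word ++ m) a b) (conf e m (t.word ++ a) b)
      (8 * t.size + 4) := fun v => by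
  have := exec_move (v := v) (e := e) (d := triple m a b) (k := .main)
    (k' := .left) (r := m) t
  exact ⟨_, by simpa [conf] using this⟩

theorem runs_move_main_right (t : Data) :
    Runs (move .main .right) (conf e (t.word ++ m) a b) (conf e m a (t.word ++ b))
      (8 * t.size + 4) := fun v => by
  have := exec_move (v := v) (e := e) (d := triple m a b) (k := .main)
    (k' := .right) (r := m) t
  exact ⟨_, by simpa [conf] using this⟩

theorem runs_move_left_main (t : Data) :
    Runs (move .left .main) (conf e m (t.word ++ a) b) (conf e (t.word ++ m) a b)
      (8 * t.size + 4) := fun v => by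
  have := exec_move (v := v) (e := e) (d := triple m a b) (k := .left)
    (k' := .main) (r := a) t
  exact ⟨_, by simpa [conf] using this⟩

theorem runs_move_right_main (t : Data) :
    Runs (move .right .main) (conf e m a (t.word ++ b)) (conf e (t.word ++ m) a b)
      (8 * t.size + 4) := fun v => by
  have := exec_move (v := v) (e := e) (d := triple m a b) (k := .right)
    (k' := .main) (r := b) t
  exact ⟨_, by simpa [conf] using this⟩

theorem runs_pushBit (y : Bool) : Runs (pushBit .main y) (conf e m a b) (conf e (y :: m) a b) 1 :=
  fun v => ⟨v, by
    simpa [conf] using exec_pushBit (v := v) (e := e) (x := []) (c := [])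
      (d := triple m a b) (k := .main) (y := y)⟩

theorem exec_popBit_main (y : Bool) (v : Register A) :
    Exec (popBit .main) v (conf e (y :: m) a b) (v.1, some y) (conf e m a b) 1 := by
  simpa [conf] using exec_popBit (v := v) (e := e) (x := []) (c := [])
    (d := triple (y :: m) a b) (k := .main)

theorem runs_popBit (y : Bool) : Runs (popBit .main) (conf e (y :: m) a b) (conf e m a b) 1 :=
  fun v => ⟨_, exec_popBit_main e m a b y v⟩

theorem runs_dup (t : Data) :
    Runs dup (conf e (t.word ++ m) a b) (conf e (t.word ++ (t.word ++ m)) a b)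
      (17 * t.size + 8) := by
  intro v
  have h := exec_drainTwice (e := e) (x := t.word.reverse) (c := []) (d := triple m a b)
    (k := .main) (k' := .left) (v := (v.1, none)) (by simp)
  have h₀ := exec_unload (e := e) (x := []) (d := triple m a b) (k := .main) (v := v) t (r := m)
  simp only [List.append_nil, List.reverse_reverse, List.length_reverse, update_main,
    update_left, triple_main, triple_left] at h h₀
  obtain ⟨v', h'⟩ := runs_move_left_main e (t.word ++ m) a b t (v.1, none)
  exact ⟨v', (h₀.seq (h.seq h')).mono (by simp only [Data.size]; omega)⟩

theorem runs_drop (t : Data) :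
    Runs drop (conf e (t.word ++ m) a b) (conf e m a b) (7 * t.size + 4) := by
  intro v
  have h₀ := exec_unload (e := e) (x := []) (d := triple m a b) (k := .main) (v := v) t (r := m)
  simp only [List.append_nil, update_main] at h₀
  exact ⟨_, (h₀.seq exec_clear).mono (by simp only [Data.size, List.length_reverse]; omega)⟩

theorem runs_swap (s t : Data) :
    Runs swap (conf e (s.word ++ (t.word ++ m)) a b) (conf e (t.word ++ (s.word ++ m)) a b)
      (16 * (s.size + t.size) + 16) :=
  ((runs_move_main_left e _ a b s).seq ((runs_move_main_right e m _ b t).seq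
    ((runs_move_left_main e m a _ s).seq (runs_move_right_main e _ a b t)))).mono (by omega)

theorem runs_nop : Runs (.load id : Program A) (conf e m a b) (conf e m a b) 1 :=
  fun v => ⟨v, .load⟩

end Prog

end StackProgram

/-! ### Polynomial time functions -/

namespace StackProgram

open Prog Polynomial

/-- Coefficients are natural numbers, so bounds on sizes can be substituted into time bounds. -/
theorem eval_mono (P : ℕ[X]) {m n : ℕ} (h : m ≤ n) : P.eval m ≤ P.eval n := by
  induction P using Polynomial.induction_on' with
  | add p q hp hq => simpa using Nat.add_le_add hp hq
  | monomial k c => simpa using Nat.mul_le_mul_left c (Nat.pow_le_pow_left h k)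

variable {A : Type}

theorem Runs.test_true {p q : Program A} {e : External A} {m a b : List Bool}
    {S : ∀ k, List (Alphabet A k)} {t : ℕ} (h : Runs p (conf e m a b) S t) :
    Runs (.seq (popBit .main) (.ite lastBit p q)) (conf e (true :: m) a b) S (t + 2) := by
  intro v
  obtain ⟨v', h⟩ := h (v.1, some true)
  exact ⟨v', ((exec_popBit_main e m a b true v).seq (.ite_true rfl h)).mono (by omega)⟩

theorem Runs.test_false {p q : Program A} {e : External A} {m a b : List Bool}
    {S : ∀ k, List (Alphabet A k)} {t : ℕ} (h : Runs q (conf e m a b) S t) :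
    Runs (.seq (popBit .main) (.ite lastBit p q)) (conf e (false :: m) a b) S (t + 2) := by
  intro v
  obtain ⟨v', h⟩ := h (v.1, some false)
  exact ⟨v', ((exec_popBit_main e m a b false v).seq (.ite_false rfl h)).mono (by omega)⟩

/-- Read bits of the main stack; run `p` after each bit `true` and stop at a bit `false`. -/
def Prog.repeatWhile (p : Program A) : Program A :=
  .seq (popBit .main) (.loop lastBit (.seq p (popBit .main)))

theorem Runs.repeatWhile_false (p : Program A) (e : External A) (m a b : List Bool) :
    Runs (repeatWhile p) (conf e (false :: m) a b) (conf e m a b) 2 := fun v =>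
  ⟨_, (exec_popBit_main e m a b false v).seq (.loop_false rfl)⟩

/-- The constructor `mono` may sit on top of `seq`, hence the inequality between the times. The
inversion serves to cut off the initial read of a `repeatWhile`, which becomes the final read of the
preceding round. -/
theorem Prog.Exec.seq_inv {K : Type} [DecidableEq K] {Γ : K → Type} {σ : Type}
    {p q : Prog Γ σ} {v v' : σ} {S S' : ∀ k, List (Γ k)} {t : ℕ}
    (h : Exec (.seq p q) v S v' S' t) :
    ∃ v₁ S₁ t₁ t₂, Exec p v S v₁ S₁ t₁ ∧ Exec q v₁ S₁ v' S' t₂ ∧ t₁ + t₂ ≤ t := by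
  generalize hr : Prog.seq p q = r at h
  induction h with
  | seq h₁ h₂ => cases hr; exact ⟨_, _, _, _, h₁, h₂, le_rfl⟩
  | mono _ ht ih =>
    obtain ⟨v₁, S₁, t₁, t₂, h₁, h₂, h⟩ := ih hr
    exact ⟨v₁, S₁, t₁, t₂, h₁, h₂, h.trans ht⟩
  | _ => cases hr

theorem Runs.repeatWhile_true {p : Program A} {e : External A} {m a b : List Bool}
    {S S' : ∀ k, List (Alphabet A k)} {t t' : ℕ} (h : Runs p (conf e m a b) S t)
    (h' : Runs (repeatWhile p) S S' t') :
    Runs (repeatWhile p) (conf e (true :: m) a b) S' (t + t' + 2) := by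
  intro v
  obtain ⟨v₁, h₁⟩ := h (v.1, some true)
  obtain ⟨v₂, h₂⟩ := h' v₁
  obtain ⟨v₃, S₃, t₁, t₂, h₃, h₄, ht⟩ := h₂.seq_inv
  have := (exec_popBit_main e m a b true v).seq
    (Exec.loop_true (c := lastBit) rfl (h₁.seq h₃) h₄)
  exact ⟨v₂, this.mono (by omega)⟩

/-- Push a word. -/
def Prog.pushWord : List Bool → Program A
  | [] => .load id
  | y :: w => .seq (pushWord w) (pushBit .main y)

theorem Prog.runs_pushWord (e : External A) (m a b : List Bool) : ∀ w : List Bool,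
    Runs (pushWord w) (conf e m a b) (conf e (w ++ m) a b) (w.length + 1)
  | [] => runs_nop e m a b
  | y :: w => (runs_pushWord e m a b w).seq (runs_pushBit e _ a b y)

/-- The program `p` turns the tree `s` on the main stack into the tree `t`, and time and size
are bounded by the polynomial `P`. -/
def Transforms (p : Program A) (P : ℕ[X]) (s t : Data) : Prop :=
  t.size ≤ P.eval s.size ∧ ∀ e m a b,
    Runs p (conf e (s.word ++ m) a b) (conf e (t.word ++ m) a b) (P.eval s.size)

variable (A) in
/-- Some program transforms the tree `u i` into `w i`, for all `i`, in polynomial time. -/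
def PolyMap {ι : Type} (u w : ι → Data) : Prop :=
  ∃ (p : Program A) (P : ℕ[X]), ∀ i, Transforms p P (u i) (w i)

namespace PolyMap

variable {ι κ : Type} {u w z : ι → Data}

theorem refl (u : ι → Data) : PolyMap A u u :=
  ⟨.load id, X + 1, fun i => ⟨by simp, fun e m a b => (runs_nop e _ a b).mono (by simp)⟩⟩

/-- With a subtype inclusion for `f`, a program only has to be correct on the indices that reach it;
`branch` relies on this. -/
theorem reindex (h : PolyMap A u w) (f : κ → ι) : PolyMap A (fun k => u (f k)) fun k => w (f k) :=
  let ⟨p, P, h⟩ := h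
  ⟨p, P, fun i => h (f i)⟩

theorem trans (h₁ : PolyMap A u w) (h₂ : PolyMap A w z) : PolyMap A u z := by
  obtain ⟨p, P, hp⟩ := h₁
  obtain ⟨q, Q, hq⟩ := h₂
  refine ⟨.seq p q, P + Q.comp P, fun i => ⟨?_, fun e m a b => ?_⟩⟩
  · have := (hq i).1.trans (eval_mono Q (hp i).1)
    simp only [eval_add, eval_comp]; omega
  · refine (((hp i).2 e m a b).seq ((hq i).2 e m a b)).mono ?_
    have := eval_mono Q (hp i).1
    simp only [eval_add, eval_comp]; omega

/-- One copy of the tree is turned into `w i`, exchanged with the other copy, which is turned into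
`z i`, and exchanged back; a leading bit `true` joins the two words into a node. The constants are
generous. -/
theorem pair (h₁ : PolyMap A u w) (h₂ : PolyMap A u z) :
    PolyMap A u fun i => .node (w i) (z i) := by
  obtain ⟨p, P, hp⟩ := h₁
  obtain ⟨q, Q, hq⟩ := h₂
  refine ⟨.seq dup <| .seq p <| .seq swap <| .seq q <| .seq swap (pushBit .main true),
    40 * X + 50 + 40 * P + 40 * Q, fun i => ⟨?_, fun e m a b => ?_⟩⟩
  · have := (hp i).1
    have := (hq i).1
    simp only [eval_add, eval_mul, eval_X, eval_ofNat, Data.size_node]; omega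
  · have h := (runs_dup e m a b (u i)).seq <| ((hp i).2 e _ a b).seq <|
      (runs_swap e m a b (w i) (u i)).seq <| ((hq i).2 e _ a b).seq <|
      (runs_swap e m a b (z i) (w i)).seq (runs_pushBit e _ a b true)
    have := (hp i).1
    have := (hq i).1
    simp only [Data.word, List.cons_append, List.append_assoc]
    refine h.mono ?_
    simp only [eval_add, eval_mul, eval_X, eval_ofNat]; omega

theorem left (w z : ι → Data) : PolyMap A (fun i => .node (w i) (z i)) w := by
  refine ⟨.seq (popBit .main) (.seq swap drop), 30 * X + 30, fun i => ⟨?_, fun e m a b => ?_⟩⟩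
  · simp; omega
  · simp only [Data.word, List.cons_append, List.append_assoc]
    refine ((runs_popBit e _ a b true).seq ((runs_swap e m a b (w i) (z i)).seq
      (runs_drop e _ a b (z i)))).mono ?_
    simp; omega

theorem right (w z : ι → Data) : PolyMap A (fun i => .node (w i) (z i)) z := by
  refine ⟨.seq (popBit .main) drop, 30 * X + 30, fun i => ⟨?_, fun e m a b => ?_⟩⟩
  · simp; omega
  · simp only [Data.word, List.cons_append, List.append_assoc]
    refine ((runs_popBit e _ a b true).seq (runs_drop e _ a b (w i))).mono ?_
    simp; omega

theorem const (u : ι → Data) (t : Data) : PolyMap A u fun _ => t := by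
  refine ⟨.seq drop (pushWord t.word), 7 * X + 5 + C t.size, fun i => ⟨?_, fun e m a b => ?_⟩⟩
  · simp
  · refine ((runs_drop e m a b (u i)).seq (runs_pushWord e m a b t.word)).mono ?_
    simp [Data.size]; omega

/-- The trees that represent the truth values. -/
def _root_.StackProgram.Data.ofBool (b : Bool) : Data := bif b then .node .leaf .leaf else .leaf

/-- The first bit of the word tells a leaf from a node. For a leaf nothing is left on the stack; for
a node the two subtrees still have to be deleted. -/
theorem isNode {b : ι → Bool} (h : ∀ i, b i = true ↔ u i ≠ .leaf) :
    PolyMap A u fun i => .ofBool (b i) := by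
  refine ⟨.seq (popBit .main) (.ite lastBit (.seq drop (.seq drop (pushWord
    (Data.node .leaf .leaf).word))) (pushWord [false])), 20 * X + 20,
    fun i => ⟨?_, fun e m a b' => ?_⟩⟩
  · cases hb : b i <;> simp [Data.ofBool, hb]
  · cases hu : u i with
    | leaf =>
      have hb : b i = false := by rw [← Bool.not_eq_true, h i]; simp [hu]
      beta_reduce
      rw [hb]
      refine (Runs.test_false (runs_pushWord e m a b' _)).mono ?_
      simp
    | node s t =>
      have hb : b i = true := by rw [h i]; simp [hu]
      beta_reduce
      rw [hb]
      simp only [Data.word, List.cons_append, List.append_assoc]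
      refine (Runs.test_true ((runs_drop e _ a b' s).seq ((runs_drop e _ a b' t).seq
        (runs_pushWord e _ a b' _)))).mono ?_
      simp; omega

/-- The test is run on a copy and its leading bit is read. The tree for `true` has the word `true,
false, false`, so two more bits are removed in that branch and none in the other. -/
theorem branch {b : ι → Bool} (hb : PolyMap A u fun i => .ofBool (b i))
    (h₁ : PolyMap A (fun i : {i // b i = true} => u i) fun i => w i)
    (h₂ : PolyMap A (fun i : {i // b i = false} => u i) fun i => w i) : PolyMap A u w := by
  obtain ⟨p, P, hp⟩ := hb
  obtain ⟨q, Q, hq⟩ := h₁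
  obtain ⟨q', Q', hq'⟩ := h₂
  refine ⟨.seq dup <| .seq p <| .seq (popBit .main) <| .ite lastBit
    (.seq (popBit .main) (.seq (popBit .main) q)) q', 17 * X + 20 + P + Q + Q',
    fun i => ⟨?_, fun e m a b' => ?_⟩⟩
  · cases h : b i with
    | true => have := (hq ⟨i, h⟩).1; simp at this ⊢; omega
    | false => have := (hq' ⟨i, h⟩).1; simp at this ⊢; omega
  · cases hbi : b i with
    | true =>
      have h₀ := (hp i).2 e ((u i).word ++ m) a b'
      beta_reduce at h₀
      rw [hbi] at h₀
      refine ((runs_dup e m a b' (u i)).seq (h₀.seq (Runs.test_true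
        ((runs_popBit e _ a b' _).seq ((runs_popBit e _ a b' _).seq
          ((hq ⟨i, hbi⟩).2 e m a b')))))).mono ?_
      simp; omega
    | false =>
      have h₀ := (hp i).2 e ((u i).word ++ m) a b'
      beta_reduce at h₀
      rw [hbi] at h₀
      refine ((runs_dup e m a b' (u i)).seq (h₀.seq (Runs.test_false
        ((hq' ⟨i, hbi⟩).2 e m a b')))).mono ?_
      simp; omega

end PolyMap

/-! Functions between types whose elements are represented by binary trees. -/

/-- A representation of the elements of a type by binary trees. -/
class Coded (α : Type) where
  /-- The tree that represents an element. -/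
  toData : α → Data

open Coded

/-- The size of the representation. -/
def size {α : Type} [Coded α] (x : α) : ℕ := (toData x).size

/-- A representation of lists. -/
def listToData {α : Type} [Coded α] : List α → Data
  | [] => .leaf
  | a :: l => .node (toData a) (listToData l)

instance : Coded Bool := ⟨.ofBool⟩
instance : Coded Unit := ⟨fun _ => .leaf⟩
instance {α β : Type} [Coded α] [Coded β] : Coded (α × β) := ⟨fun x => .node (toData x.1) (toData x.2)⟩
instance {α : Type} [Coded α] : Coded (List α) := ⟨listToData⟩

variable {α β γ δ σ : Type} [Coded α] [Coded β] [Coded γ] [Coded δ] [Coded σ]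

theorem size_toData (x : α) : (toData x).size = size x := rfl

theorem size_pos (x : α) : 1 ≤ size x := Data.size_pos _

@[simp] theorem size_mk (x : α) (y : β) : size (x, y) = size x + size y + 1 := by
  simp [size, toData]

@[simp] theorem size_nil : size ([] : List α) = 1 := rfl

@[simp] theorem size_cons (x : α) (l : List α) : size (x :: l) = size x + size l + 1 := by
  simp [size, toData, listToData]

theorem length_lt_size (l : List α) : l.length < size l := by
  induction l with
  | nil => simp
  | cons x l ih => simp; omega

variable (A) in
/-- The function `f` is computable in polynomial time, with respect to the representations of
its arguments and values as binary trees. -/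
def PolyTime (f : α → β) : Prop := PolyMap A (fun x => toData x) fun x => toData (f x)

/-- The word of a list carries a bit `true` in front of each entry and ends with `false`, so its own
bits control `repeatWhile`. In each round the rest of the list is parked on the right stack, while
the entry passes through the left stack to be joined with context and state. The number `N` bounds
the sizes of the context, the list and all states reached. -/
theorem runs_loop_foldl {p : Program A} {P : ℕ[X]} {h : γ → σ → α → σ}
    (hp : ∀ x : γ × σ × α, Transforms p P
      (.node (toData x.2.2) (.node (toData x.1) (toData x.2.1)))
      (.node (toData x.1) (toData (h x.1 x.2.1 x.2.2))))
    (e : External A) (m a b : List Bool) (c : γ) (N : ℕ) (hc : size c ≤ N) (l : List α) :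
    ∀ s : σ, size l ≤ N → (∀ l', l' <+: l → size (l'.foldl (h c) s) ≤ N) →
      Runs (repeatWhile <| .seq (move .main .left) <| .seq (move .main .right) <|
          .seq (move .left .main) <| .seq (pushBit .main true) <| .seq p (move .right .main))
        (conf e ((toData l).word ++ ((Data.node (toData c) (toData s)).word ++ m)) a b)
        (conf e ((Data.node (toData c) (toData (l.foldl (h c) s))).word ++ m) a b)
        (l.length * (40 * N + 40 + P.eval (4 * N + 4)) + 2) := by
  induction l with
  | nil =>
    intro s _ _
    exact (Runs.repeatWhile_false _ _ _ _ _).mono (by simp)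
  | cons x l ih =>
    intro s hl hs
    have hN : size x + size l + 1 ≤ N := by simpa using hl
    have hsN : size s ≤ N := hs [] (List.nil_prefix)
    have hsN' : size (h c s x) ≤ N := hs [x] (by simp)
    have h₁ := (runs_move_main_left e _ a b (toData x)).seq <|
      (runs_move_main_right e ((Data.node (toData c) (toData s)).word ++ m) _ b (toData l)).seq <|
      (runs_move_left_main e _ a _ (toData x)).seq <| (runs_pushBit e _ a _ true).seq <|
      Runs.seq (p := p) (S₂ := conf e ((Data.node (toData c) (toData (h c s x))).word ++ m) a
          ((toData l).word ++ b)) (t₁ := P.eval (4 * N + 4)) (by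
        have := (hp (c, s, x)).2 e m a ((toData l).word ++ b)
        simp only [Data.word, List.cons_append, List.append_assoc] at this ⊢
        exact this.mono (eval_mono P (by simp [size_toData]; omega))) <|
      runs_move_right_main e _ a b (toData l)
    have h₂ := h₁.repeatWhile_true (ih (h c s x) (by omega) fun l' hl' => by
      simpa using hs (x :: l') (by simpa using hl'))
    simp only [toData, listToData, Data.word, List.cons_append, List.append_assoc,
      List.length_cons, List.foldl_cons] at h₂ ⊢
    refine h₂.mono ?_
    simp only [size_toData] at *
    rw [Nat.add_mul]
    have : (listToData l).size = size l := rfl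
    generalize l.length * (40 * N + 40 + P.eval (4 * N + 4)) = k
    omega

/-- Iterating a polynomial time step can produce values of exponential size. The bound `B` on the
results over all prefixes excludes this: every round then costs polynomial time, and the number of
rounds is below the size of the list. -/
theorem PolyMap.foldl {f : γ → List α} {g : γ → σ} {h : γ → σ → α → σ}
    (hh : PolyMap A
      (fun x : γ × σ × α => .node (toData x.2.2) (.node (toData x.1) (toData x.2.1)))
      fun x => .node (toData x.1) (toData (h x.1 x.2.1 x.2.2)))
    (B : ℕ[X]) (hB : ∀ c l, l <+: f c → size (l.foldl (h c) (g c)) ≤ B.eval (size c)) :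
    PolyMap A (fun c => .node (toData (f c)) (.node (toData c) (toData (g c))))
      fun c => .node (toData c) (toData ((f c).foldl (h c) (g c))) := by
  obtain ⟨p, P, hp⟩ := hh
  refine ⟨.seq (popBit .main) <| repeatWhile <| .seq (move .main .left) <|
    .seq (move .main .right) <| .seq (move .left .main) <| .seq (pushBit .main true) <|
    .seq p (move .right .main),
    X * (40 * (X + B) + 40 + P.comp (4 * (X + B) + 4)) + 3 + (X + B), fun c => ?_⟩
  have hN : ∀ n, size c ≤ n → B.eval (size c) ≤ B.eval n := fun n h => eval_mono B h
  set n := (Data.node (toData (f c)) (.node (toData c) (toData (g c)))).size with hn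
  have hc : size c + size (f c) + 1 ≤ n := by simp [hn, size_toData]; omega
  have hfc := length_lt_size (f c)
  have hBn := hN n (by omega)
  constructor
  · have := hB c (f c) (List.prefix_refl _)
    rw [Data.size_node, size_toData, size_toData, ← hn]
    simp only [eval_add, eval_mul, eval_X, eval_comp, eval_ofNat]
    generalize n * (_ + _) = k
    omega
  · intro e m a b
    have h₁ := (runs_popBit e _ a b true).seq (runs_loop_foldl hp e m a b c (n + B.eval n)
      (by omega) (f c) (g c) (by omega) fun l hl => (hB c l hl).trans (by omega))
    simp only [Data.word, List.cons_append, List.append_assoc] at h₁ ⊢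
    refine h₁.mono ?_
    rw [← hn]
    simp only [eval_add, eval_mul, eval_X, eval_comp, eval_ofNat]
    have := Nat.mul_le_mul_right (40 * (n + B.eval n) + 40 + P.eval (4 * (n + B.eval n) + 4))
      (show (f c).length ≤ n by omega)
    omega

end StackProgram

/-! ### A calculus of polynomial time functions -/

namespace StackProgram

open Polynomial Coded

namespace PolyTime

variable {A : Type} {α β γ δ σ ν : Type} [Coded α] [Coded β] [Coded γ] [Coded δ] [Coded σ] [Coded ν]

theorem exists_size_le {f : α → β} (hf : PolyTime A f) :
    ∃ P : ℕ[X], ∀ x, size (f x) ≤ P.eval (size x) :=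
  let ⟨_, P, h⟩ := hf
  ⟨P, fun x => (h x).1⟩

theorem of_toData {f : α → β} (h : ∀ x, toData (f x) = toData x) : PolyTime A f := by
  have : (fun x => toData (f x)) = fun x => toData x := funext h
  unfold PolyTime
  rw [this]
  exact PolyMap.refl _

theorem id : PolyTime A fun x : α => x := of_toData fun _ => rfl

theorem comp {g : β → γ} {f : α → β} (hg : PolyTime A g) (hf : PolyTime A f) :
    PolyTime A fun x => g (f x) :=
  PolyMap.trans hf (PolyMap.reindex hg f)

theorem pair {f : α → β} {g : α → γ} (hf : PolyTime A f) (hg : PolyTime A g) :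
    PolyTime A fun x => (f x, g x) := PolyMap.pair hf hg

theorem comp₂ {g : β → γ → δ} {f₁ : α → β} {f₂ : α → γ}
    (hg : PolyTime A fun x : β × γ => g x.1 x.2) (h₁ : PolyTime A f₁) (h₂ : PolyTime A f₂) :
    PolyTime A fun x => g (f₁ x) (f₂ x) := hg.comp (h₁.pair h₂)

theorem const (y : β) : PolyTime A fun _ : α => y := PolyMap.const _ _

theorem fst {f : α → β × γ} (hf : PolyTime A f) : PolyTime A fun x => (f x).1 :=
  PolyMap.trans hf (PolyMap.left _ _)

theorem snd {f : α → β × γ} (hf : PolyTime A f) : PolyTime A fun x => (f x).2 :=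
  PolyMap.trans hf (PolyMap.right _ _)

theorem cons {f : α → β} {g : α → List β} (hf : PolyTime A f) (hg : PolyTime A g) :
    PolyTime A fun x => f x :: g x := PolyMap.pair hf hg

theorem ite {b : α → Bool} {f g : α → β} (hb : PolyTime A b) (hf : PolyTime A f)
    (hg : PolyTime A g) : PolyTime A fun x => if b x = true then f x else g x := by
  refine PolyMap.branch (b := b) hb ?_ ?_
  · have := PolyMap.reindex hf fun i : {i // b i = true} => i.1
    have h : ∀ i : {i // b i = true}, (if b i = true then f i else g i) = f i :=
      fun i => if_pos i.2
    simpa only [h] using this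
  · have := PolyMap.reindex hg fun i : {i // b i = false} => i.1
    have h : ∀ i : {i // b i = false}, (if b i = true then f i else g i) = g i :=
      fun i => if_neg (by simp [i.2])
    simpa only [h] using this

theorem not {f : α → Bool} (hf : PolyTime A f) : PolyTime A fun x => !f x := by
  have := hf.ite (const false) (const true) (β := Bool)
  convert this using 2 with x
  cases f x <;> rfl

theorem and {f g : α → Bool} (hf : PolyTime A f) (hg : PolyTime A g) :
    PolyTime A fun x => f x && g x := by
  have := hf.ite hg (const false)
  convert this using 2 with x
  cases f x <;> rfl

theorem or {f g : α → Bool} (hf : PolyTime A f) (hg : PolyTime A g) :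
    PolyTime A fun x => f x || g x := by
  have := hf.ite (const true) hg
  convert this using 2 with x
  cases f x <;> rfl

theorem isEmpty {f : α → List β} (hf : PolyTime A f) : PolyTime A fun x => (f x).isEmpty := by
  have h : PolyTime A fun x => !(f x).isEmpty := PolyMap.trans hf (PolyMap.isNode fun x => by
    cases f x <;> simp [toData, listToData])
  simpa using h.not

theorem headD {f : α → List β} {g : α → β} (hf : PolyTime A f) (hg : PolyTime A g) :
    PolyTime A fun x => (f x).headD (g x) := by
  refine PolyMap.branch (b := fun x => (f x).isEmpty) hf.isEmpty ?_ ?_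
  · have := PolyMap.reindex hg fun i : {i // (f i).isEmpty = true} => i.1
    convert this using 3 with i
    obtain ⟨i, hi⟩ := i
    simp [List.isEmpty_iff.1 hi]
  · have := PolyMap.reindex hf fun i : {i // (f i).isEmpty = false} => i.1
    refine this.trans ?_
    convert PolyMap.left (A := A)
      (fun i : {i // (f i).isEmpty = false} => toData ((f i).headD (g i)))
      (fun i : {i // (f i).isEmpty = false} => toData (f i).tail) using 2 with i
    obtain ⟨i, hi⟩ := i
    cases h : f i with
    | nil => simp [h] at hi
    | cons a l => simp [toData, listToData]

theorem tail {f : α → List β} (hf : PolyTime A f) : PolyTime A fun x => (f x).tail := by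
  refine PolyMap.branch (b := fun x => (f x).isEmpty) hf.isEmpty ?_ ?_
  · have := PolyMap.reindex hf fun i : {i // (f i).isEmpty = true} => i.1
    convert this using 3 with i
    obtain ⟨i, hi⟩ := i
    simp [List.isEmpty_iff.1 hi]
  · have := PolyMap.reindex hf fun i : {i // (f i).isEmpty = false} => i.1
    refine this.trans ?_
    convert PolyMap.right (A := A)
      -- The tree of the head, named through `head?` because `β` need not have a default element;
      -- the value `.leaf` never occurs on this subtype.
      (fun i : {i // (f i).isEmpty = false} => ((f i).head?.map toData).getD .leaf)
      (fun i : {i // (f i).isEmpty = false} => toData (f i).tail) using 2 with i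
    obtain ⟨i, hi⟩ := i
    cases h : f i with
    | nil => simp [h] at hi
    | cons a l => simp [toData, listToData]

/-! Folds -/

theorem size_le_of_mem {a : α} {l : List α} (h : a ∈ l) : size a < size l := by
  induction l with
  | nil => simp at h
  | cons b l ih =>
    rw [size_cons]
    rcases List.mem_cons.1 h with rfl | h
    · omega
    · have := ih h; omega

/-- The context `c` has to survive every round, so the loop transforms pairs of context and state
and the context is projected away at the end. -/
theorem foldl {f : γ → List α} {g : γ → σ} {h : γ → σ → α → σ} (hf : PolyTime A f)
    (hg : PolyTime A g) (hh : PolyTime A fun x : γ × σ × α => h x.1 x.2.1 x.2.2) (B : ℕ[X])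
    (hB : ∀ c l, l <+: f c → size (l.foldl (h c) (g c)) ≤ B.eval (size c)) :
    PolyTime A fun c => (f c).foldl (h c) (g c) := by
  have h₁ : PolyMap A (fun c => toData c)
      (fun c => .node (toData (f c)) (.node (toData c) (toData (g c)))) :=
    PolyMap.pair hf (PolyMap.pair id hg)
  refine h₁.trans ((PolyMap.foldl ?_ B hB).trans (PolyMap.right _ _))
  have ha := PolyMap.left (A := A) (fun x : γ × σ × α => toData x.2.2)
    (fun x => .node (toData x.1) (toData x.2.1))
  have hcs := PolyMap.right (A := A) (fun x : γ × σ × α => toData x.2.2)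
    (fun x => .node (toData x.1) (toData x.2.1))
  have hc := hcs.trans (PolyMap.left _ _)
  have hs := hcs.trans (PolyMap.right _ _)
  -- The loop presents the entry in front of context and state; here they are put in the order in
  -- which `h` takes them, and the context is kept.
  exact hc.pair ((hc.pair (hs.pair ha)).trans hh)

/-- If each round adds at most an amount independent of the current state, the final size is at most
the initial size plus the number of rounds times that amount. -/
theorem foldl_of_growth {f : γ → List α} {g : γ → σ} {h : γ → σ → α → σ} (hf : PolyTime A f)
    (hg : PolyTime A g) (hh : PolyTime A fun x : γ × σ × α => h x.1 x.2.1 x.2.2) (B : ℕ[X])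
    (hB : ∀ c, ∀ a ∈ f c, ∀ s, size (h c s a) ≤ size s + B.eval (size c)) :
    PolyTime A fun c => (f c).foldl (h c) (g c) := by
  obtain ⟨P, hP⟩ := hf.exists_size_le
  obtain ⟨Q, hQ⟩ := hg.exists_size_le
  refine foldl hf hg hh (Q + P * B) fun c l hl => ?_
  have key : ∀ (l : List α) (s : σ), (∀ a ∈ l, a ∈ f c) →
      size (l.foldl (h c) s) ≤ size s + l.length * B.eval (size c) := by
    intro l
    induction l with
    | nil => intro s _; simp
    | cons a l ih =>
      intro s hl
      have h₁ := ih (h c s a) fun b hb => hl b (List.mem_cons_of_mem _ hb)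
      have h₂ := hB c a (hl a List.mem_cons_self) s
      simp only [List.foldl_cons, List.length_cons, Nat.add_mul]
      omega
  have h₁ := key l (g c) fun a ha => hl.subset ha
  have h₂ := hQ c
  have h₃ : l.length ≤ P.eval (size c) :=
    hl.length_le.trans ((length_lt_size _).le.trans (hP c))
  have h₄ := Nat.mul_le_mul_right (B.eval (size c)) h₃
  simp only [eval_add, eval_mul]
  omega

theorem size_bool_le (b : Bool) : size b ≤ 3 := by cases b <;> simp [size, toData, Data.ofBool]

theorem any {f : γ → List α} {p : γ → α → Bool} (hf : PolyTime A f)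
    (hp : PolyTime A fun x : γ × α => p x.1 x.2) : PolyTime A fun c => (f c).any (p c) := by
  have h : PolyTime A fun c => (f c).foldl (fun s a => s || p c a) false :=
    foldl (h := fun c s a => s || p c a) hf (const false)
      (id.snd.fst.or (hp.comp (id.fst.pair id.snd.snd))) 3 fun c l _ => by
        simpa using size_bool_le _
  have key : ∀ (q : α → Bool) (l : List α) (s : Bool),
      l.foldl (fun s a => s || q a) s = (s || l.any q) := by
    intro q l
    induction l with
    | nil => simp
    | cons a l ih => intro s; simp [ih, Bool.or_assoc]
  simpa only [key, Bool.false_or] using h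

theorem all {f : γ → List α} {p : γ → α → Bool} (hf : PolyTime A f)
    (hp : PolyTime A fun x : γ × α => p x.1 x.2) : PolyTime A fun c => (f c).all (p c) := by
  have := (any (p := fun c a => !p c a) hf hp.not).not
  simpa [List.not_any_eq_all_not] using this

@[simp] theorem size_append (l m : List α) : size (l ++ m) + 1 = size l + size m := by
  induction l with
  | nil => simp; omega
  | cons a l ih => simp; omega

@[simp] theorem size_reverse (l : List α) : size l.reverse = size l := by
  induction l with
  | nil => rfl
  | cons a l ih =>
    have := size_append l.reverse [a]
    simp only [size_cons, size_nil, List.reverse_cons] at this ⊢; omega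

/-- A left fold piles up entries in reversed order. Reversal and concatenation are derived from this
form, and `flatMap` accumulates with it and reverses once at the end. -/
theorem reverse_append {f g : γ → List α} (hf : PolyTime A f) (hg : PolyTime A g) :
    PolyTime A fun c => (f c).reverse ++ g c := by
  obtain ⟨P, hP⟩ := hf.exists_size_le
  have := foldl_of_growth (h := fun _ s a => a :: s) hf hg (id.snd.snd.cons id.snd.fst) P
    fun c a ha s => by
      have := size_le_of_mem ha
      have := hP c
      simp; omega
  convert this using 2 with c
  have key : ∀ l m : List α, l.reverse ++ m = l.foldl (fun s a => a :: s) m := by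
    intro l
    induction l with
    | nil => simp
    | cons a l ih => intro m; simp [← ih]
  exact key _ _

theorem reverse {f : γ → List α} (hf : PolyTime A f) : PolyTime A fun c => (f c).reverse := by
  simpa using hf.reverse_append (const [])

theorem append {f g : γ → List α} (hf : PolyTime A f) (hg : PolyTime A g) :
    PolyTime A fun c => f c ++ g c := by
  simpa using hf.reverse.reverse_append hg

theorem flatMap {f : γ → List α} {g : γ → α → List β} (hf : PolyTime A f)
    (hg : PolyTime A fun x : γ × α => g x.1 x.2) :
    PolyTime A fun c => (f c).flatMap (g c) := by
  obtain ⟨P, hP⟩ := hf.exists_size_le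
  obtain ⟨Q, hQ⟩ := hg.exists_size_le
  have := (foldl_of_growth (h := fun c (s : List β) a => (g c a).reverse ++ s) (g := fun _ => [])
    hf (const []) ((hg.comp (id.fst.pair id.snd.snd)).reverse_append id.snd.fst)
    -- An entry of `f c` is smaller than `f c`, so the pair `(c, a)` has size at most `size c +
    -- P.eval (size c) + 1`.
    (Q.comp (X + P + 1)) fun c a ha s => by
      have h₁ := size_le_of_mem ha
      have h₂ := hP c
      have h₃ := size_append (g c a).reverse s
      have h₄ := (hQ (c, a)).trans (eval_mono Q (show _ ≤ size c + P.eval (size c) + 1 by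
        simp; omega))
      rw [size_reverse] at h₃
      simp only [eval_comp, eval_add, eval_X, eval_one] at h₄ ⊢; omega).reverse
  convert this using 2 with c
  have key : ∀ (q : α → List β) (l : List α) (s : List β),
      (l.foldl (fun s a => (q a).reverse ++ s) s).reverse = s.reverse ++ l.flatMap q := by
    intro q l
    induction l with
    | nil => simp
    | cons a l ih => intro s; rw [List.foldl_cons, ih]; simp
  rw [key]; simp

theorem map {f : γ → List α} {g : γ → α → β} (hf : PolyTime A f)
    (hg : PolyTime A fun x : γ × α => g x.1 x.2) : PolyTime A fun c => (f c).map (g c) := by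
  have := flatMap (g := fun c a => [g c a]) hf (hg.cons (const []))
  convert this using 2 with c
  induction f c with
  | nil => rfl
  | cons a l ih => simp [ih]

theorem filter {f : γ → List α} {p : γ → α → Bool} (hf : PolyTime A f)
    (hp : PolyTime A fun x : γ × α => p x.1 x.2) : PolyTime A fun c => (f c).filter (p c) := by
  have := flatMap (g := fun c a => if p c a = true then [a] else []) hf
    (hp.ite (id.snd.cons (const [])) (const []))
  convert this using 2 with c
  induction f c with
  | nil => rfl
  | cons a l ih => cases h : p c a <;> simp [h, ih]

theorem flatten {f : γ → List (List α)} (hf : PolyTime A f) : PolyTime A fun c => (f c).flatten := by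
  simpa [List.flatMap_id'] using flatMap (g := fun _ a => a) hf id.snd

/-- The number is given in unary: one entry of the first list is used up for each entry that is
kept. -/
theorem take_length {f : γ → List ν} {g : γ → List α} (hf : PolyTime A f) (hg : PolyTime A g) :
    PolyTime A fun c => (g c).take (f c).length := by
  obtain ⟨P, hP⟩ := hg.exists_size_le
  have := (foldl_of_growth (h := fun _ (s : List ν × List α) a =>
      if s.1.isEmpty = true then s else (s.1.tail, a :: s.2)) (g := fun c => (f c, []))
    hg (hf.pair (const [])) (id.snd.fst.fst.isEmpty.ite id.snd.fst
      (id.snd.fst.fst.tail.pair (id.snd.snd.cons id.snd.fst.snd)))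
    P fun c a ha s => by
      have h₁ := size_le_of_mem ha
      have h₂ := hP c
      obtain ⟨n, m⟩ := s
      cases n <;> simp; omega).snd.reverse
  convert this using 2 with c
  have key : ∀ (l : List α) (n : List ν) (m : List α),
      (l.foldl (fun (s : List ν × List α) a =>
        if s.1.isEmpty = true then s else (s.1.tail, a :: s.2)) (n, m)).2.reverse =
        m.reverse ++ l.take n.length := by
    intro l
    induction l with
    | nil => simp
    | cons a l ih =>
      intro n m
      cases n with
      | nil => simpa using ih [] m
      | cons x n => simpa using ih n (a :: m)
  rw [key]; simp

/-! Equality -/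

theorem bool_eq {f g : γ → Bool} (hf : PolyTime A f) (hg : PolyTime A g) :
    PolyTime A fun c => decide (f c = g c) := by
  convert hf.ite hg hg.not using 2 with c
  cases f c <;> cases g c <;> rfl

/-- The fold over the first list carries the unread rest of the second one and a verdict. The
default in `headD a` is harmless, since the emptiness test beside it already fails in that case.
Finally the rest must be empty. -/
theorem list_eq [DecidableEq α] (h : PolyTime A fun x : α × α => decide (x.1 = x.2))
    {f g : γ → List α} (hf : PolyTime A f) (hg : PolyTime A g) :
    PolyTime A fun c => decide (f c = g c) := by
  have h₁ : PolyTime A fun c => (f c).foldl (fun (s : List α × Bool) a =>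
      (s.1.tail, s.2 && (!s.1.isEmpty && decide (a = s.1.headD a)))) (g c, true) :=
    foldl_of_growth (h := fun _ (s : List α × Bool) a =>
      (s.1.tail, s.2 && (!s.1.isEmpty && decide (a = s.1.headD a)))) (g := fun c => (g c, true))
      hf (hg.pair (const true)) (id.snd.fst.fst.tail.pair (id.snd.fst.snd.and
        (id.snd.fst.fst.isEmpty.not.and
          (h.comp (id.snd.snd.pair (id.snd.fst.fst.headD id.snd.snd)))))) 3
      fun c a _ s => by
        obtain ⟨l, b⟩ := s
        have h₁ := size_bool_le (b && (!l.isEmpty && decide (a = l.headD a)))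
        have h₂ : size l.tail ≤ size l := by cases l <;> simp; omega
        simp only [size_mk, eval_ofNat]; omega
  convert h₁.snd.and h₁.fst.isEmpty using 2 with c
  have key : ∀ (l m : List α) (b : Bool), (b && decide (l = m)) =
      ((l.foldl (fun (s : List α × Bool) a =>
        (s.1.tail, s.2 && (!s.1.isEmpty && decide (a = s.1.headD a)))) (m, b)).2 &&
      (l.foldl (fun (s : List α × Bool) a =>
        (s.1.tail, s.2 && (!s.1.isEmpty && decide (a = s.1.headD a)))) (m, b)).1.isEmpty) := by
    intro l
    induction l with
    | nil => intro m b; cases m <;> simp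
    | cons a l ih =>
      intro m b
      cases m with
      | nil => rw [List.foldl_cons, ← ih]; simp
      | cons a' m => rw [List.foldl_cons, ← ih]; simp [Bool.and_assoc]; congr!
  simpa using key (f c) (g c) true

theorem mem [DecidableEq α] (h : PolyTime A fun x : α × α => decide (x.1 = x.2))
    {f : γ → α} {g : γ → List α} (hf : PolyTime A f) (hg : PolyTime A g) :
    PolyTime A fun c => decide (f c ∈ g c) := by
  have := any (p := fun c a => decide (f c = a)) hg (h.comp₂ (g := fun x y => decide (x = y))
    (hf.comp id.fst) id.snd)
  convert this using 2 with c
  induction g c with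
  | nil => simp
  | cons a l ih => simp [ih, Bool.decide_or]

end PolyTime

end StackProgram

/-! ### Polynomial time functions and Turing machines -/

namespace StackProgram

open Polynomial Coded Prog

variable {A : Type}

namespace Prog

/-- Read a symbol of the input into the register. -/
def popInput : Program A := .pop .input fun v a => (a, v.2)

/-- Read a symbol of the reversed input into the register. -/
def popReversed : Program A := .pop .reversed fun v a => (a, v.2)

/-- The last attempt to read a symbol was successful. -/
def hasSymbol (v : Register A) : Bool := v.1.isSome

/-- Push the symbol in the register on the stack of reversed input. -/
def pushReversed [Inhabited A] : Program A :=
  .push .reversed fun v => (v.1.getD default : A)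

/-- Reverse the input. -/
def reverseInput [Inhabited A] : Program A :=
  .seq popInput (.loop hasSymbol (.seq pushReversed popInput))

/-- Push the word `c a` if the symbol `a` in the register occurs in the list. -/
def pushCode [DecidableEq A] (c : A → List Bool) : List A → Program A
  | [] => .load id
  | a :: l => .seq (pushCode c l) (.ite (fun v => v.1 == some a) (pushWord (c a)) (.load id))

/-- Represent the list of symbols on the stack of reversed input as a tree on the main stack. -/
def readInput [DecidableEq A] (c : A → List Bool) (l : List A) : Program A :=
  .seq (pushBit .main false) <| .seq popReversed <| .loop hasSymbol <|
    .seq (pushCode c l) <| .seq (pushBit .main true) popReversed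

/-- Move a truth value from the main stack to the output. -/
def writeOutput : Program A :=
  .seq (popBit .main) <| .ite lastBit
    (.seq (popBit .main) (.seq (popBit .main) (.push .output fun _ => true)))
    (.push .output fun _ => false)

theorem exec_popInput {e : External A} {m a b : List Bool} {v : Register A} :
    Exec popInput v (conf e m a b) (e.input.head?, v.2)
      (conf { e with input := e.input.tail } m a b) 1 := by
  unfold conf
  rw [← update_input e [] [] _ e.input.tail]; exact .pop

theorem exec_popReversed {e : External A} {m a b : List Bool} {v : Register A} :
    Exec popReversed v (conf e m a b) (e.reversed.head?, v.2)
      (conf { e with reversed := e.reversed.tail } m a b) 1 := by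
  unfold conf
  rw [← update_reversed e [] [] _ e.reversed.tail]; exact .pop

theorem exec_pushReversed [Inhabited A] {e : External A} {m a b : List Bool}
    {v : Register A} : Exec pushReversed v (conf e m a b) v
      (conf { e with reversed := v.1.getD default :: e.reversed } m a b) 1 := by
  unfold conf
  rw [← update_reversed e [] [] _ (v.1.getD default :: e.reversed)]; exact .push

theorem exec_push_output {e : External A} {m a b : List Bool} {v : Register A}
    {f : Register A → Bool} :
    Exec (.push .output f) v (conf e m a b) v
      (conf { e with output := f v :: e.output } m a b) 1 := by
  unfold conf
  rw [← update_output e [] [] _ (f v :: e.output)]; exact .push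

theorem exec_pushBit_main (e : External A) (m a b : List Bool) (y : Bool) (v : Register A) :
    Exec (pushBit .main y) v (conf e m a b) v (conf e (y :: m) a b) 1 := by
  simpa [conf] using exec_pushBit (v := v) (e := e) (x := []) (c := [])
    (d := triple m a b) (k := .main) (y := y)

theorem exec_pushWord (e : External A) (m a b : List Bool) (v : Register A) : ∀ w : List Bool,
    Exec (pushWord w) v (conf e m a b) v (conf e (w ++ m) a b) (w.length + 1)
  | [] => .load
  | y :: w => (exec_pushWord e m a b v w).seq (exec_pushBit_main e _ a b y v)

theorem exec_reverseInput [Inhabited A] (l r : List A) (o m a b : List Bool) (v : Register A) :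
    ∃ v', Exec reverseInput v (conf ⟨l, r, o⟩ m a b) v' (conf ⟨[], l.reverse ++ r, o⟩ m a b)
      (3 * l.length + 2) := by
  suffices h : ∀ (l r : List A) (z : Option Bool), ∃ v',
      Exec (.loop hasSymbol (.seq pushReversed popInput))
        (l.head?, z) (conf ⟨l.tail, r, o⟩ m a b) v' (conf ⟨[], l.reverse ++ r, o⟩ m a b)
        (3 * l.length + 1) by
    obtain ⟨v', h⟩ := h l r v.2
    have := (exec_popInput (e := ⟨l, r, o⟩)).seq h
    exact ⟨v', this.mono (by omega)⟩
  intro l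
  induction l with
  | nil => exact fun r z => ⟨_, .loop_false rfl⟩
  | cons x l ih =>
    intro r z
    obtain ⟨v', h⟩ := ih (x :: r) z
    have h₀ := Exec.seq (exec_pushReversed (e := ⟨l, r, o⟩) (m := m) (a := a) (b := b)
      (v := (some x, z))) exec_popInput
    have := Exec.loop_true (c := hasSymbol) rfl h₀ h
    refine ⟨v', ?_⟩
    simpa using this.mono (t' := 3 * (l.length + 1) + 1) (by omega)

/-- The tests run through a list without repetitions, so at most one of them fires and the code is
not pushed twice. -/
theorem exec_pushCode [DecidableEq A] (c : A → List Bool) (e : External A) (m a b : List Bool)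
    (x : A) (z : Option Bool) (K : ℕ) (hK : (c x).length ≤ K) : ∀ l : List A, l.Nodup →
      Exec (pushCode c l) (some x, z) (conf e m a b) (some x, z)
        (conf e ((if x ∈ l then c x else []) ++ m) a b) (l.length * (K + 2) + 1)
  | [], _ => .mono (.load (f := id)) (by simp)
  | y :: l, hl => by
    obtain ⟨hy, hl⟩ := List.nodup_cons.1 hl
    have h := exec_pushCode c e m a b x z K hK l hl
    by_cases hxy : x = y
    · subst hxy
      rw [if_neg hy] at h
      have := h.seq (Exec.ite_true (c := fun v => v.1 == some x) (q := .load id) (by simp)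
        (exec_pushWord e _ a b (some x, z) (c x)))
      simp only [List.mem_cons, true_or, if_true]
      exact this.mono (by simp only [List.length_cons, Nat.add_mul]; omega)
    · have := h.seq (Exec.ite_false (c := fun v => v.1 == some y) (p := pushWord (c y))
        (by simpa using hxy) (.load (f := id)))
      simp only [List.mem_cons, hxy, false_or]
      exact this.mono (by simp only [List.length_cons, Nat.add_mul]; omega)

/-- The tree of a list is built from its end: first the bit `false` for the empty list, then for
each symbol its code and a bit `true`. The symbols are therefore needed last one first, which is why
the input is reversed beforehand. -/
theorem exec_readInput [Fintype A] [DecidableEq A] [Coded A] (K : ℕ)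
    (hK : ∀ x : A, size x ≤ K) (l : List A) (o a b : List Bool) (v : Register A) :
    ∃ v', Exec (readInput (fun x : A => (toData x).word) Finset.univ.toList) v
      (conf ⟨[], l.reverse, o⟩ [] a b) v' (conf ⟨[], [], o⟩ (toData l).word a b)
      (l.length * (Fintype.card A * (K + 2) + 4) + 3) := by
  set body : Program A := .seq (pushCode (fun x : A => (toData x).word) Finset.univ.toList) <|
    .seq (pushBit .main true) popReversed with hbody
  suffices h : ∀ (l l' : List A) (z : Option Bool), ∃ v',
      Exec (.loop hasSymbol body) (l.head?, z) (conf ⟨[], l.tail, o⟩ (toData l').word a b) v'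
        (conf ⟨[], [], o⟩ (toData (l.reverse ++ l')).word a b)
        (l.length * (Fintype.card A * (K + 2) + 4) + 1) by
    obtain ⟨v', h⟩ := h l.reverse [] v.2
    have := (exec_pushBit_main ⟨[], l.reverse, o⟩ [] a b false v).seq (exec_popReversed.seq h)
    simp only [List.reverse_reverse, List.append_nil, List.length_reverse] at this
    exact ⟨v', this.mono (by omega)⟩
  intro l
  induction l with
  | nil => exact fun l' z => ⟨_, (Exec.loop_false rfl).mono (by simp)⟩
  | cons x l ih =>
    intro l' z
    obtain ⟨v', h⟩ := ih (x :: l') z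
    have h₀ := exec_pushCode (fun x : A => (toData x).word) ⟨[], l, o⟩ (toData l').word a b x z K
      (hK x) Finset.univ.toList (Finset.nodup_toList _)
    rw [if_pos (by simp), Finset.length_toList] at h₀
    have h₁ := h₀.seq ((exec_pushBit_main ⟨[], l, o⟩ _ a b true (some x, z)).seq exec_popReversed)
    have := Exec.loop_true (c := hasSymbol) rfl h₁ h
    refine ⟨v', ?_⟩
    simp only [List.reverse_cons, List.append_assoc, List.singleton_append]
    exact this.mono (by rw [List.length_cons, Nat.add_mul, Finset.card_univ]; omega)

theorem exec_writeOutput (y : Bool) (v : Register A) :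
    ∃ v', Exec writeOutput v (conf ⟨[], [], []⟩ (toData y).word [] []) v'
      (conf ⟨[], [], [y]⟩ [] [] []) 6 := by
  cases y with
  | false =>
    exact ⟨_, ((exec_popBit_main _ [] [] [] false v).seq (.ite_false rfl exec_push_output)).mono
      (by omega)⟩
  | true =>
    exact ⟨_, ((exec_popBit_main _ [false, false] [] [] true v).seq (.ite_true rfl
      ((exec_popBit_main _ [false] [] [] false _).seq
        ((exec_popBit_main _ [] [] [] false _).seq exec_push_output)))).mono (by omega)⟩

end Prog

/-- The Turing machine that runs a program and clears the register at the end. -/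
def machine [Fintype A] (p : Program A) : Turing.FinTM2 where
  K := Stack
  k₀ := .input
  k₁ := .output
  Γ := Alphabet A
  Λ := Option p.Label
  main := some p.entry
  σ := Register A
  initialState := (none, none)
  Γk₀Fin := inferInstanceAs (Fintype A)
  m l := match l with
    | some l => p.code some none l
    | none => .load (fun _ => (none, none)) .halt

/-- The additional step is the halting label, which resets the register as the prescribed final
configuration demands. The list `l'` is separate from `l` because the alphabet of the input stack
equals `A` only after unfolding `machine`. -/
theorem machine_outputs [Fintype A] {p : Program A} {v : Register A} {l : List A}
    {o : List Bool} {t : ℕ}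
    (h : Exec p (none, none) (conf ⟨l, [], []⟩ [] [] []) v (conf ⟨[], [], o⟩ [] [] []) t)
    (l' : List ((machine p).Γ (machine p).k₀)) (hl : l' = l) :
    Nonempty (Turing.TM2OutputsInTime (machine p) l' (some o) (t + 1)) := by
  subst hl
  obtain ⟨n, hn, h⟩ := h.steps (machine p).m some none fun _ => rfl
  have h₁ : Turing.initList (machine p) l' =
      ⟨some (some p.entry), (none, none), conf ⟨l', [], []⟩ [] [] []⟩ := by
    unfold Turing.initList
    congr 1
    funext k
    rcases k with _ | _ | _ | _ | _ | k <;> try rfl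
    cases k <;> rfl
  have h₂ : Turing.haltList (machine p) o =
      ⟨none, (none, none), conf ⟨[], [], o⟩ [] [] []⟩ := by
    unfold Turing.haltList
    congr 1
    funext k
    rcases k with _ | _ | _ | _ | _ | k <;> try rfl
    cases k <;> rfl
  have h₃ := h.trans (Steps.single (M := (machine p).m) (l := (none : Option p.Label)) (v := v)
    (S := conf ⟨[], [], o⟩ [] [] []) rfl)
  refine ⟨⟨⟨n + 1, ?_⟩, Nat.succ_le_succ hn⟩⟩
  exact (congrArg (fun c => (flip bind (machine p).step)^[n + 1] (some c)) h₁).trans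
    (Eq.trans h₃ (congrArg some h₂.symm))

/-- Polynomial time functions with truth values give problems in P. -/
theorem PolyTime.inP [Fintype A] [DecidableEq A] [Inhabited A] [Coded A] {α : Type}
    {e : Computability.Encoding α A} {S : Set α} {f : List A → Bool} (hf : PolyTime A f)
    (h : ∀ x, f (e.encode x) = true ↔ x ∈ S) : DefaultLogic.InP e S := by
  classical
  obtain ⟨p, P, hp⟩ := hf
  obtain ⟨K, hK⟩ : ∃ K, ∀ x : A, size x ≤ K :=
    ⟨Finset.univ.sup size, fun x => Finset.le_sup (Finset.mem_univ x)⟩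
  have hsize : ∀ l : List A, size l ≤ l.length * (K + 1) + 1 := by
    intro l
    induction l with
    | nil => simp
    | cons x l ih =>
      have := hK x
      simp only [size_cons, List.length_cons, Nat.add_mul] at ih ⊢
      omega
  set q : Program A := .seq reverseInput <|
    .seq (readInput (fun x : A => (toData x).word) Finset.univ.toList) <| .seq p writeOutput with hq
  have key : ∀ l : List A, ∃ v, Exec q (none, none) (conf ⟨l, [], []⟩ [] [] []) v
      (conf ⟨[], [], [f l]⟩ [] [] [])
      (3 * l.length + 2 + (l.length * (Fintype.card A * (K + 2) + 4) + 3 +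
        (P.eval (l.length * (K + 1) + 1) + 6))) := by
    intro l
    obtain ⟨v₁, h₁⟩ := exec_reverseInput l [] [] [] [] [] (none, none)
    obtain ⟨v₂, h₂⟩ := exec_readInput K hK l [] [] [] v₁
    obtain ⟨v₃, h₃⟩ := (hp l).2 ⟨[], [], []⟩ [] [] [] v₂
    obtain ⟨v₄, h₄⟩ := exec_writeOutput (f l) v₃
    simp only [List.append_nil] at h₁ h₃
    exact ⟨v₄, h₁.seq (h₂.seq ((h₃.mono (eval_mono P (hsize l))).seq h₄))⟩
  choose v hv using key
  refine ⟨⟨⟨machine q, Equiv.refl _, Equiv.refl _⟩,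
    3 * X + 2 + (X * C (Fintype.card A * (K + 2) + 4) + 3 +
        (P.comp (X * C (K + 1) + 1) + 6)) + 1, fun x => ?_⟩⟩
  have h₁ : decide (x ∈ S) = f (e.encode x) := by
    rw [Bool.eq_iff_iff, h x, decide_eq_true_iff]
  rw [h₁]
  have h₂ : (3 * X + 2 + (X * C (Fintype.card A * (K + 2) + 4) + 3 +
        (P.comp (X * C (K + 1) + 1) + 6)) + 1 : ℕ[X]).eval (e.encode x).length =
      3 * (e.encode x).length + 2 + ((e.encode x).length * (Fintype.card A * (K + 2) + 4) + 3 +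
        (P.eval ((e.encode x).length * (K + 1) + 1) + 6)) + 1 := by
    simp
  rw [h₂]
  exact Classical.choice (machine_outputs (hv (e.encode x)) _ (List.map_id _))

end StackProgram

/-! ### Strong backdoors into ID -/

namespace DefaultLogic

section

variable {V : Type}

theorem Literal.holds_compl (w : V → Bool) (l : Literal V) :
    l.compl.Holds w ↔ ¬ l.Holds w := by
  cases l <;> simp [Literal.compl, Literal.Holds]

theorem subset_Th (S : Set (CNF V)) : S ⊆ Th S := fun _ hφ _ hv => hv _ hφ

theorem Th_Th (S : Set (CNF V)) : Th (Th S) = Th S :=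
  Set.Subset.antisymm (fun _ hφ v hv => hφ v fun _ hψ => hψ v hv) (subset_Th _)

theorem Th_mono {S S' : Set (CNF V)} (h : S ⊆ S') : Th S ⊆ Th S' :=
  fun _ hφ v hv => hφ v fun _ hψ => hv _ (h hψ)

theorem mem_Th_singleton {φ ψ : CNF V} :
    ψ ∈ Th {φ} ↔ ∀ w, CNF.Sat w φ → CNF.Sat w ψ := by
  simp [Th, Entails]

variable [DecidableEq V]

/-- The negation of a CNF formula is equivalent to a CNF formula. -/
theorem exists_isNegationOf (β : CNF V) : ∃ ψ, IsNegationOf ψ β := by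
  induction β using Finset.induction_on with
  | empty => exact ⟨CNF.bot, fun v => by simp [CNF.Sat, CNF.bot]⟩
  | insert C β _ ih =>
    obtain ⟨ψ, hψ⟩ := ih
    -- The negation of `C ∧ β` is the disjunction of the conjunction of all complements of literals
    -- of `C` with `ψ`; distributing gives one clause for each pair.
    refine ⟨(C ×ˢ ψ).image fun p => insert p.1.compl p.2, fun v => ?_⟩
    have h : ¬ CNF.Sat v (insert C β) ↔
        (∀ l ∈ C, ¬ Literal.Holds v l) ∨ ¬ CNF.Sat v β := by
      simp only [CNF.Sat, Finset.forall_mem_insert, not_and_or]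
      simp
    rw [h, ← hψ v]
    simp only [CNF.Sat, Finset.mem_image, Finset.mem_product, Prod.exists, forall_exists_index,
      and_imp]
    constructor
    · intro h
      by_contra! hcon
      obtain ⟨⟨l, hl, hlv⟩, D, hD, hDv⟩ := hcon
      obtain ⟨l', hl', hv⟩ := h _ l D hl hD rfl
      rcases Finset.mem_insert.1 hl' with rfl | hl'
      · exact (l.holds_compl v).1 hv hlv
      · exact hDv l' hl' hv
    · rintro h _ l D hl hD rfl
      rcases h with h | h
      · exact ⟨l.compl, Finset.mem_insert_self _ _, (l.holds_compl v).2 (h l hl)⟩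
      · obtain ⟨l', hl', hv⟩ := h D hD
        exact ⟨l', Finset.mem_insert_of_mem hl', hv⟩

/-- A CNF negation of `β` always exists, and a deductively closed set contains it as soon as no
model of the set satisfies `β`. Justifications become a semantic matter. -/
theorem negMem_iff {E : Set (CNF V)} (hE : E = Th E) (β : CNF V) :
    NegMem β E ↔ ∀ w, (∀ φ ∈ E, CNF.Sat w φ) → ¬ CNF.Sat w β := by
  constructor
  · rintro ⟨ψ, hψE, hψ⟩ w hw
    exact (hψ w).1 (hw ψ hψE)
  · intro h
    obtain ⟨ψ, hψ⟩ := exists_isNegationOf β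
    refine ⟨ψ, ?_, hψ⟩
    rw [hE]
    exact fun w hw => (hψ w).2 (h w hw)

/-- Outside `B`, every clause has at most one literal, and this literal is positive. -/
def CNF.IsPositiveUnitOutside (B : Finset V) (φ : CNF V) : Prop :=
  ∀ C ∈ φ, ∀ l ∈ C, l.var ∉ B → (∃ x, l = .pos x) ∧ ∀ l' ∈ C, l'.var ∉ B → l' = l

/-- An injective renaming keeps signs and does not merge literals, so passing to the variables with
fresh `y_δ` does not affect membership in ID. -/
theorem rename_inl_mem_classID {U : Type} [DecidableEq U] (φ : CNF V) :
    CNF.rename (Sum.inl : V → V ⊕ U) φ ∈ classID (V ⊕ U) ↔ φ ∈ classID V := by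
  simp only [classID, CNF.rename, Set.mem_ofPred_eq, Finset.forall_mem_image]
  refine forall₂_congr fun C _ => or_congr Finset.image_eq_empty ⟨?_, ?_⟩
  · rintro ⟨x, hx⟩
    have hC : ∀ l ∈ C, Literal.map Sum.inl l = .pos x := fun l hl => by
      simpa [hx] using Finset.mem_image_of_mem (Literal.map (Sum.inl : V → V ⊕ U)) hl
    obtain ⟨l, hl⟩ : C.Nonempty := by
      rw [← Finset.image_nonempty (f := Literal.map (Sum.inl : V → V ⊕ U)), hx]; simp
    have hl' := hC l hl
    cases l with
    | neg y => cases hl'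
    | pos y =>
      refine ⟨y, Finset.eq_singleton_iff_unique_mem.2 ⟨hl, fun l' h => ?_⟩⟩
      have := (hC l' h).trans hl'.symm
      cases l' with
      | neg z => cases this
      | pos z => injection this with this; rw [Sum.inl_injective this]
  · rintro ⟨x, rfl⟩
    exact ⟨.inl x, by simp [Literal.map]⟩

/-- The reduct by `x_ε` deletes no clause. Taken for all of `B`, it exposes the part outside `B` of
every clause at once, so it is the most demanding reduct. -/
theorem reducts_eps (l : List V) : ∀ φ : CNF V, CNF.reducts φ (l.map .eps) =
    φ.image fun C => C.filter fun t => t.var ∉ l := by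
  induction l with
  | nil => intro φ; simp [CNF.reducts]
  | cons x l ih =>
    intro φ
    have h := ih (φ.reduct (.eps x))
    simp only [CNF.reducts, List.map_cons, List.foldl_cons] at h ⊢
    rw [h, CNF.reduct, Finset.image_image]
    congr 1
    funext C
    ext t
    have ht : t.var = x ↔ t = .pos x ∨ t = .neg x := by cases t <;> simp [Literal.var]
    simp only [Function.comp, Finset.mem_filter, Finset.mem_erase, List.mem_cons, ht]
    tauto

/-- Whatever the extended literal, clauses can only disappear or shrink, and its variable is gone
afterwards. A condition on the parts of clauses outside `B` is therefore inherited by all reducts.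
-/
theorem mem_reduct {φ : CNF V} {y : ExtLiteral V} {C' : Clause V} (h : C' ∈ φ.reduct y) :
    ∃ C ∈ φ, C' ⊆ C ∧ ∀ l ∈ C', l.var ≠ y.var := by
  cases y with
  | lit t =>
    simp only [CNF.reduct, Finset.mem_image, Finset.mem_filter] at h
    obtain ⟨C, ⟨hC, ht⟩, rfl⟩ := h
    refine ⟨C, hC, Finset.erase_subset _ _, fun l hl hv => ?_⟩
    obtain ⟨h₁, h₂⟩ := Finset.mem_erase.1 hl
    cases l <;> cases t <;> simp_all [Literal.var, Literal.compl, ExtLiteral.var]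
  | eps x =>
    simp only [CNF.reduct, Finset.mem_image] at h
    obtain ⟨C, hC, rfl⟩ := h
    refine ⟨C, hC, (Finset.erase_subset _ _).trans (Finset.erase_subset _ _), fun l hl hv => ?_⟩
    cases l <;> simp_all [Literal.var, ExtLiteral.var]

theorem mem_reducts (Y : List (ExtLiteral V)) : ∀ {φ : CNF V} {C' : Clause V},
    C' ∈ φ.reducts Y → ∃ C ∈ φ, C' ⊆ C ∧ ∀ l ∈ C', l.var ∉ Y.map ExtLiteral.var := by
  induction Y with
  | nil => exact fun {φ C'} h => ⟨C', h, subset_rfl, by simp⟩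
  | cons y Y ih =>
    intro φ C' h
    obtain ⟨C₁, hC₁, hsub₁, hv₁⟩ := ih (φ := φ.reduct y) h
    obtain ⟨C, hC, hsub, hv⟩ := mem_reduct hC₁
    refine ⟨C, hC, hsub₁.trans hsub, fun l hl => ?_⟩
    rw [List.map_cons, List.mem_cons, not_or]
    exact ⟨hv l (hsub₁ hl), hv₁ l hl⟩

theorem CNF.IsPositiveUnitOutside.reducts_mem {B : Finset V} {φ : CNF V}
    (h : φ.IsPositiveUnitOutside B) {Y : List (ExtLiteral V)} (hY : IsThreefoldAssignment B Y) :
    φ.reducts Y ∈ classID V := by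
  intro C' hC'
  obtain ⟨C, hC, hsub, hv⟩ := mem_reducts Y hC'
  have hB : ∀ l ∈ C', l.var ∉ B := fun l hl => by
    rw [← hY.2, List.mem_toFinset]; exact hv l hl
  rcases C'.eq_empty_or_nonempty with h' | ⟨l, hl⟩
  · exact .inl h'
  · obtain ⟨⟨x, rfl⟩, huniq⟩ := h C hC l (hsub hl) (hB l hl)
    exact .inr ⟨x, Finset.eq_singleton_iff_unique_mem.2
      ⟨hl, fun l' hl' => huniq l' (hsub hl') (hB l' hl')⟩⟩

theorem isPositiveUnitOutside_of_reducts {B : Finset V} {φ : CNF V}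
    (h : φ.reducts (B.toList.map .eps) ∈ classID V) : φ.IsPositiveUnitOutside B := by
  rw [reducts_eps] at h
  intro C hC l hl hlB
  have hmem : ∀ l ∈ C, l.var ∉ B → l ∈ C.filter fun t => t.var ∉ B.toList := fun l hl h => by
    simpa using ⟨hl, h⟩
  rcases h _ (Finset.mem_image_of_mem _ hC) with h | ⟨x, hx⟩
  · have := hmem l hl hlB
    simp only [h, Finset.notMem_empty] at this
  · simp only [hx, Finset.mem_singleton] at hmem
    exact ⟨⟨x, hmem l hl hlB⟩, fun l' hl' h' => (hmem l' hl' h').trans (hmem l hl hlB).symm⟩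

theorem isThreefoldAssignment_eps (B : Finset V) :
    IsThreefoldAssignment B (B.toList.map .eps) := by
  have : (B.toList.map .eps).map ExtLiteral.var = B.toList := by
    simp [List.map_map, Function.comp_def, ExtLiteral.var]
  exact ⟨by rw [this]; exact B.nodup_toList, by rw [this]; exact B.toList_toFinset⟩

/-- All formulas of the theory satisfy `p`. -/
def DefaultTheory.Forall (T : DefaultTheory V) (p : CNF V → Prop) : Prop :=
  (∀ φ ∈ T.W, p φ) ∧ ∀ δ ∈ T.D, p δ.prereq ∧ p δ.just ∧ p δ.concl

theorem classID_union {φ ψ : CNF V} :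
    φ ∪ ψ ∈ classID V ↔ φ ∈ classID V ∧ ψ ∈ classID V := by
  simp [classID, Finset.mem_union, or_imp, forall_and]

/-- The added clauses `{y_δ}` are positive unit clauses, and ID is closed under unions and
subformulas; so the reduct theory can be tested formula by formula over the old variables. -/
theorem reducts_inClass_iff (T : DefaultTheory V) (Y : List (ExtLiteral V)) :
    (T.reducts Y).InClass classID ↔ T.Forall fun φ => φ.reducts Y ∈ classID V := by
  have hy : ∀ δ : Default V, ({{Literal.pos (Sum.inr δ)}} : CNF (V ⊕ Default V)) ∈
      classID (V ⊕ Default V) := fun δ C hC => .inr ⟨_, Finset.mem_singleton.1 hC⟩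
  unfold DefaultTheory.InClass DefaultTheory.Forall DefaultTheory.reducts
  simp only [Finset.mem_singleton, forall_eq, Finset.forall_mem_image, classID_union,
    rename_inl_mem_classID, hy, and_true]
  refine and_congr ?_ Iff.rfl
  simp only [classID, Set.mem_ofPred_eq, Finset.mem_biUnion]
  exact ⟨fun h φ hφ C hC => h C ⟨φ, hφ, hC⟩, fun h C ⟨φ, hφ, hC⟩ => h φ hφ C hC⟩

/-- The assignment with `x_ε` throughout forces the syntactic condition, and the condition passes to
all other reducts. The right-hand side can be decided in polynomial time. -/
theorem isStrongBackdoor_classID_iff (T : DefaultTheory V) (B : Finset V) :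
    T.IsStrongBackdoor classID B ↔
      B ⊆ T.vars ∧ T.Forall fun φ => φ.IsPositiveUnitOutside B := by
  unfold DefaultTheory.IsStrongBackdoor
  refine and_congr Iff.rfl ⟨fun h => ?_, fun h Y hY => ?_⟩
  · obtain ⟨h₁, h₂⟩ := (reducts_inClass_iff T _).1 (h _ (isThreefoldAssignment_eps B))
    exact ⟨fun φ hφ => isPositiveUnitOutside_of_reducts (h₁ φ hφ), fun δ hδ =>
      ⟨isPositiveUnitOutside_of_reducts (h₂ δ hδ).1,
        isPositiveUnitOutside_of_reducts (h₂ δ hδ).2.1,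
        isPositiveUnitOutside_of_reducts (h₂ δ hδ).2.2⟩⟩
  · exact (reducts_inClass_iff T Y).2 ⟨fun φ hφ => (h.1 φ hφ).reducts_mem hY, fun δ hδ =>
      ⟨(h.2 δ hδ).1.reducts_mem hY, (h.2 δ hδ).2.1.reducts_mem hY,
        (h.2 δ hδ).2.2.reducts_mem hY⟩⟩

end

end DefaultLogic

/-! ### Evaluation by guessing the consistent assignments of the backdoor variables -/

namespace DefaultLogic

/-- The truth value of a literal. -/
def Literal.eval {V : Type} (w : V → Bool) : Literal V → Bool
  | pos x => w x
  | neg x => !w x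

theorem Literal.eval_eq_true {V : Type} (w : V → Bool) (l : Literal V) :
    l.eval w = true ↔ l.Holds w := by
  cases l <;> simp [Literal.eval, Literal.Holds]

/-! ### Entailment through greatest assignments and least models over the backdoor -/

namespace RawCNF

/-- The truth value of a clause. -/
def evalClause (w : Var → Bool) (C : List (Literal Var)) : Bool := C.any fun l => l.eval w

/-- The truth value of a formula. -/
def eval (w : Var → Bool) (r : RawCNF) : Bool := List.all r (evalClause w)

theorem evalClause_eq_true (w : Var → Bool) (C : List (Literal Var)) :
    evalClause w C = true ↔ ∃ l ∈ C, l.Holds w := by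
  simp [evalClause, Literal.eval_eq_true]

theorem eval_eq_true (w : Var → Bool) (r : RawCNF) :
    r.eval w = true ↔ ∀ C ∈ r, ∃ l ∈ C, l.Holds w := by
  simp [eval, evalClause_eq_true]

theorem sat_toCNF (w : Var → Bool) (r : RawCNF) : CNF.Sat w r.toCNF ↔ r.eval w = true := by
  simp [eval_eq_true, CNF.Sat, toCNF]

/-- Outside `B`, every clause has at most one literal, and this literal is positive. -/
def IsPositiveUnitOutside (B : List Var) (r : RawCNF) : Prop :=
  ∀ C ∈ r, ∀ l ∈ C, l.var ∉ B → (∃ x, l = .pos x) ∧ ∀ l' ∈ C, l'.var ∉ B → l' = l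

theorem isPositiveUnitOutside_toCNF (B : List Var) (r : RawCNF) :
    r.toCNF.IsPositiveUnitOutside B.toFinset ↔ r.IsPositiveUnitOutside B := by
  simp [CNF.IsPositiveUnitOutside, IsPositiveUnitOutside, toCNF]

/-- The variables of `v` and the variables outside `B` are true. -/
def greatest (B v : List Var) (x : Var) : Bool := decide (x ∈ v) || !decide (x ∈ B)

/-- The least model of `r` among the assignments that are given by `v` on `B`, if there is such
a model. -/
def least (B v : List Var) (r : RawCNF) (x : Var) : Bool :=
  decide (x ∈ v) || (!decide (x ∈ B) && List.any r fun C =>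
    !evalClause (fun y => decide (y ∈ v)) C && decide (Literal.pos x ∈ C))

/-- The assignment `w` is given by `v` on `B`. -/
def Agrees (B v : List Var) (w : Var → Bool) : Prop := ∀ x ∈ B, w x = decide (x ∈ v)

variable {B v : List Var} {r α : RawCNF} {w : Var → Bool}

theorem Agrees.eval_eq (h : Agrees B v w) {l : Literal Var} (hl : l.var ∈ B) :
    l.eval w = l.eval fun y => decide (y ∈ v) := by
  have := h _ hl
  cases l <;> simp only [Literal.eval, Literal.var] at this ⊢ <;> rw [this] <;> congr

theorem agrees_greatest : Agrees B v (greatest B v) := fun x hx => by simp [greatest, hx]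

theorem agrees_least : Agrees B v (least B v r) := fun x hx => by simp [least, hx]

/-- Literals outside `B` are positive, so making all variables outside `B` true destroys no
satisfied literal. -/
theorem eval_greatest (hr : r.IsPositiveUnitOutside B) (hw : Agrees B v w)
    (h : r.eval w = true) : r.eval (greatest B v) = true := by
  rw [eval_eq_true] at h ⊢
  intro C hC
  obtain ⟨l, hl, hlw⟩ := h C hC
  refine ⟨l, hl, ?_⟩
  by_cases hB : l.var ∈ B
  · rw [← Literal.eval_eq_true] at hlw ⊢
    rw [agrees_greatest.eval_eq hB, ← hw.eval_eq hB, hlw]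
  · obtain ⟨⟨x, rfl⟩, -⟩ := hr C hC l hl hB
    have hx : x ∉ B := hB
    simp [Literal.Holds, greatest, hx]

/-- A clause that is false with `v` on `B` and `false` elsewhere can only be satisfied by its single
literal outside `B`, and `least` makes exactly those variables true. The hypothesis `v ⊆ B` ensures
that membership in `v` sets no outside variable. -/
theorem eval_least (hv : v ⊆ B) (hr : r.IsPositiveUnitOutside B)
    (h : r.eval (greatest B v) = true) : r.eval (least B v r) = true := by
  rw [eval_eq_true] at h ⊢
  intro C hC
  by_cases hlow : evalClause (fun y => decide (y ∈ v)) C = true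
  · obtain ⟨l, hl, hlw⟩ := (evalClause_eq_true _ _).1 hlow
    refine ⟨l, hl, ?_⟩
    by_cases hB : l.var ∈ B
    · rw [← Literal.eval_eq_true] at hlw ⊢
      rw [agrees_least.eval_eq hB, hlw]
    · obtain ⟨⟨x, rfl⟩, -⟩ := hr C hC l hl hB
      have hx : x ∈ v := by simpa [Literal.Holds] using hlw
      exact absurd (hv hx) hB
  · obtain ⟨l, hl, hlw⟩ := h C hC
    refine ⟨l, hl, ?_⟩
    by_cases hB : l.var ∈ B
    · rw [← Literal.eval_eq_true, agrees_greatest.eval_eq hB, Literal.eval_eq_true] at hlw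
      exact absurd ((evalClause_eq_true _ _).2 ⟨l, hl, hlw⟩) hlow
    · obtain ⟨⟨x, rfl⟩, -⟩ := hr C hC l hl hB
      have hx : x ∉ B := hB
      simp only [Literal.Holds, least, hx, Bool.or_eq_true, Bool.and_eq_true, List.any_eq_true]
      exact .inr ⟨by simp, C, hC, by simp [hlow, hl]⟩

/-- Each variable made true by `least` outside `B` is the only outside literal of a clause whose
other literals are false under `v`, so every model over `v` must make it true. -/
theorem least_le (hr : r.IsPositiveUnitOutside B) (hw : Agrees B v w)
    (h : r.eval w = true) {x : Var} (hx : x ∉ B) (hxv : x ∉ v) (hl : least B v r x = true) :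
    w x = true := by
  simp only [least, hx, hxv, decide_false, Bool.false_or, Bool.not_false, Bool.true_and,
    List.any_eq_true, Bool.and_eq_true, Bool.not_eq_true', decide_eq_true_eq] at hl
  obtain ⟨C, hC, hlow, hxC⟩ := hl
  obtain ⟨l, hlC, hlw⟩ := (eval_eq_true _ _).1 h C hC
  by_cases hB : l.var ∈ B
  · rw [← Literal.eval_eq_true, hw.eval_eq hB, Literal.eval_eq_true] at hlw
    rw [(evalClause_eq_true _ _).2 ⟨l, hlC, hlw⟩] at hlow
    cases hlow
  · obtain ⟨-, huniq⟩ := hr C hC l hlC hB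
    rw [← huniq _ hxC hx] at hlw
    exact hlw

/-- Truth of `α` passes upwards from the least model, because `α` too has only positive literals
outside `B`. -/
theorem eval_of_least (hv : v ⊆ B) (hr : r.IsPositiveUnitOutside B)
    (hα : α.IsPositiveUnitOutside B) (hw : Agrees B v w) (h : r.eval w = true)
    (hl : α.eval (least B v r) = true) : α.eval w = true := by
  rw [eval_eq_true] at hl ⊢
  intro C hC
  obtain ⟨l, hlC, hlw⟩ := hl C hC
  refine ⟨l, hlC, ?_⟩
  by_cases hB : l.var ∈ B
  · rw [← Literal.eval_eq_true] at hlw ⊢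
    rw [hw.eval_eq hB, ← agrees_least.eval_eq hB, hlw]
  · obtain ⟨⟨x, rfl⟩, -⟩ := hα C hC l hlC hB
    exact least_le hr hw h hB (fun hx => hB (hv hx)) hlw

/-- The list `L` represents all assignments of the variables in `B`. -/
structure Covers (B : List Var) (L : List (List Var)) : Prop where
  subset : ∀ v ∈ L, v ⊆ B
  exists_agrees : ∀ w : Var → Bool, ∃ v ∈ L, Agrees B v w

/-- The formula `r` entails `α`; the assignments of the variables in `B` are listed in `L`. -/
def entails (B : List Var) (L : List (List Var)) (r α : RawCNF) : Bool :=
  L.all fun v => !r.eval (greatest B v) || α.eval (least B v r)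

/-- Over each `v` the greatest assignment decides whether `r` has a model, and if so, the least
model decides whether all models satisfy `α`. -/
theorem entails_iff {L : List (List Var)} (hL : Covers B L) (hr : r.IsPositiveUnitOutside B)
    (hα : α.IsPositiveUnitOutside B) :
    entails B L r α = true ↔ ∀ w, r.eval w = true → α.eval w = true := by
  simp only [entails, List.all_eq_true, Bool.or_eq_true, Bool.not_eq_true']
  constructor
  · intro h w hw
    obtain ⟨v, hv, hvw⟩ := hL.exists_agrees w
    rcases h v hv with h | h
    · rw [eval_greatest hr hvw hw] at h; cases h
    · exact eval_of_least (hL.subset v hv) hr hα hvw hw h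
  · intro h v hv
    by_cases hg : r.eval (greatest B v) = true
    · exact .inr (h _ (eval_least (hL.subset v hv) hr hg))
    · exact .inl (by simpa using hg)

theorem IsPositiveUnitOutside.append {s : RawCNF} (hr : r.IsPositiveUnitOutside B)
    (hs : s.IsPositiveUnitOutside B) :
    IsPositiveUnitOutside B (r ++ s) := fun C hC => by
  rcases List.mem_append.1 hC with h | h
  · exact hr C h
  · exact hs C h

end RawCNF

/-! ### The closure computed from a guessed list of consistent assignments -/

namespace RawInstance

open RawCNF

/-- All formulas of the instance satisfy `p`. -/
def Forall (I : RawInstance) (p : RawCNF → Prop) : Prop :=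
  (∀ r ∈ I.kb, p r) ∧ ∀ d ∈ I.rules, p d.1 ∧ p d.2.1 ∧ p d.2.2

theorem theory_forall (I : RawInstance) (p : CNF Var → Prop) :
    I.theory.Forall p ↔ I.Forall fun r => p r.toCNF := by
  simp only [DefaultTheory.Forall, Forall, theory, List.mem_toFinset, List.forall_mem_map]

/-- The knowledge base and the conclusions of the given rules. -/
def conclusions (I : RawInstance) (l : List (RawCNF × RawCNF × RawCNF)) : RawCNF :=
  I.kb.flatten ++ l.flatMap fun d => d.2.2

/-- The rule `d` is applicable if `r` is derived and the assignments `A` are consistent with the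
extension. -/
def applicable (B : List Var) (L A : List (List Var)) (r : RawCNF)
    (d : RawCNF × RawCNF × RawCNF) : Bool :=
  entails B L r d.1 && A.any fun v => d.2.1.eval (greatest B v)

/-- The applicable rules after the rules `l` have been applied. -/
def applyRules (I : RawInstance) (B : List Var) (L A : List (List Var))
    (l : List (RawCNF × RawCNF × RawCNF)) : List (RawCNF × RawCNF × RawCNF) :=
  I.rules.filter (applicable B L A (I.conclusions l))

/-- Everything that is derived if the assignments `A` are consistent with the extension. -/
def closure (I : RawInstance) (B : List Var) (L A : List (List Var)) : RawCNF :=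
  I.conclusions (I.rules.foldl (fun l _ => I.applyRules B L A l) [])

/-- The assignments from `L` that are consistent with `r`. -/
def consistentPart (B : List Var) (L : List (List Var)) (r : RawCNF) : List (List Var) :=
  L.filter fun v => r.eval (greatest B v)

/-- `A` is the list of assignments that are consistent with a stable extension. -/
def accepts (I : RawInstance) (B : List Var) (L A : List (List Var)) : Bool :=
  decide (A = consistentPart B L (I.closure B L A))

end RawInstance

/-- The iterates form an increasing chain of sublists of `s`. Until the chain becomes stationary
every step adds an entry, so it is stationary after `s.length` steps at the latest. Sublists instead
of sets give equality of lists from equality of lengths. -/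
theorem iterate_eq_of_sublist {α : Type} (f : List α → List α) (s : List α)
    (hs : ∀ l, (f l).Sublist s)
    (hf : ∀ l l', l'.Sublist s → l.Sublist l' → (f l).Sublist (f l')) :
    f (f^[s.length] []) = f^[s.length] [] := by
  have hmono : ∀ i, (f^[i] []).Sublist (f^[i + 1] []) := by
    intro i
    induction i with
    | zero => exact List.nil_sublist _
    | succ i ih =>
      have := hf _ _ (by rw [Function.iterate_succ_apply']; exact hs _) ih
      rwa [← Function.iterate_succ_apply' f, ← Function.iterate_succ_apply' f] at this
  have hstep : ∀ i, i ≤ (f^[i] []).length ∨ f (f^[i] []) = f^[i] [] := by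
    intro i
    induction i with
    | zero => exact .inl (Nat.zero_le _)
    | succ i ih =>
      rcases ih with h | h
      · rcases (hmono i).length_le.lt_or_eq with hlt | heq
        · exact .inl (by omega)
        · right
          have := (hmono i).eq_of_length heq
          rw [← this, ← Function.iterate_succ_apply' f, ← this]
      · right
        rw [Function.iterate_succ_apply', h, h]
  rcases hstep s.length with h | h
  · have h₁ := (hmono s.length).length_le
    have h₂ : (f^[s.length + 1] []).length ≤ s.length := by
      rw [Function.iterate_succ_apply']; exact (hs _).length_le
    have := (hmono s.length).eq_of_length (by omega)
    rw [← Function.iterate_succ_apply' f, ← this]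
  · exact h

/-! ### Accepted guesses correspond to stable extensions -/

namespace RawInstance

open RawCNF

variable {I : RawInstance} {B : List Var} {L A : List (List Var)}

theorem conclusions_isPositiveUnitOutside (hI : I.Forall (·.IsPositiveUnitOutside B))
    {l : List (RawCNF × RawCNF × RawCNF)} (hl : l ⊆ I.rules) :
    (I.conclusions l).IsPositiveUnitOutside B := by
  refine IsPositiveUnitOutside.append (fun C hC => ?_) fun C hC => ?_
  · obtain ⟨r, hr, hC⟩ := List.mem_flatten.1 hC
    exact hI.1 r hr C hC
  · obtain ⟨d, hd, hC⟩ := List.mem_flatMap.1 hC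
    exact (hI.2 d (hl hd)).2.2 C hC

theorem eval_conclusions (w : Var → Bool) (l : List (RawCNF × RawCNF × RawCNF)) :
    (I.conclusions l).eval w = true ↔
      (∀ r ∈ I.kb, r.eval w = true) ∧ ∀ d ∈ l, d.2.2.eval w = true := by
  simp only [eval_eq_true, conclusions, List.mem_append, or_imp, forall_and, List.mem_flatten,
    List.mem_flatMap]
  exact and_congr ⟨fun h r hr C hC => h C ⟨r, hr, hC⟩, fun h C ⟨r, hr, hC⟩ => h r hr C hC⟩
    ⟨fun h r hr C hC => h C ⟨r, hr, hC⟩, fun h C ⟨r, hr, hC⟩ => h r hr C hC⟩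

theorem mem_applyRules (hL : Covers B L) (hI : I.Forall (·.IsPositiveUnitOutside B))
    {l : List (RawCNF × RawCNF × RawCNF)} (hl : l ⊆ I.rules) {d : RawCNF × RawCNF × RawCNF} :
    d ∈ I.applyRules B L A l ↔ d ∈ I.rules ∧
      (∀ w, (I.conclusions l).eval w = true → d.1.eval w = true) ∧
      ∃ v ∈ A, d.2.1.eval (greatest B v) = true := by
  rw [applyRules, List.mem_filter, applicable, Bool.and_eq_true, List.any_eq_true]
  refine and_congr_right fun hd => and_congr_left fun _ => ?_
  exact entails_iff hL (conclusions_isPositiveUnitOutside hI hl) (hI.2 d hd).1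

/-- The rules that are applied in the computation of `closure`. -/
def appliedRules (I : RawInstance) (B : List Var) (L A : List (List Var)) :
    List (RawCNF × RawCNF × RawCNF) :=
  I.rules.foldl (fun l _ => I.applyRules B L A l) []

theorem appliedRules_eq :
    I.appliedRules B L A = (I.applyRules B L A)^[I.rules.length] [] := by
  have h : ∀ (m s : List (RawCNF × RawCNF × RawCNF)),
      m.foldl (fun l _ => I.applyRules B L A l) s = (I.applyRules B L A)^[m.length] s := by
    intro m
    induction m with
    | nil => intro s; rfl
    | cons d m ih => intro s; exact ih _
  exact h _ _

theorem applyRules_sublist (l : List (RawCNF × RawCNF × RawCNF)) :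
    (I.applyRules B L A l).Sublist I.rules := List.filter_sublist

theorem iterate_subset (n : ℕ) : (I.applyRules B L A)^[n] [] ⊆ I.rules := by
  cases n with
  | zero => simp
  | succ n => rw [Function.iterate_succ_apply']; exact (applyRules_sublist _).subset

theorem appliedRules_subset : I.appliedRules B L A ⊆ I.rules := by
  rw [appliedRules_eq]; exact iterate_subset _

/-- More applied rules entail more prerequisites, while the justification test depends on `A` alone;
hence rule application is monotone and the fold over `I.rules`, used merely as a counter, reaches a
fixed point. -/
theorem applyRules_appliedRules (hL : Covers B L) (hI : I.Forall (·.IsPositiveUnitOutside B)) :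
    I.applyRules B L A (I.appliedRules B L A) = I.appliedRules B L A := by
  rw [appliedRules_eq]
  refine iterate_eq_of_sublist _ _ applyRules_sublist fun l l' hl' hll' => ?_
  -- Writing the smaller list as a filter of the larger one gives the sublist relation with the
  -- order of the rules respected.
  have h : I.applyRules B L A l =
      (I.applyRules B L A l').filter (applicable B L A (I.conclusions l)) := by
    rw [applyRules, applyRules, List.filter_filter]
    refine List.filter_congr fun d hd => ?_
    cases hp : applicable B L A (I.conclusions l) d with
    | false => rfl
    | true =>
      have h₁ := (mem_applyRules hL hI (hll'.trans hl').subset).1 (List.mem_filter.2 ⟨hd, hp⟩)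
      have h₂ : d ∈ I.applyRules B L A l' := (mem_applyRules hL hI hl'.subset).2
        ⟨hd, fun w hw => h₁.2.1 w ?_, h₁.2.2⟩
      · rw [applyRules] at h₂
        rw [(List.mem_filter.1 h₂).2]; rfl
      · rw [eval_conclusions] at hw ⊢
        exact ⟨hw.1, fun d hd => hw.2 d (hll'.subset hd)⟩
  rw [h]
  exact List.filter_sublist

theorem closure_isPositiveUnitOutside (hI : I.Forall (·.IsPositiveUnitOutside B)) :
    (I.closure B L A).IsPositiveUnitOutside B :=
  conclusions_isPositiveUnitOutside hI appliedRules_subset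

/-- Every set that satisfies the closure conditions entails what is derived. -/
theorem closure_of_gammaClosed (hL : Covers B L) (hI : I.Forall (·.IsPositiveUnitOutside B))
    {E S : Set (CNF Var)} (hA : ∀ d ∈ I.rules,
      NegMem d.2.1.toCNF E ↔ ¬ ∃ v ∈ A, d.2.1.eval (greatest B v) = true)
    (hS : I.theory.GammaClosed E S) : (I.closure B L A).toCNF ∈ S := by
  suffices h : ∀ n, (I.conclusions ((I.applyRules B L A)^[n] [])).toCNF ∈ S by
    have := h I.rules.length
    rwa [← appliedRules_eq] at this
  have hkb : ∀ r ∈ I.kb, r.toCNF ∈ S := fun r hr => hS.base _ (by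
    simpa [theory] using ⟨r, hr, rfl⟩)
  intro n
  rw [hS.closed]
  intro w hw
  rw [sat_toCNF]
  -- All models of `S` are treated at once: entailment of a prerequisite by `S` needs the induction
  -- hypothesis for other models as well.
  induction n generalizing w with
  | zero =>
    rw [eval_conclusions]
    exact ⟨fun r hr => (sat_toCNF w r).1 (hw _ (hkb r hr)), by simp⟩
  | succ n ih =>
    rw [eval_conclusions]
    refine ⟨fun r hr => (sat_toCNF w r).1 (hw _ (hkb r hr)), fun d hd => ?_⟩
    rw [Function.iterate_succ_apply', mem_applyRules hL hI (iterate_subset n)] at hd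
    obtain ⟨hd, hpre, hj⟩ := hd
    rw [← sat_toCNF]
    refine hw _ (hS.rules ⟨d.1.toCNF, d.2.1.toCNF, d.2.2.toCNF⟩ ?_ ?_ ?_)
    · simpa only [theory, List.mem_toFinset, List.mem_map] using ⟨d, hd, rfl⟩
    · rw [hS.closed]
      exact fun w' hw' => (sat_toCNF w' d.1).2 (hpre w' (ih w' hw'))
    · exact fun h => (hA d hd).1 h hj

/-- The set `E` enters `Γ(E)` only through its justification tests. If these agree with the tests by
`A`, the fixed point of rule application is closed under all conditions and contained in every set
that is. -/
theorem gamma_eq (hL : Covers B L) (hI : I.Forall (·.IsPositiveUnitOutside B))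
    {E : Set (CNF Var)} (hA : ∀ d ∈ I.rules,
      NegMem d.2.1.toCNF E ↔ ¬ ∃ v ∈ A, d.2.1.eval (greatest B v) = true) :
    I.theory.Gamma E = Th {(I.closure B L A).toCNF} := by
  have hG := I.theory.gamma_isLeast E
  apply Set.Subset.antisymm
  · refine hG.2 ⟨fun φ hφ => ?_, (Th_Th _).symm, fun δ hδ hp hj => ?_⟩
    · obtain ⟨r, hr, rfl⟩ : ∃ r ∈ I.kb, RawCNF.toCNF r = φ := by simpa [theory] using hφ
      rw [mem_Th_singleton]
      intro w hw
      rw [sat_toCNF] at hw ⊢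
      exact ((eval_conclusions w _).1 hw).1 r hr
    · obtain ⟨d, hd, rfl⟩ : ∃ d ∈ I.rules,
          (⟨d.1.toCNF, d.2.1.toCNF, d.2.2.toCNF⟩ : Default Var) = δ := by
        simpa only [theory, List.mem_toFinset, List.mem_map] using hδ
      rw [mem_Th_singleton] at hp ⊢
      simp only [sat_toCNF] at hp ⊢
      have hmem : d ∈ I.appliedRules B L A := by
        rw [← applyRules_appliedRules hL hI, mem_applyRules hL hI appliedRules_subset]
        exact ⟨hd, hp, by by_contra h; exact hj ((hA d hd).2 h)⟩
      exact fun w hw => ((eval_conclusions w _).1 hw).2 d hmem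
  · rw [hG.1.closed]
    exact Th_mono (Set.singleton_subset_iff.2 (closure_of_gammaClosed hL hI hA hG.1))

/-- Justifications are checked correctly, if consistency with the set `E` of formulas only depends
on the values of the variables in `B`. -/
theorem negMem_iff_of_consistentPart {E : Set (CNF Var)} (hE : E = Th E) (hL : Covers B L)
    (hEB : ∀ v ∈ L, ∀ w, Agrees B v w → (∀ φ ∈ E, CNF.Sat w φ) →
      ∀ φ ∈ E, CNF.Sat (greatest B v) φ)
    (hA : ∀ v, v ∈ A ↔ v ∈ L ∧ ∀ φ ∈ E, CNF.Sat (greatest B v) φ) {β : RawCNF}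
    (hβ : β.IsPositiveUnitOutside B) :
    NegMem β.toCNF E ↔ ¬ ∃ v ∈ A, β.eval (greatest B v) = true := by
  rw [negMem_iff hE]
  simp only [sat_toCNF, not_exists, not_and]
  constructor
  · intro h v hv
    exact h _ ((hA v).1 hv).2
  · intro h w hw hβw
    -- A common model of `E` and `β` may be raised to the greatest assignment over its values on
    -- `B`; both remain satisfied, so that `v` is a witness in `A`.
    obtain ⟨v, hv, hvw⟩ := hL.exists_agrees w
    exact h v ((hA v).2 ⟨hv, hEB v hv w hvw hw⟩) (eval_greatest hβ hvw hβw)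

theorem sat_greatest {φ : CNF Var} {v : List Var} {w : Var → Bool}
    (hφ : φ.IsPositiveUnitOutside B.toFinset) (hw : Agrees B v w) (h : CNF.Sat w φ) :
    CNF.Sat (greatest B v) φ := by
  obtain ⟨r, rfl⟩ : ∃ r : RawCNF, r.toCNF = φ :=
    ⟨φ.toList.map Finset.toList, by
      ext C; simp [toCNF]⟩
  rw [sat_toCNF] at h ⊢
  exact eval_greatest ((isPositiveUnitOutside_toCNF B r).1 hφ) hw h

/-- If an assignment list is accepted, then it comes from a stable extension. -/
theorem isStableExtension_of_accepts (hL : Covers B L)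
    (hI : I.Forall (·.IsPositiveUnitOutside B)) (h : I.accepts B L A = true) :
    I.theory.IsStableExtension (Th {(I.closure B L A).toCNF}) := by
  have hA : A = consistentPart B L (I.closure B L A) := of_decide_eq_true h
  have hcl := closure_isPositiveUnitOutside (L := L) (A := A) hI
  refine (gamma_eq hL hI fun d hd => ?_).symm
  refine negMem_iff_of_consistentPart (Th_Th _).symm hL (fun v _ w hvw hw φ hφ => ?_)
    (fun v => ?_) (hI.2 d hd).2.1
  · have h₁ := (sat_toCNF _ _).1 (hw _ (subset_Th _ rfl))
    exact mem_Th_singleton.1 hφ _ ((sat_toCNF _ _).2 (eval_greatest hcl hvw h₁))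
  · conv_lhs => rw [hA]
    rw [consistentPart, List.mem_filter, ← sat_toCNF]
    exact and_congr_right fun _ => ⟨fun h φ hφ => mem_Th_singleton.1 hφ _ h,
      fun h => h _ (subset_Th _ rfl)⟩

/-- A stable extension comes from an accepted assignment list. -/
theorem exists_accepts_of_isStableExtension (hL : Covers B L)
    (hI : I.Forall (·.IsPositiveUnitOutside B)) {E : Set (CNF Var)}
    (hE : I.theory.IsStableExtension E) :
    ∃ A, A.Sublist L ∧ I.accepts B L A = true ∧ E = Th {(I.closure B L A).toCNF} := by
  classical
  set T := I.theory with hT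
  have hTB : T.Forall fun φ => φ.IsPositiveUnitOutside B.toFinset := by
    rw [theory_forall]
    simpa only [isPositiveUnitOutside_toCNF] using hI
  have hG := T.gamma_isLeast E
  have hcl : E = Th E := by
    have := hG.1.closed
    rwa [← hE] at this
  -- The generating formulas of `E`: the knowledge base and the conclusions of the rules that fire
  -- in `E`. Then `E = Th S`.
  set S : Set (CNF Var) := {φ | φ ∈ T.W ∨ ∃ δ ∈ T.D, δ.prereq ∈ E ∧ ¬ NegMem δ.just E ∧
    φ = δ.concl} with hS
  have hSB : ∀ φ ∈ S, φ.IsPositiveUnitOutside B.toFinset := by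
    rintro φ (hφ | ⟨δ, hδ, -, -, rfl⟩)
    · exact hTB.1 φ hφ
    · exact (hTB.2 δ hδ).2.2
  have hSE : S ⊆ E := by
    intro φ hφ
    rw [hE]
    rcases hφ with hφ | ⟨δ, hδ, hp, hj, rfl⟩
    · exact hG.1.base φ hφ
    · refine hG.1.rules δ hδ ?_ hj
      rwa [← hE]
  have hES : E = Th S := by
    apply Set.Subset.antisymm
    · conv_lhs => rw [hE]
      refine hG.2 ⟨fun φ hφ => subset_Th _ (.inl hφ), (Th_Th _).symm, fun δ hδ hp hj => ?_⟩
      refine subset_Th _ (.inr ⟨δ, hδ, ?_, hj, rfl⟩)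
      rw [hcl]
      exact Th_mono hSE hp
    · rw [hcl]
      exact Th_mono hSE
  -- The members of `E` are arbitrary CNF formulas and need not be positive outside `B`; the
  -- generating formulas are, and they pass the property on to all their consequences.
  have hEB : ∀ v ∈ L, ∀ w, Agrees B v w → (∀ φ ∈ E, CNF.Sat w φ) →
      ∀ φ ∈ E, CNF.Sat (greatest B v) φ := by
    intro v _ w hvw hw φ hφ
    rw [hES] at hφ
    exact hφ _ fun ψ hψ => sat_greatest (hSB ψ hψ) hvw (hw ψ (hSE hψ))
  set A := L.filter fun v => decide (∀ φ ∈ E, CNF.Sat (greatest B v) φ) with hA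
  have hEA : E = Th {(I.closure B L A).toCNF} := by
    conv_lhs => rw [hE]
    refine gamma_eq hL hI fun d hd => ?_
    exact negMem_iff_of_consistentPart hcl hL hEB (fun v => by simp [hA]) (hI.2 d hd).2.1
  refine ⟨A, List.filter_sublist, decide_eq_true ?_, hEA⟩
  rw [consistentPart]
  conv_lhs => rw [hA]
  refine List.filter_congr fun v _ => ?_
  rw [Bool.eq_iff_iff, decide_eq_true_iff, ← sat_toCNF]
  constructor
  · intro h
    exact h _ (by rw [hEA]; exact subset_Th _ rfl)
  · intro h φ hφ
    rw [hEA] at hφ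
    exact mem_Th_singleton.1 hφ _ h

theorem hasStableExtension_iff (hL : Covers B L) (hI : I.Forall (·.IsPositiveUnitOutside B))
    {P : List (List (List Var))} (hP : ∀ A, A.Sublist L → A ∈ P) :
    I.theory.HasStableExtension ↔ P.any (fun A => I.accepts B L A) = true := by
  rw [List.any_eq_true]
  constructor
  · rintro ⟨E, hE⟩
    obtain ⟨A, hA, h, -⟩ := exists_accepts_of_isStableExtension hL hI hE
    exact ⟨A, hP A hA, h⟩
  · rintro ⟨A, -, h⟩
    exact ⟨_, isStableExtension_of_accepts hL hI h⟩

theorem hasConsistentStableExtension_iff (hL : Covers B L)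
    (hI : I.Forall (·.IsPositiveUnitOutside B))
    {P : List (List (List Var))} (hP : ∀ A, A.Sublist L → A ∈ P) :
    I.theory.HasConsistentStableExtension ↔
      P.any (fun A => I.accepts B L A && !A.isEmpty) = true := by
  -- An accepted `A` lists the assignments over which the closure has a model, so it is empty
  -- exactly if the closure has no model at all.
  have key : ∀ A, I.accepts B L A = true →
      (CNF.bot ∉ Th {(I.closure B L A).toCNF} ↔ A.isEmpty = false) := by
    intro A h
    have hA : A = consistentPart B L (I.closure B L A) := of_decide_eq_true h
    have hbot : ∀ w : Var → Bool, ¬ CNF.Sat w CNF.bot := fun w => by simp [CNF.Sat, CNF.bot]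
    rw [mem_Th_singleton, ← Bool.not_eq_true, List.isEmpty_iff, not_iff_not]
    constructor
    · intro h'
      rw [hA, consistentPart, List.filter_eq_nil_iff]
      exact fun v _ hv => hbot _ (h' _ ((sat_toCNF _ _).2 hv))
    · intro h' w hw
      obtain ⟨v, hv, hvw⟩ := hL.exists_agrees w
      have : v ∈ A := by
        rw [hA]
        exact List.mem_filter.2 ⟨hv, eval_greatest (closure_isPositiveUnitOutside hI) hvw
          ((sat_toCNF _ _).1 hw)⟩
      rw [h'] at this
      simp at this
  simp only [List.any_eq_true, Bool.and_eq_true, Bool.not_eq_true']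
  constructor
  · rintro ⟨E, hE, hbot⟩
    obtain ⟨A, hA, h, rfl⟩ := exists_accepts_of_isStableExtension hL hI hE
    exact ⟨A, hP A hA, h, (key A h).1 hbot⟩
  · rintro ⟨A, -, h, hne⟩
    exact ⟨_, isStableExtension_of_accepts hL hI h, (key A h).2 hne⟩

end RawInstance

end DefaultLogic

/-! ### Reading instances -/

namespace DefaultLogic

/-- The sign of a literal. -/
def Literal.isPos {V : Type} : Literal V → Bool
  | pos _ => true
  | neg _ => false

/-- The literal with a given sign and variable. -/
def Literal.mk {V : Type} (s : Bool) (x : V) : Literal V := bif s then pos x else neg x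

/-- The state of the parser: the bits of the current variable, the sign of the current literal,
the current clause, formula, and part of the input, and the previous parts, all of them
in reversed order. -/
abbrev ParseState :=
  Var × Bool × List (Literal Var) × RawCNF × List RawCNF × List (List RawCNF × List (Literal Var))

/-- Read a symbol. -/
def parseStep : ParseState → Symb → ParseState
  | (v, s, c, f, p, q), .bit b => (b :: v, s, c, f, p, q)
  | (v, _, c, f, p, q), .pos => (v, true, c, f, p, q)
  | (v, _, c, f, p, q), .neg => (v, false, c, f, p, q)
  | (v, s, c, f, p, q), .endVar => ([], true, Literal.mk s v.reverse :: c, f, p, q)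
  | (v, s, c, f, p, q), .endClause => (v, s, [], c.reverse :: f, p, q)
  | (v, s, c, f, p, q), .endFormula => (v, s, c, [], f.reverse :: p, q)
  | (v, s, c, f, p, q), .endPart => (v, s, [], f, [], (p.reverse, c.reverse) :: q)

/-- The parts of the input, in reversed order. -/
def parseParts (x : List Symb) : List (List RawCNF × List (Literal Var)) :=
  (x.foldl parseStep ([], true, [], [], [], [])).2.2.2.2.2

/-- One step in splitting a list into triples. -/
def tripleStep {α : Type} (s : List α × List (α × α × α)) (a : α) : List α × List (α × α × α) :=
  if s.1.tail.isEmpty = true then (a :: s.1, s.2)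
  else ([], (s.1.tail.headD a, s.1.headD a, a) :: s.2)

/-- Split a list into triples. -/
def triples {α : Type} (l : List α) : List (α × α × α) := (l.foldl tripleStep ([], [])).2.reverse

/-- The instance that is encoded by a word. -/
def parse (x : List Symb) : RawInstance where
  kb := ((parseParts x).tail.tail.headD ([], [])).1
  rules := triples ((parseParts x).tail.headD ([], [])).1
  backdoor := ((parseParts x).headD ([], [])).2.map Literal.var

/-- Here `st` places a list of finished entries into a parser state. If reading one entry adds it to
this list, reading all of them adds them in reversed order; each nesting level of the encoding is an
instance. -/
theorem foldl_flatMap_eq {α β σ : Type} {step : σ → β → σ} {c : α → List β} {st : List α → σ}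
    (h : ∀ a acc, (c a).foldl step (st acc) = st (a :: acc)) (l : List α) :
    ∀ acc, (l.flatMap c).foldl step (st acc) = st (l.reverse ++ acc) := by
  induction l with
  | nil => intro acc; rfl
  | cons a l ih =>
    intro acc
    rw [List.flatMap_cons, List.foldl_append, h, ih]
    simp

theorem foldl_encodeVar (x : Var) (s : Bool) (c : List (Literal Var)) (f : RawCNF)
    (p : List RawCNF) (q : List (List RawCNF × List (Literal Var))) :
    (encodeVar x).foldl parseStep ([], s, c, f, p, q) =
      ([], true, Literal.mk s x :: c, f, p, q) := by
  have h := foldl_flatMap_eq (step := parseStep) (c := fun b => [Symb.bit b])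
    (st := fun v => (v, s, c, f, p, q)) (fun _ _ => rfl) x []
  rw [encodeVar, encodeListWith, List.foldl_append, h]
  simp [parseStep]

theorem foldl_encodeLiteral (l : Literal Var) (c : List (Literal Var)) (f : RawCNF)
    (p : List RawCNF) (q : List (List RawCNF × List (Literal Var))) :
    (encodeLiteral l).foldl parseStep ([], true, c, f, p, q) = ([], true, l :: c, f, p, q) := by
  cases l with
  | pos x => exact foldl_encodeVar x true c f p q
  | neg x => exact foldl_encodeVar x false c f p q

theorem foldl_encodeClause (C : List (Literal Var)) (f : RawCNF)
    (p : List RawCNF) (q : List (List RawCNF × List (Literal Var))) :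
    (encodeListWith .endClause encodeLiteral C).foldl parseStep ([], true, [], f, p, q) =
      ([], true, [], C :: f, p, q) := by
  have h := foldl_flatMap_eq (step := parseStep) (c := encodeLiteral)
    (st := fun c => ([], true, c, f, p, q)) (fun l c => foldl_encodeLiteral l c f p q) C []
  rw [encodeListWith, List.foldl_append, h]
  simp [parseStep]

theorem foldl_encodeCNF (r : RawCNF) (p : List RawCNF)
    (q : List (List RawCNF × List (Literal Var))) :
    (encodeCNF r).foldl parseStep ([], true, [], [], p, q) = ([], true, [], [], r :: p, q) := by
  have h := foldl_flatMap_eq (step := parseStep) (c := encodeListWith .endClause encodeLiteral)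
    (st := fun f => ([], true, [], f, p, q)) (fun C f => foldl_encodeClause C f p q) r []
  rw [encodeCNF, encodeListWith, List.foldl_append, h]
  simp [parseStep]

theorem triples_flatMap {α : Type} (l : List (α × α × α)) :
    triples (l.flatMap fun d => [d.1, d.2.1, d.2.2]) = l := by
  have h := foldl_flatMap_eq (step := tripleStep) (c := fun d : α × α × α => [d.1, d.2.1, d.2.2])
    (st := fun acc => ([], acc)) (fun d acc => by simp [tripleStep]) l []
  rw [triples, h]
  simp

/-- The word of an instance is parsed correctly. -/
theorem parse_encode (I : RawInstance) : parse I.encode = I := by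
  obtain ⟨kb, rules, backdoor⟩ := I
  have h₁ : (encodeListWith .endPart encodeCNF kb).foldl parseStep ([], true, [], [], [], []) =
      ([], true, [], [], [], [(kb, [])]) := by
    have h := foldl_flatMap_eq (step := parseStep) (c := encodeCNF)
      (st := fun p => ([], true, [], [], p, [])) (fun r p => foldl_encodeCNF r p []) kb []
    rw [encodeListWith, List.foldl_append, h]
    simp [parseStep]
  have h₂ : (encodeListWith .endPart encodeDefault rules).foldl parseStep
      ([], true, [], [], [], [(kb, [])]) =
      ([], true, [], [], [], [(rules.flatMap fun d => [d.1, d.2.1, d.2.2], []), (kb, [])]) := by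
    have h := foldl_flatMap_eq (step := parseStep) (c := encodeCNF)
      (st := fun p => ([], true, [], [], p, [(kb, [])]))
      (fun r p => foldl_encodeCNF r p _) (rules.flatMap fun d => [d.1, d.2.1, d.2.2]) []
    have hd : rules.flatMap encodeDefault =
        (rules.flatMap fun d => [d.1, d.2.1, d.2.2]).flatMap encodeCNF := by
      rw [List.flatMap_assoc]
      congr 1; funext d; simp [encodeDefault, List.append_assoc]
    rw [encodeListWith, hd, List.foldl_append, h]
    simp [parseStep]
  -- Backdoor variables are written without a sign. The sign in the parser state is `true` at this
  -- point and is restored by each `endVar`, so they arrive as positive literals in the clause slot.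
  have h₃ : ∀ q, (encodeListWith .endPart encodeVar backdoor).foldl parseStep
      ([], true, [], [], [], q) = ([], true, [], [], [], ([], backdoor.map .pos) :: q) := by
    intro q
    have h := foldl_flatMap_eq (step := parseStep) (c := encodeVar)
      (st := fun l => ([], true, l.map .pos, [], [], q))
      (fun x l => foldl_encodeVar x true _ _ _ _) backdoor []
    rw [encodeListWith, List.foldl_append]
    rw [List.map_nil] at h
    rw [h]
    simp [parseStep]
  have h : parseParts (RawInstance.encode ⟨kb, rules, backdoor⟩) =
      [([], backdoor.map .pos), (rules.flatMap fun d => [d.1, d.2.1, d.2.2], []), (kb, [])] := by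
    rw [parseParts, RawInstance.encode, List.foldl_append, List.foldl_append, h₁, h₂, h₃]
  simp [parse, h, triples_flatMap, Literal.var, Function.comp_def]

/-! ### Deciding the problem -/

/-- The sublists of `l`, but at most as many as `n` has entries. -/
def sublistsUpTo {α ν : Type} (n : List ν) (l : List α) : List (List α) :=
  l.reverse.foldl (fun s a => (s ++ s.map (a :: ·)).take n.length) [[]]

/-- Truncation keeps the enumeration polynomial on every input, even with insufficient padding. The
intermediate lists have at most `2 ^ l.length` entries, so sufficient padding makes the truncation
void. -/
theorem sublistsUpTo_eq {α ν : Type} {n : List ν} {l : List α} (h : 2 ^ l.length ≤ n.length) :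
    sublistsUpTo n l = l.sublists' := by
  rw [sublistsUpTo, List.foldl_reverse]
  induction l with
  | nil => rfl
  | cons a l ih =>
    rw [List.length_cons, pow_succ] at h
    rw [List.foldr_cons, ih (by omega), List.sublists'_cons, List.take_of_length_le]
    simp; omega

/-- The entries of a list, without repetitions. -/
def distinct (l : List Var) : List Var :=
  l.foldl (fun s a => if decide (a ∈ s) = true then s else a :: s) []

theorem distinct_spec (l : List Var) :
    (distinct l).Nodup ∧ ∀ x, x ∈ distinct l ↔ x ∈ l := by
  suffices h : ∀ (l s : List Var), s.Nodup →
      (l.foldl (fun s a => if decide (a ∈ s) = true then s else a :: s) s).Nodup ∧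
      ∀ x, x ∈ l.foldl (fun s a => if decide (a ∈ s) = true then s else a :: s) s ↔
        x ∈ s ∨ x ∈ l by
    have := h l [] List.nodup_nil
    simpa [distinct] using this
  intro l
  induction l with
  | nil => intro s hs; simpa using hs
  | cons a l ih =>
    intro s hs
    rw [List.foldl_cons]
    by_cases ha : a ∈ s
    · rw [if_pos (by simpa using ha)]
      refine ⟨(ih s hs).1, fun x => ?_⟩
      rw [(ih s hs).2, List.mem_cons]
      constructor
      · tauto
      · rintro (h | rfl | h) <;> tauto
    · rw [if_neg (by simpa using ha)]
      have hs' : (a :: s).Nodup := List.nodup_cons.2 ⟨ha, hs⟩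
      refine ⟨(ih _ hs').1, fun x => ?_⟩
      rw [(ih _ hs').2, List.mem_cons, List.mem_cons]
      tauto

/-! ### Checking that an instance comes with a strong backdoor -/

namespace RawInstance

open RawCNF

/-- All clauses of an instance. -/
def clauses (I : RawInstance) : List (List (Literal Var)) :=
  (I.kb ++ I.rules.flatMap fun d => [d.1, d.2.1, d.2.2]).flatten

/-- The variables `B` occur in the instance. -/
def containsVars (I : RawInstance) (B : List Var) : Bool :=
  B.all fun x => I.clauses.any fun C => C.any fun l => decide (l.var = x)

/-- Outside `B`, every clause has at most one literal, and this literal is positive. -/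
def isPositiveOutside (I : RawInstance) (B : List Var) : Bool :=
  I.clauses.all fun C => C.all fun l => decide (l.var ∈ B) ||
    (l.isPos && C.all fun l' => decide (l'.var ∈ B) || decide (l' = l))

theorem isPositiveOutside_iff (I : RawInstance) (B : List Var) :
    I.isPositiveOutside B = true ↔ I.Forall (·.IsPositiveUnitOutside B) := by
  have hpos : ∀ l : Literal Var, l.isPos = true ↔ ∃ x, l = .pos x := fun l => by
    cases l <;> simp [Literal.isPos]
  have hor : ∀ (l : Literal Var) (p : Prop), (l.var ∈ B ∨ p) ↔ (l.var ∉ B → p) := fun l p => by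
    tauto
  simp only [isPositiveOutside, clauses, List.all_eq_true, List.mem_flatten, List.mem_append,
    List.mem_flatMap, List.mem_cons, List.not_mem_nil, or_false, Bool.or_eq_true,
    decide_eq_true_eq, Bool.and_eq_true, hpos, hor]
  unfold Forall IsPositiveUnitOutside
  constructor
  · intro h
    exact ⟨fun r hr C hC => h C ⟨r, .inl hr, hC⟩, fun d hd =>
      ⟨fun C hC => h C ⟨_, .inr ⟨d, hd, .inl rfl⟩, hC⟩,
        fun C hC => h C ⟨_, .inr ⟨d, hd, .inr (.inl rfl)⟩, hC⟩,
        fun C hC => h C ⟨_, .inr ⟨d, hd, .inr (.inr rfl)⟩, hC⟩⟩⟩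
  · rintro ⟨h₁, h₂⟩ C ⟨r, hr | ⟨d, hd, rfl | rfl | rfl⟩, hC⟩
    · exact h₁ r hr C hC
    · exact (h₂ d hd).1 C hC
    · exact (h₂ d hd).2.1 C hC
    · exact (h₂ d hd).2.2 C hC

theorem mem_vars_toCNF (r : RawCNF) (x : Var) :
    x ∈ r.toCNF.vars ↔ ∃ C ∈ r, ∃ l ∈ C, l.var = x := by
  simp [CNF.vars, toCNF]

theorem containsVars_iff (I : RawInstance) (B : List Var) :
    I.containsVars B = true ↔ B.toFinset ⊆ I.theory.vars := by
  have key : ∀ x, x ∈ I.theory.vars ↔ ∃ C ∈ I.clauses, ∃ l ∈ C, l.var = x := by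
    intro x
    simp only [DefaultTheory.vars, Default.vars, theory, Finset.mem_union, Finset.mem_biUnion,
      List.mem_toFinset, List.mem_map, exists_exists_and_eq_and, mem_vars_toCNF, clauses,
      List.mem_flatten, List.mem_append, List.mem_flatMap, List.mem_cons, List.not_mem_nil,
      or_false]
    constructor
    · rintro (⟨r, hr, C, hC, h⟩ | ⟨d, hd, (⟨C, hC, h⟩ | ⟨C, hC, h⟩) | ⟨C, hC, h⟩⟩)
      · exact ⟨C, ⟨r, .inl hr, hC⟩, h⟩
      · exact ⟨C, ⟨_, .inr ⟨d, hd, .inl rfl⟩, hC⟩, h⟩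
      · exact ⟨C, ⟨_, .inr ⟨d, hd, .inr (.inl rfl)⟩, hC⟩, h⟩
      · exact ⟨C, ⟨_, .inr ⟨d, hd, .inr (.inr rfl)⟩, hC⟩, h⟩
    · rintro ⟨C, ⟨r, hr | ⟨d, hd, rfl | rfl | rfl⟩, hC⟩, h⟩
      · exact .inl ⟨r, hr, C, hC, h⟩
      · exact .inr ⟨d, hd, .inl (.inl ⟨C, hC, h⟩)⟩
      · exact .inr ⟨d, hd, .inl (.inr ⟨C, hC, h⟩)⟩
      · exact .inr ⟨d, hd, .inr ⟨C, hC, h⟩⟩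
  simp only [containsVars, List.all_eq_true, List.any_eq_true, decide_eq_true_eq,
    Finset.subset_iff, List.mem_toFinset, key]

/-- Some list of consistent assignments, satisfying the test, is accepted. The list `n` bounds the
number of the lists that are tried. -/
def search (test : List (List Var) → Bool) (n : List Bool) (I : RawInstance) (B : List Var) :
    Bool :=
  (sublistsUpTo n (sublistsUpTo n B)).any fun A =>
    I.accepts B (sublistsUpTo n B) A && test A

end RawInstance

/-- The decision procedure: the word `y` consists of entries `false`, whose number has to be the
parameter, and of entries `true`, which give time for the search. -/
def decision (test : List (List Var) → Bool) (x : List Symb) (y : List Bool) : Bool :=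
  decide ((parse x).encode = x) && ((parse x).containsVars (distinct (parse x).backdoor) &&
    ((parse x).isPositiveOutside (distinct (parse x).backdoor) &&
      (decide ((y.filter fun b => !b).map (fun _ => ()) =
          (distinct (parse x).backdoor).map fun _ => ()) &&
        (parse x).search test y (distinct (parse x).backdoor))))

/-- The second component of the instances for the parameter `k`. -/
def paddedParameter (k : ℕ) : List Bool :=
  List.replicate k false ++ List.replicate (2 ^ 2 ^ k) true

open RawCNF in
theorem covers_sublists' (B : List Var) : Covers B B.sublists' where
  subset v hv := (List.mem_sublists'.1 hv).subset
  exists_agrees w := ⟨B.filter w, List.mem_sublists'.2 List.filter_sublist, fun x hx => by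
    rw [Bool.eq_iff_iff]; simp [hx]⟩

open RawCNF in
-- The property `Q` enters only through its characterisation by accepted guesses that pass `test`,
-- so both variants of the problem are treated at once. Membership in the class of all CNF formulas
-- is no condition.
theorem mem_backdoorEvaluation_iff {Q : DefaultTheory Var → Prop}
    {test : List (List Var) → Bool}
    (h : ∀ (I : RawInstance) (B : List Var) (L : List (List Var)), Covers B L →
      I.Forall (·.IsPositiveUnitOutside B) → ∀ P : List (List (List Var)),
        (∀ A, A.Sublist L → A ∈ P) →
          (Q I.theory ↔ (P.any fun A => I.accepts B L A && test A) = true))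
    (x : List Symb) (k : ℕ) :
    (x, k) ∈ backdoorEvaluation Q classCNF classID ↔ decision test x (paddedParameter k) = true := by
  have hfilter : ((paddedParameter k).filter fun b => !b) = List.replicate k false := by
    simp [paddedParameter]
  have hlen : 2 ^ 2 ^ k ≤ (paddedParameter k).length := by simp [paddedParameter]
  have key : ∀ I : RawInstance, I.encode = x →
      ((I.theory.IsStrongBackdoor classID I.backdoorSet ∧ I.backdoorSet.card = k ∧ Q I.theory) ↔
        decision test x (paddedParameter k) = true) := by
    rintro I rfl
    obtain ⟨hnd, hmem⟩ := distinct_spec I.backdoor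
    set B := distinct I.backdoor with hB
    have hset : I.backdoorSet = B.toFinset := by
      ext x; simp [RawInstance.backdoorSet, hmem]
    -- Two numbers are compared in unary, as lists over `Unit`; the backdoor is counted without
    -- repetitions.
    have hcard : ((List.replicate k false).map (fun _ => ()) = B.map fun _ => ()) ↔
        I.backdoorSet.card = k := by
      rw [hset, List.toFinset_card_of_nodup hnd, List.map_replicate, List.map_const',
        List.replicate_inj]
      constructor
      · exact fun h => h.1.symm
      · exact fun h => ⟨h.symm, .inr rfl⟩
    simp only [decision, parse_encode, decide_true, Bool.true_and, Bool.and_eq_true, ← hB,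
      decide_eq_true_eq, hfilter, hcard, RawInstance.containsVars_iff,
      RawInstance.isPositiveOutside_iff, isStrongBackdoor_classID_iff, hset,
      RawInstance.theory_forall, isPositiveUnitOutside_toCNF, and_assoc]
    refine and_congr_right fun _ => and_congr_right fun hI => and_congr_right fun hk => ?_
    have hBk : B.length = k := by rw [← hk, List.toFinset_card_of_nodup hnd]
    have hL : sublistsUpTo (paddedParameter k) B = B.sublists' :=
      sublistsUpTo_eq (by
        rw [hBk]; exact (Nat.lt_two_pow_self).le.trans hlen)
    -- There are `2 ^ k` assignments of the backdoor variables, hence `2 ^ 2 ^ k` lists of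
    -- assignments, which is the amount of padding.
    have hP : sublistsUpTo (paddedParameter k) B.sublists' = B.sublists'.sublists' :=
      sublistsUpTo_eq (by rw [List.length_sublists', hBk]; exact hlen)
    rw [RawInstance.search, hL, hP]
    exact h I B _ (covers_sublists' B) hI _ fun A hA => List.mem_sublists'.2 hA
  constructor
  · rintro ⟨I, hx, -, h⟩
    exact (key I hx).1 h
  · intro hd
    -- The parser returns something on every word; encoding the result again rejects the words that
    -- encode no instance.
    have hx : (parse x).encode = x := by
      simp only [decision, Bool.and_eq_true, decide_eq_true_eq] at hd
      exact hd.1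
    refine ⟨parse x, hx, ?_, (key _ hx).2 hd⟩
    simp [DefaultTheory.InClass, classCNF]

theorem mem_SBDexpl_iff (x : List Symb) (k : ℕ) : (x, k) ∈ SBDexpl classCNF classID ↔
    decision (fun _ => true) x (paddedParameter k) = true :=
  mem_backdoorEvaluation_iff (fun _ _ _ hL hI _ hP => by
    simpa using RawInstance.hasStableExtension_iff hL hI hP) x k

theorem mem_consistentSBDexpl_iff (x : List Symb) (k : ℕ) :
    (x, k) ∈ consistentSBDexpl classCNF classID ↔
      decision (fun A => !A.isEmpty) x (paddedParameter k) = true :=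
  mem_backdoorEvaluation_iff (fun _ _ _ hL hI _ hP =>
    RawInstance.hasConsistentStableExtension_iff hL hI hP) x k

end DefaultLogic

/-! ### The decision procedure takes polynomial time -/

namespace StackProgram

open Polynomial Coded

/-- A code for the elements of a finite type. -/
noncomputable def unaryCode {α : Type} [Fintype α] (a : α) : List Bool :=
  List.replicate (Fintype.equivFin α a) true

theorem unaryCode_injective {α : Type} [Fintype α] : Function.Injective (unaryCode (α := α)) :=
  fun _ _ h => (Fintype.equivFin α).injective (Fin.ext (List.replicate_inj.1 h).1)

namespace PolyTime

variable {A : Type} {α β γ δ ν : Type} [Coded α] [Coded β] [Coded γ] [Coded δ] [Coded ν]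

theorem weaken {f : γ → β} (hf : PolyTime A f) : PolyTime A fun x : γ × α => f x.1 :=
  hf.comp id.fst

theorem weaken₂ {f : γ → ν → β} (hf : PolyTime A fun x : γ × ν => f x.1 x.2) :
    PolyTime A fun x : (γ × α) × ν => f x.1.1 x.2 :=
  hf.comp (id.fst.fst.pair id.snd)

theorem fintype_eq [Fintype α] [DecidableEq α] (h : ∀ a : α, toData a = toData (unaryCode a)) :
    PolyTime A fun x : α × α => decide (x.1 = x.2) := by
  have hc : PolyTime A (unaryCode (α := α)) := of_toData fun a => (h a).symm
  have := list_eq (bool_eq id.fst id.snd) (hc.comp (id.fst (β := α) (γ := α)))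
    (hc.comp (id.snd (β := α) (γ := α)))
  simpa only [unaryCode_injective.eq_iff] using this

/-- Case distinction on a finite type. -/
theorem fintype_cases [Fintype α] [DecidableEq α] [Inhabited α]
    (h : ∀ a : α, toData a = toData (unaryCode a)) {f : γ → α → β} {g : γ → α}
    (hg : PolyTime A g) (hf : ∀ a, PolyTime A fun c => f c a) : PolyTime A fun c => f c (g c) := by
  have key : ∀ l : List α, PolyTime A fun c => l.foldr
      (fun a d => if decide (g c = a) = true then f c a else d) (f c default) := by
    intro l
    induction l with
    | nil => exact hf default
    | cons a l ih =>
      exact ite ((fintype_eq h).comp₂ (g := fun x y => decide (x = y)) hg (const a)) (hf a) ih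
  have heq : ∀ (c : γ) (l : List α), g c ∈ l → l.foldr
      (fun a d => if decide (g c = a) = true then f c a else d) (f c default) = f c (g c) := by
    intro c l
    induction l with
    | nil => simp
    | cons a l ih =>
      intro hl
      by_cases ha : g c = a
      · simp [ha]
      · simpa [ha] using ih (by simpa [ha] using hl)
  have := key Finset.univ.toList
  simpa only [heq _ _ (Finset.mem_toList.2 (Finset.mem_univ _))] using this

theorem size_le_of_sublist {l m : List α} (h : l.Sublist m) : size l ≤ size m := by
  induction h with
  | slnil => exact le_rfl
  | cons a _ ih => simp; omega
  | cons_cons a _ ih => simp; omega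

theorem size_le_of_forall {K : ℕ} {l : List α} (h : ∀ a ∈ l, size a ≤ K) :
    size l ≤ l.length * (K + 1) + 1 := by
  induction l with
  | nil => simp
  | cons a l ih =>
    have h₁ := h a List.mem_cons_self
    have h₂ := ih fun b hb => h b (List.mem_cons_of_mem _ hb)
    simp only [size_cons, List.length_cons, Nat.add_mul] at h₂ ⊢
    omega

theorem unit_eq {f g : γ → Unit} : PolyTime A fun c => decide (f c = g c) := by
  simpa using const (A := A) (α := γ) true

end PolyTime

end StackProgram

namespace DefaultLogic

open StackProgram StackProgram.Coded Polynomial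

/-- Finite alphabets are coded in unary, so that equality and case distinction reduce to lists of
bits. The sum type is the alphabet in which a pair of words is written. -/
noncomputable instance : Coded Symb := ⟨fun a => toData (unaryCode a)⟩
noncomputable instance : Coded (Symb ⊕ Fin 2) := ⟨fun a => toData (unaryCode a)⟩
instance : Coded (Literal Var) := ⟨fun l => toData (l.isPos, l.var)⟩
instance : Coded RawInstance := ⟨fun I => toData (I.kb, I.rules, I.backdoor)⟩

end DefaultLogic

namespace StackProgram.PolyTime

open Polynomial Coded DefaultLogic

variable {A : Type} {α β γ δ ν : Type} [Coded α] [Coded β] [Coded γ] [Coded δ] [Coded ν]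

/-! Literals and their values -/

theorem var_eq {f g : γ → Var} (hf : PolyTime A f) (hg : PolyTime A g) :
    PolyTime A fun c => decide (f c = g c) := list_eq (bool_eq id.fst id.snd) hf hg

theorem var_mem {f : γ → Var} {g : γ → List Var} (hf : PolyTime A f) (hg : PolyTime A g) :
    PolyTime A fun c => decide (f c ∈ g c) := by
  convert mem (var_eq id.fst id.snd) hf hg

theorem isPos_var {f : γ → Literal Var} (hf : PolyTime A f) :
    PolyTime A fun c => ((f c).isPos, (f c).var) :=
  (of_toData (f := fun l : Literal Var => (l.isPos, l.var)) fun _ => rfl).comp hf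

theorem isPos {f : γ → Literal Var} (hf : PolyTime A f) : PolyTime A fun c => (f c).isPos :=
  hf.isPos_var.fst

theorem var {f : γ → Literal Var} (hf : PolyTime A f) : PolyTime A fun c => (f c).var :=
  hf.isPos_var.snd

theorem literalMk {s : γ → Bool} {x : γ → Var} (hs : PolyTime A s) (hx : PolyTime A x) :
    PolyTime A fun c => Literal.mk (s c) (x c) :=
  (of_toData (f := fun p : Bool × Var => Literal.mk p.1 p.2) fun p => by
    obtain ⟨_ | _, x⟩ := p <;> rfl).comp (hs.pair hx)

theorem literal_eq {f g : γ → Literal Var} (hf : PolyTime A f) (hg : PolyTime A g) :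
    PolyTime A fun c => decide (f c = g c) := by
  have := (bool_eq hf.isPos hg.isPos).and (var_eq hf.var hg.var)
  convert this using 2 with c
  cases f c <;> cases g c <;> simp [Literal.isPos, Literal.var] <;> congr

theorem literalEval {w : γ → Var → Bool} {f : γ → Literal Var}
    (hw : PolyTime A fun x : γ × Var => w x.1 x.2) (hf : PolyTime A f) :
    PolyTime A fun c => (f c).eval (w c) := by
  have := hf.isPos.ite (hw.comp₂ id hf.var) (hw.comp₂ id hf.var).not
  convert this using 2 with c
  cases f c <;> simp [Literal.isPos, Literal.var, Literal.eval]

theorem evalClause {w : γ → Var → Bool} {f : γ → List (Literal Var)}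
    (hw : PolyTime A fun x : γ × Var => w x.1 x.2) (hf : PolyTime A f) :
    PolyTime A fun c => RawCNF.evalClause (w c) (f c) :=
  any (p := fun c l => Literal.eval (w c) l) hf (literalEval hw.weaken₂ id.snd)

theorem evalCNF {w : γ → Var → Bool} {r : γ → RawCNF}
    (hw : PolyTime A fun x : γ × Var => w x.1 x.2) (hr : PolyTime A r) :
    PolyTime A fun c => RawCNF.eval (w c) (r c) :=
  all (p := fun c C => RawCNF.evalClause (w c) C) hr (evalClause hw.weaken₂ id.snd)

section

variable {B v : γ → List Var} {r a : γ → RawCNF} {L M : γ → List (List Var)} {I : γ → RawInstance}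
  {l : γ → List (RawCNF × RawCNF × RawCNF)} {d : γ → RawCNF × RawCNF × RawCNF}

theorem greatest (hB : PolyTime A B) (hv : PolyTime A v) :
    PolyTime A fun x : γ × Var => RawCNF.greatest (B x.1) (v x.1) x.2 :=
  (var_mem id.snd hv.weaken).or (var_mem id.snd hB.weaken).not

theorem least (hB : PolyTime A B) (hv : PolyTime A v) (hr : PolyTime A r) :
    PolyTime A fun x : γ × Var => RawCNF.least (B x.1) (v x.1) (r x.1) x.2 :=
  (var_mem id.snd hv.weaken).or <| (var_mem id.snd hB.weaken).not.and <|
    any (p := fun (x : γ × Var) C =>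
      !RawCNF.evalClause (fun y => decide (y ∈ v x.1)) C && decide (Literal.pos x.2 ∈ C))
    hr.weaken <| (evalClause (w := fun (x : (γ × Var) × List (Literal Var)) y =>
      decide (y ∈ v x.1.1)) (var_mem id.snd hv.weaken.weaken.weaken) id.snd).not.and <|
    mem (literal_eq id.fst id.snd) ((const true).literalMk id.fst.snd) id.snd

theorem entails (hB : PolyTime A B) (hL : PolyTime A L) (hr : PolyTime A r) (ha : PolyTime A a) :
    PolyTime A fun c => RawCNF.entails (B c) (L c) (r c) (a c) :=
  all (p := fun c v => !(r c).eval (RawCNF.greatest (B c) v) ||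
    (a c).eval (RawCNF.least (B c) v (r c))) hL <|
    (evalCNF (greatest hB.weaken id.snd) hr.weaken).not.or
      (evalCNF (least hB.weaken id.snd hr.weaken) ha.weaken)

/-! Rules and extensions -/

theorem instance_toProd (hI : PolyTime A I) :
    PolyTime A fun c => ((I c).kb, (I c).rules, (I c).backdoor) :=
  (of_toData (f := fun J : RawInstance => (J.kb, J.rules, J.backdoor)) fun _ => rfl).comp hI

theorem kb (hI : PolyTime A I) : PolyTime A fun c => (I c).kb := hI.instance_toProd.fst

theorem rules (hI : PolyTime A I) : PolyTime A fun c => (I c).rules := hI.instance_toProd.snd.fst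

theorem backdoor (hI : PolyTime A I) : PolyTime A fun c => (I c).backdoor :=
  hI.instance_toProd.snd.snd

theorem conclusions (hI : PolyTime A I) (hl : PolyTime A l) :
    PolyTime A fun c => (I c).conclusions (l c) :=
  hI.kb.flatten.append (flatMap (g := fun _ d => d.2.2) hl id.snd.snd.snd)

theorem applicable (hB : PolyTime A B) (hL : PolyTime A L) (hM : PolyTime A M)
    (hr : PolyTime A r) (hd : PolyTime A d) :
    PolyTime A fun c => RawInstance.applicable (B c) (L c) (M c) (r c) (d c) :=
  (entails hB hL hr hd.fst).and <|
    any (p := fun c v => (d c).2.1.eval (RawCNF.greatest (B c) v)) hM <|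
      evalCNF (greatest hB.weaken id.snd) hd.weaken.snd.fst

theorem applyRules (hI : PolyTime A I) (hB : PolyTime A B) (hL : PolyTime A L)
    (hM : PolyTime A M) (hl : PolyTime A l) :
    PolyTime A fun c => (I c).applyRules (B c) (L c) (M c) (l c) :=
  filter (p := fun c d =>
    RawInstance.applicable (B c) (L c) (M c) ((I c).conclusions (l c)) d) hI.rules <|
    applicable hB.weaken hL.weaken hM.weaken (hI.conclusions hl).weaken id.snd

/-- Each state of the fold is a filter of `I.rules`, so the sizes do not accumulate over the rounds.
-/
theorem closure (hI : PolyTime A I) (hB : PolyTime A B) (hL : PolyTime A L)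
    (hM : PolyTime A M) : PolyTime A fun c => (I c).closure (B c) (L c) (M c) := by
  obtain ⟨P, hP⟩ := hI.rules.exists_size_le
  refine hI.conclusions (foldl (h := fun c l _ => (I c).applyRules (B c) (L c) (M c) l)
    (g := fun _ => []) hI.rules (const []) (applyRules hI.weaken hB.weaken hL.weaken
      hM.weaken id.snd.fst) P fun c l _ => le_trans (size_le_of_sublist ?_) (hP c))
  rcases List.eq_nil_or_concat l with rfl | ⟨l, d, rfl⟩
  · exact List.nil_sublist _
  · rw [List.concat_eq_append, List.foldl_append]
    exact List.filter_sublist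

theorem accepts (hI : PolyTime A I) (hB : PolyTime A B) (hL : PolyTime A L)
    (hM : PolyTime A M) : PolyTime A fun c => (I c).accepts (B c) (L c) (M c) :=
  list_eq (list_eq (var_eq id.fst id.snd) id.fst id.snd) hM <|
    filter (p := fun c v => ((I c).closure (B c) (L c) (M c)).eval (RawCNF.greatest (B c) v)) hL <|
      evalCNF (greatest hB.weaken id.snd) (hI.closure hB hL hM).weaken

end

end StackProgram.PolyTime

namespace StackProgram.PolyTime

open Polynomial Coded DefaultLogic

variable {A : Type} {α β γ δ ν : Type} [Coded α] [Coded β] [Coded γ] [Coded δ] [Coded ν]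

/-! Reading the input -/

theorem symb_eq {f g : γ → Symb} (hf : PolyTime A f) (hg : PolyTime A g) :
    PolyTime A fun c => decide (f c = g c) :=
  (fintype_eq fun _ => rfl).comp₂ (g := fun x y => decide (x = y)) hf hg

theorem parseStep {s : γ → ParseState} {a : γ → Symb} (hs : PolyTime A s) (ha : PolyTime A a) :
    PolyTime A fun c => DefaultLogic.parseStep (s c) (a c) := by
  have : Inhabited Symb := ⟨.pos⟩
  refine fintype_cases (fun _ => rfl) (f := fun c a => DefaultLogic.parseStep (s c) a) ha fun a => ?_
  have hv := hs.fst
  have hl := hs.snd.fst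
  have hc := hs.snd.snd.fst
  have hf := hs.snd.snd.snd.fst
  have hp := hs.snd.snd.snd.snd.fst
  have hq := hs.snd.snd.snd.snd.snd
  cases a with
  | bit b => exact ((const b).cons hv).pair hs.snd
  | pos => exact hv.pair ((const true).pair hs.snd.snd)
  | neg => exact hv.pair ((const false).pair hs.snd.snd)
  | endVar =>
    exact (const []).pair ((const true).pair (((hl.literalMk hv.reverse).cons hc).pair
      hs.snd.snd.snd))
  | endClause =>
    exact hv.pair (hl.pair ((const []).pair ((hc.reverse.cons hf).pair hs.snd.snd.snd.snd)))
  | endFormula => exact hv.pair (hl.pair (hc.pair ((const []).pair ((hf.reverse.cons hp).pair hq))))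
  | endPart =>
    exact hv.pair (hl.pair ((const []).pair (hf.pair ((const []).pair
      ((hp.reverse.pair hc.reverse).cons hq)))))

@[simp] theorem size_literalMk (s : Bool) (x : Var) :
    size (Literal.mk s x) = size s + size x + 1 := by
  cases s <;> exact size_mk _ _

/-- A step only rearranges components of the state and adds a bounded number of nodes, so parsing
needs linear size. -/
theorem size_parseStep_le (s : ParseState) (a : Symb) :
    size (DefaultLogic.parseStep s a) ≤ size s + 10 := by
  obtain ⟨v, l, c, f, p, q⟩ := s
  have hb : ∀ b : Bool, 1 ≤ size b ∧ size b ≤ 3 := fun b => ⟨size_pos b, size_bool_le b⟩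
  have hl := hb l
  have ht := hb true
  have hf := hb false
  have hv := size_pos v
  cases a with
  | bit b =>
    have := hb b
    simp [DefaultLogic.parseStep]; omega
  | _ => simp [DefaultLogic.parseStep]; omega

theorem parseParts {x : γ → List Symb} (hx : PolyTime A x) :
    PolyTime A fun c => DefaultLogic.parseParts (x c) :=
  (foldl_of_growth (h := fun _ s a => DefaultLogic.parseStep s a)
    (g := fun _ => ([], true, [], [], [], [])) hx (const _) (parseStep id.snd.fst id.snd.snd) 10
    fun c a _ s => by simpa using size_parseStep_le s a).snd.snd.snd.snd.snd

theorem triples {f : γ → List α} (hf : PolyTime A f) :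
    PolyTime A fun c => DefaultLogic.triples (f c) := by
  obtain ⟨P, hP⟩ := hf.exists_size_le
  refine (foldl_of_growth (h := fun _ s a => tripleStep s a) (g := fun _ => ([], [])) hf (const _)
    (ite id.snd.fst.fst.tail.isEmpty ((id.snd.snd.cons id.snd.fst.fst).pair id.snd.fst.snd)
      ((const []).pair (((id.snd.fst.fst.tail.headD id.snd.snd).pair
        ((id.snd.fst.fst.headD id.snd.snd).pair id.snd.snd)).cons id.snd.fst.snd))) (P + 10)
    fun c a ha s => ?_).snd.reverse
  have h₁ := size_le_of_mem ha
  have h₂ := hP c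
  obtain ⟨s, t⟩ := s
  rcases s with _ | ⟨x, _ | ⟨y, s⟩⟩ <;> simp [tripleStep] <;> omega

theorem parse {x : γ → List Symb} (hx : PolyTime A x) :
    PolyTime A fun c => DefaultLogic.parse (x c) := by
  have hp := hx.parseParts
  exact (of_toData (f := fun J : List RawCNF × List (RawCNF × RawCNF × RawCNF) × List Var =>
    RawInstance.mk J.1 J.2.1 J.2.2) fun _ => rfl).comp <|
      (hp.tail.tail.headD (const ([], []))).fst.pair <|
        (hp.tail.headD (const ([], []))).fst.triples.pair <|
          map (g := fun _ l => Literal.var l) (hp.headD (const ([], []))).snd id.snd.var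

/-! Writing instances -/

theorem encodeListWith {f : γ → List α} {t : Symb} {h : α → List Symb} (hf : PolyTime A f)
    (hh : PolyTime A h) : PolyTime A fun c => DefaultLogic.encodeListWith t h (f c) :=
  (flatMap (g := fun _ a => h a) hf (hh.comp id.snd)).append (const [t])

theorem encodeVar : PolyTime A DefaultLogic.encodeVar := by
  have h : PolyTime A Symb.bit := by
    have := ite (A := A) id (const (Symb.bit true)) (const (Symb.bit false))
    convert this using 2 with b
    cases b <;> rfl
  exact encodeListWith (h := fun b => [Symb.bit b]) id (h.cons (const []))

theorem encodeLiteral : PolyTime A DefaultLogic.encodeLiteral := by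
  have := ((isPos id).ite (const Symb.pos) (const Symb.neg)).cons (encodeVar.comp (var (A := A) id))
  convert this using 2 with l
  cases l <;> rfl

theorem encodeCNF : PolyTime A DefaultLogic.encodeCNF :=
  encodeListWith id (encodeListWith id encodeLiteral)

theorem encodeDefault : PolyTime A DefaultLogic.encodeDefault :=
  ((encodeCNF.comp id.fst).append (encodeCNF.comp id.snd.fst)).append (encodeCNF.comp id.snd.snd)

theorem encode {I : γ → RawInstance} (hI : PolyTime A I) : PolyTime A fun c => (I c).encode :=
  (encodeListWith hI.kb encodeCNF).append <|
    (encodeListWith hI.rules encodeDefault).append (encodeListWith hI.backdoor encodeVar)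

/-! The search -/

theorem sublistsUpTo {n : γ → List ν} {l : γ → List α} (hn : PolyTime A n) (hl : PolyTime A l) :
    PolyTime A fun c => DefaultLogic.sublistsUpTo (n c) (l c) := by
  obtain ⟨N, hN⟩ := hn.exists_size_le
  obtain ⟨P, hP⟩ := hl.exists_size_le
  refine foldl (h := fun c s a => (s ++ s.map (a :: ·)).take (n c).length) (g := fun _ => [[]])
    hl.reverse (const _) (take_length hn.weaken (id.snd.fst.append (map (g := fun x s => x.2.2 :: s)
      id.snd.fst (id.fst.snd.snd.cons id.snd)))) ((N + 1) * (P + 2) + 1) fun c m hm => ?_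
  -- The invariant is that an entry and the unread rest together have size at most `K`: putting an
  -- element in front of an entry removes it from the rest.
  have key : ∀ (m : List α) (K : ℕ) (s : List (List α)), (∀ e ∈ s, size e + size m ≤ K) →
      ∀ e ∈ m.foldl (fun s a => (s ++ s.map (a :: ·)).take (n c).length) s, size e ≤ K := by
    intro m K
    induction m with
    | nil => intro s hs e he; exact (Nat.le_add_right _ _).trans (hs e he)
    | cons a m ih =>
      refine fun s hs => ih _ fun e he => ?_
      rcases List.mem_append.1 (List.mem_of_mem_take he) with h | h
      · have := hs e h
        simp at this; omega
      · obtain ⟨e', he', rfl⟩ := List.mem_map.1 h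
        have := hs e' he'
        simp at this ⊢; omega
  -- The summand `1` covers the initial list `[[]]`, which has not been truncated.
  have hlen : (m.foldl (fun s a => (s ++ s.map (a :: ·)).take (n c).length) [[]]).length ≤
      (n c).length + 1 := by
    rcases List.eq_nil_or_concat m with rfl | ⟨m, a, rfl⟩
    · simp
    · rw [List.concat_eq_append, List.foldl_append]
      exact (List.length_take_le _ _).trans (Nat.le_succ _)
  have h₁ : size m ≤ P.eval (size c) := by
    have := size_le_of_sublist hm.sublist
    rw [size_reverse] at this
    exact this.trans (hP c)
  have h₂ := size_le_of_forall (key m (P.eval (size c) + 1) [[]] (by simp; omega))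
  have h₃ := (length_lt_size (n c)).trans_le (hN c)
  simp only [eval_add, eval_mul, eval_one, eval_ofNat]
  exact h₂.trans (Nat.succ_le_succ (Nat.mul_le_mul (by omega) (by omega)))

theorem distinct {l : γ → List Var} (hl : PolyTime A l) :
    PolyTime A fun c => DefaultLogic.distinct (l c) := by
  obtain ⟨P, hP⟩ := hl.exists_size_le
  refine foldl_of_growth (h := fun _ s a => if decide (a ∈ s) = true then s else a :: s)
    (g := fun _ => []) hl (const _) ((var_mem id.snd.snd id.snd.fst).ite id.snd.fst
      (id.snd.snd.cons id.snd.fst)) (P + 1) fun c a ha s => ?_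
  have h₁ := size_le_of_mem ha
  have h₂ := hP c
  split_ifs <;> simp; omega

section

variable {I : γ → RawInstance} {B : γ → List Var}

theorem clauses (hI : PolyTime A I) : PolyTime A fun c => (I c).clauses :=
  (hI.kb.append (flatMap (g := fun _ (d : RawCNF × RawCNF × RawCNF) => [d.1, d.2.1, d.2.2]) hI.rules
    (id.snd.fst.cons (id.snd.snd.fst.cons (id.snd.snd.snd.cons (const [])))))).flatten

theorem containsVars (hI : PolyTime A I) (hB : PolyTime A B) :
    PolyTime A fun c => (I c).containsVars (B c) :=
  all (p := fun c x => (I c).clauses.any fun C => C.any fun l => decide (l.var = x)) hB <|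
    any (p := fun (x : γ × Var) C => C.any fun l => decide (l.var = x.2)) hI.clauses.weaken <|
      any (p := fun (x : (γ × Var) × List (Literal Var)) (l : Literal Var) =>
        decide (l.var = x.1.2)) id.snd (var_eq id.snd.var id.fst.fst.snd)

theorem isPositiveOutside (hI : PolyTime A I) (hB : PolyTime A B) :
    PolyTime A fun c => (I c).isPositiveOutside (B c) :=
  all (p := fun c (C : List (Literal Var)) => C.all fun l => decide (l.var ∈ B c) ||
    (l.isPos && C.all fun l' => decide (l'.var ∈ B c) || decide (l' = l))) hI.clauses <|
  all (p := fun (x : γ × List (Literal Var)) (l : Literal Var) => decide (l.var ∈ B x.1) ||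
    (l.isPos && x.2.all fun l' => decide (l'.var ∈ B x.1) || decide (l' = l))) id.snd <|
  (var_mem id.snd.var hB.weaken.weaken).or <| id.snd.isPos.and <|
  all (p := fun (x : (γ × List (Literal Var)) × Literal Var) (l' : Literal Var) =>
    decide (l'.var ∈ B x.1.1) || decide (l' = x.2)) id.fst.snd <|
  (var_mem id.snd.var hB.weaken.weaken.weaken).or (literal_eq id.snd id.fst.snd)

theorem search {test : List (List Var) → Bool} (ht : PolyTime A test) {n : γ → List Bool}
    (hn : PolyTime A n) (hI : PolyTime A I) (hB : PolyTime A B) :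
    PolyTime A fun c => (I c).search test (n c) (B c) :=
  any (p := fun c M => (I c).accepts (B c) (DefaultLogic.sublistsUpTo (n c) (B c)) M && test M)
    (hn.sublistsUpTo (hn.sublistsUpTo hB)) <|
    (accepts hI.weaken hB.weaken (hn.sublistsUpTo hB).weaken id.snd).and (ht.comp id.snd)

theorem decision {test : List (List Var) → Bool} (ht : PolyTime A test) {x : γ → List Symb}
    {y : γ → List Bool} (hx : PolyTime A x) (hy : PolyTime A y) :
    PolyTime A fun c => DefaultLogic.decision test (x c) (y c) := by
  have hI := hx.parse
  have hB := hI.backdoor.distinct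
  exact (list_eq (symb_eq id.fst id.snd) hI.encode hx).and <| (hI.containsVars hB).and <|
    (hI.isPositiveOutside hB).and <| (list_eq unit_eq
      (map (g := fun _ _ => ()) (filter (p := fun _ b => !b) hy id.snd.not) (const ()))
      (map (g := fun _ _ => ()) hB (const ()))).and (search ht hy hI hB)

end

end StackProgram.PolyTime

/-! ### Assembling the parameterised result -/

namespace DefaultLogic

open StackProgram Computability

theorem computable_paddedParameter :
    Computable fun k => (paddedParameter k).map fun b => (bif b then 1 else 0 : Fin 2) := by
  have hpow : Primrec fun k => 2 ^ k := by
    -- Powers of two arise by repeated doubling.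
    refine (Primrec.nat_rec' (f := fun k : ℕ => k) (g := fun _ => 1) (h := fun _ p => p.2 + p.2)
      Primrec.id (Primrec.const 1) ((Primrec.nat_add.comp (Primrec.snd.comp Primrec.snd)
        (Primrec.snd.comp Primrec.snd)).to₂)).of_eq fun k => ?_
    induction k with
    | zero => rfl
    | succ k ih => rw [pow_succ, ← ih]; simp; omega
  have hrep : ∀ (b : Bool) {f : ℕ → ℕ}, Primrec f → Primrec fun k => List.replicate (f k) b := by
    intro b f hf
    refine (Primrec.list_map (Primrec.list_range.comp hf) (Primrec.const b).to₂).of_eq fun k => ?_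
    simp [List.map_const']
  exact (Primrec.list_map (Primrec.list_append.comp (hrep false Primrec.id)
    (hrep true (hpow.comp hpow))) ((Primrec.dom_finite fun b : Bool =>
      (bif b then 1 else 0 : Fin 2)).comp Primrec.snd).to₂).to_comp

/-- A pair of words is given as one word over the disjoint union of the alphabets. Both components
are recovered by discarding the symbols of the other alphabet, after which `decision` runs; bits of
the padding are written as elements of `Fin 2`. -/
theorem inFPT_of_decision {L : ParamProblem Symb} {test : List (List Var) → Bool}
    (ht : PolyTime (Symb ⊕ Fin 2) test)
    (h : ∀ x k, (x, k) ∈ L ↔ decision test x (paddedParameter k) = true) : InFPT L := by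
  have : Inhabited (Symb ⊕ Fin 2) := ⟨.inr 0⟩
  refine ⟨2, fun k => (paddedParameter k).map fun b => bif b then 1 else 0,
    {p | decision test p.1 (p.2.map fun i => decide (i = 1)) = true},
    computable_paddedParameter, ?_, fun x k => ?_⟩
  · have hsum : ∀ {β : Type} [Coded β] (g : Symb ⊕ Fin 2 → β), PolyTime (Symb ⊕ Fin 2)
        fun x : List (Symb ⊕ Fin 2) × (Symb ⊕ Fin 2) => g x.2 := fun g =>
      PolyTime.fintype_cases (f := fun _ a => g a) (fun _ => rfl) PolyTime.id.snd
        fun a => PolyTime.const _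
    have hf := PolyTime.decision ht
      (PolyTime.flatMap (g := fun _ => Sum.elim (fun s => [s]) fun _ => []) PolyTime.id (hsum _))
      (PolyTime.flatMap (g := fun _ => Sum.elim (fun _ => []) fun i => [decide (i = 1)])
        PolyTime.id (hsum _))
    refine hf.inP ?_
    rintro ⟨x, y⟩
    have hx : (x.map Sum.inl ++ y.map Sum.inr).flatMap
        (Sum.elim (fun s => [s]) fun _ : Fin 2 => []) = x := by
      simp [List.flatMap_map]
    have hy : (x.map Sum.inl ++ y.map Sum.inr).flatMap
        (Sum.elim (fun _ : Symb => []) fun i : Fin 2 => [decide (i = 1)]) =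
        y.map fun i => decide (i = 1) := by
      rw [List.flatMap_append, List.flatMap_map, List.flatMap_map]
      simp [← List.map_eq_flatMap]
    have he : (encodingProd (encodingList Symb) (encodingList (Fin 2))).encode (x, y) =
        x.map Sum.inl ++ y.map Sum.inr := rfl
    rw [he, hx, hy, Set.mem_ofPred_eq]
  · have hy : ((paddedParameter k).map fun b => (bif b then 1 else 0 : Fin 2)).map
        (fun i => decide (i = 1)) = paddedParameter k := by
      rw [List.map_map]
      convert List.map_id _ using 2
      funext b
      cases b <;> rfl
    rw [h, Set.mem_ofPred_eq, hy]

end DefaultLogic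

theorem mainTheorem6 :
    DefaultLogic.InFPT (DefaultLogic.SBDexpl DefaultLogic.classCNF DefaultLogic.classID) ∧
      DefaultLogic.InFPT
        (DefaultLogic.consistentSBDexpl DefaultLogic.classCNF DefaultLogic.classID) :=
  ⟨DefaultLogic.inFPT_of_decision (StackProgram.PolyTime.const true)
      DefaultLogic.mem_SBDexpl_iff,
    DefaultLogic.inFPT_of_decision StackProgram.PolyTime.id.isEmpty.not
      DefaultLogic.mem_consistentSBDexpl_iff⟩
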